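/- **Setting.** A public/secret key pair is identified with its public key $k^+$. A *principal value* is $\mathrm{prin}(k,K)$ with $K$ a finite set of public keys. *Values* are integers, public keys, ciphertexts $\{v\}^n_K$ (content $v$, nonce $n$, set $K$ of keys, any one of which opens it), encapsulated principals $\{\mathrm{prin}(k,K')\}^n_K$, arrays of values, and an error value $\mathrm{NaV}$. *Base types* are $S::=\mathrm{PubKey}\mid\mathrm{SecKey}\mid\mathrm{Int}\mid\mathrm{Cipher}(S)\mid\mathrm{Array}(S)$, and $\mathrm{NaV}$ belongs to every type. *Rights* $R$ are either $\bot$ (public) or a finite set of names of keys and of principals' public keys $\mathrm{pub}(p)$; the evaluation $M(R)$ in a memory $M$ is $\bot$ or a finite set of public keys. Write $R_1\subseteq R_2$ ("$R_1$ is at least as confidential as $R_2$") if $R_2=\bot$ or both are sets and $R_1$ is a subset of $R_2$; $R\cap\bot=R$. A *device* $\langle M\triangleright C_1\mid\dots\mid C_m\rangle$ has a memory $M$, which maps locations to values (variables), principals or public keys, and parallel threads. A *system* $\nu\bar c.\,D_1\mid\dots\mid D_n$ consists of devices with fixed indices and a list of established channels. Expressions are variables, integers, $\mathrm{pub}(p)$,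 $\mathrm{release}(p)$ (which encrypts the principal $\mathrm{prin}(k,K)$ of $p$ under $K$), $\mathrm{enc}_{RS}(e)$ (encryption with a fresh nonce), integer operations, arrays and $x[e]$. Run-time errors in expressions never block; they give $\mathrm{NaV}$. Commands are $\mathbf{if}\ e_1=e_2\ \mathbf{then}\ C_1\ \mathbf{else}\ C_2$; $\mathbf{new}\ x:S_R=e;C$; $x:=e;C$; $x[e_1]:=e_2;C$ (an erroneous write has no effect); $\mathbf{let}\ k=e\ \mathbf{in}\ C$ (declare a key name); $C_1\mid C_2$; $\mathbf{skip}$; $!C$; $\mathbf{newPrin}\ p\ RS;C$; $\mathbf{connect}/\mathbf{accept}$ on public channels $c:\mathrm{Chan}(S_\bot)_\bot$ or on secure channels $c:\mathrm{Chan}(S_{R_1})_{R_2}$ between the principal $p$ and the key $k$ (both devices must name each other's keys and agree on $S$, $M(R_1)$, $M(R_2)$); output and input on a channel; decryption with $p$ into a new variable $x:S_{RS}$ with a failure branch (it succeeds iff the value is $\{v\}^n_K$ with the key of $p$ in $K$ and $M(RS)\subseteq K$); registration of a released principal, with a failure branch; and $\mathbf{synchronised}\{G\};C$, which runs the block $G$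 (built from conditionals, new variables, assignments, decryption, registration, parallel composition and skip) to completion without interleaving and then continues with $C$, in which the names declared in $G$ have been replaced. Executing a declaration replaces the declared name by a fresh run-time name. Fresh names, keys and nonces are never reused. $\to$ is one reduction of one thread or one interaction of two distinct devices, and $\to^*$ is its reflexive transitive closure. *Typing* is relative to a program counter $pc$ (a right), the declared principals and keys, channel types and variable types. Expressions: integers, $\mathrm{pub}(p)$ and $\mathrm{release}(p)$ have public types; an operation or $x[e]$ has the intersection of the rights of its operands; all entries of an array have the same $S_R$; $\mathrm{enc}_{RS}(e):\mathrm{Cipher}(S)_\bot$ if $e:S_R$ with $RS\subseteq R$. Commands: $\mathbf{newPrin}$, $\mathbf{let}$ (for $e:\mathrm{PubKey}_\bot$), registration (of $e:\mathrm{SecKey}_\bot$) and opening a public channel require $pc=\bot$; $\mathbf{new}\ x:S_{R_1}=e$ requires $e:S_{R_2}$, $R_1\subseteq pc\cap R_2$, and that $R_1$ is $\bot$ or contains $\mathrm{pub}(p)$ for a declared principal $p$; $x:=e$ requires the right of $x$ to be $\subseteq pc\cap R_e$, and $x[e_1]:=e_2$ requires it to be $\subseteq pc\cap R_{e_1}\cap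 R_{e_2}$; the branches of a conditional on $e_1:S_{R_1}$, $e_2:S_{R_2}$ are typed with $pc\cap R_1\cap R_2$; decryption of $e:\mathrm{Cipher}(S)_{R_2}$ requires $\mathrm{pub}(p)\in RS\subseteq R_2\cap pc$ and types its branches with $pc\cap R_2$; a secure channel requires $\{\mathrm{pub}(p),k\}\subseteq R_1\subseteq R_2\subseteq pc$, and its continuation has program counter $R_2$; output of $e:S_{R_3}$ on $\mathrm{Chan}(S_{R_1})_{R_2}$ requires $pc=R_2$ and $R_1\subseteq R_3$; input requires $pc=R_2$ and declares $x:S_{R_1}$; $\mathbf{synchronised}\{G\};C$ is typed as $G$ with every final skip replaced by $C$. All rights in declarations, encryptions and channels mention declared names only. A system is *valid initial* (without untyped attacker) if no channel is established; all memory locations contain public keys or principals of the form $\mathrm{prin}(k,\emptyset)$; no principal occurs on two devices; and on every device the command declares no name twice and is typable with $pc=\bot$ in the context given by its memory. A variable location *has creation rights* $M(R)$ if it was created by $\mathbf{new}\ x:S_R$, by a decryption into $x:S_R$, or by an input on a channel whose payload right was $R$, evaluated on creation (for an input: when the channel was established). For evaluated rights $L$, the *obfuscation* $\mathrm{erase}_L(v)$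 replaces, everywhere in $v$, the content of each ciphertext or encapsulated principal $\{\cdot\}^n_K$ with $K\subseteq L$ by a placeholder, keeping $n$ and $K$. For a system $P'$, a variable location $a$ of its $i$-th device, and a value $v$, let $P'_{i:a=v}$ be $P'$ with the additional parallel thread $a:=v$ on device $i$. **Theorem.** Let $P$ be a valid initial system and $P\to^*P_0$, where the $i$-th device of $P_0$ is $\langle M\triangleright \mathbf{new}\ x:S_R=e;C\mid C'\rangle$. Let $L=M(R)$, let $P_0\to P_1$ be the reduction that executes this declaration, and let $a$ be the location it creates. Let $P_1\to^*P'\to^*P''$ and let $v$ be any value of type $S$. Then there are $Q'$, $Q''$ with $$P'_{i:a=v}\to Q'\to^*Q'',$$ where the first step executes the additional assignment $a:=v$, such that $P''$ and $Q''$ agree below $L$: for every device $j$ and every location $y$ of a variable with creation rights $L_y\not\subseteq L$ in the $j$-th device of $P''$, $y$ is also a variable location with creation rights $L_y$ in the $j$-th device of $Q''$, and the values $v_P$, $v_Q$ of $y$ in $P''$ and $Q''$ satisfy $\mathrm{erase}_L(v_P)=\mathrm{erase}_L(v_Q)$; and the same holds with $P''$ and $Q''$ exchanged. -/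

import Mathlib

namespace CloudTypes

/-- Key pairs are identified by the seed they are generated from. -/
abbrev Key := ℕ

/-- Names are either program names (written in the source code and bound by a declaration) or
run-time names (memory locations and established channels).  A declaration that is executed replaces
its program name by a fresh run-time name. -/
inductive Name where
  | prog (n : ℕ)
  | run (n : ℕ)
deriving DecidableEq

/-- An element of a static right: the public key of a principal, or a key name. -/
inductive KeyRef where
  | pub (p : Name)
  | key (k : Name)
deriving DecidableEq

/-- Static rights.  The top element stands for the public right (no restriction), so that
`R₁ ≤ R₂` says that `R₁` is at least as confidential as `R₂` (`R₂` is public, or `R₁` is a syntactic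
subset of `R₂`), and `R₁ ⊓ R₂` is the syntactic intersection. -/
abbrev Rights := WithTop (Finset KeyRef)

/-- Evaluated rights: sets of public keys, or `⊤` for the public right. -/
abbrev Label := WithTop (Finset Key)

/-- Base types. -/
inductive Ty where
  | pubKey
  | secKey
  | int
  | cipher (S : Ty)
  | arr (S : Ty)

/-- A principal value: a key pair, and the set of public keys that protects it when it is released. -/
structure Principal where
  key : Key
  rights : Finset Key

/-- Values.  `enc v n K` is a ciphertext of `v` with seed `n` for the set `K` of public keys,
`encPrin` is an encapsulated principal, `nav` the error value. -/
inductive Value where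
  | int (i : ℤ)
  | pub (k : Key)
  | enc (v : Value) (n : ℕ) (K : Finset Key)
  | encPrin (P : Principal) (n : ℕ) (K : Finset Key)
  | array (m : ℕ) (vs : Fin m → Value)
  | nav

/-- Values of a base type; the error value may occur at every type. -/
inductive Value.HasType : Value → Ty → Prop
  | int (i : ℤ) : HasType (.int i) .int
  | pub (k : Key) : HasType (.pub k) .pubKey
  | enc {v S} (n : ℕ) (K : Finset Key) : HasType v S → HasType (.enc v n K) (.cipher S)
  | encPrin (P : Principal) (n : ℕ) (K : Finset Key) : HasType (.encPrin P n K) .secKey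
  | array {m S} {vs : Fin m → Value} : (∀ i, HasType (vs i) S) → HasType (.array m vs) (.arr S)
  | nav (S : Ty) : HasType .nav S

/-- Obfuscated values: as values, with ciphertexts whose content is hidden. -/
inductive ObfValue where
  | int (i : ℤ)
  | pub (k : Key)
  | enc (v : ObfValue) (n : ℕ) (K : Finset Key)
  | encPrin (P : Principal) (n : ℕ) (K : Finset Key)
  | encHidden (n : ℕ) (K : Finset Key)
  | array (m : ℕ) (vs : Fin m → ObfValue)
  | nav

open Classical in
/-- Obfuscation under `L`: the content of every ciphertext all of whose keys are in `L` is erased. -/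
noncomputable def Value.erase (L : Label) : Value → ObfValue
  | .int i => .int i
  | .pub k => .pub k
  | .enc v n K => if (K : Label) ≤ L then .encHidden n K else .enc (v.erase L) n K
  | .encPrin P n K => if (K : Label) ≤ L then .encHidden n K else .encPrin P n K
  | .array m vs => .array m fun i => (vs i).erase L
  | .nav => .nav

/-- Integer operations; `none` is a run-time error. -/
def Value.applyOp (f : ℤ → ℤ → Option ℤ) : Value → Value → Value
  | .int i, .int j => ((f i j).map Value.int).getD .nav
  | _, _ => .nav

/-- Reading an array; all run-time errors give the error value. -/
def Value.getAt : Value → Value → Value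
  | .array m vs, .int i => if h : 0 ≤ i ∧ i.toNat < m then vs ⟨i.toNat, h.2⟩ else .nav
  | _, _ => .nav

/-- Writing into an array; an erroneous write has no effect. -/
def Value.setAt : Value → Value → Value → Value
  | .array m vs, .int i, w =>
      if h : 0 ≤ i ∧ i.toNat < m then .array m (Function.update vs ⟨i.toNat, h.2⟩ w)
      else .array m vs
  | v, _, _ => v

/-- Expressions.  In programs the only literals are integers (see the typing rules); the other
literals serve to write an assignment of an arbitrary value. -/
inductive Expr where
  | var (x : Name)
  | pub (p : Name)
  | release (p : Name)
  | enc (e : Expr) (RS : Finset KeyRef)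
  | op (f : ℤ → ℤ → Option ℤ) (e₁ e₂ : Expr)
  | array (m : ℕ) (es : Fin m → Expr)
  | index (x : Name) (e : Expr)
  | lit (v : Value)

/-- Commands.  Declared names are given by the number of the program name. -/
inductive Cmd where
  /-- `if e₁ = e₂ then C₁ else C₂` -/
  | ite (e₁ e₂ : Expr) (C₁ C₂ : Cmd)
  /-- `new x : S_R = e; C` -/
  | new (x : ℕ) (S : Ty) (R : Rights) (e : Expr) (C : Cmd)
  /-- `x := e; C` -/
  | assign (x : Name) (e : Expr) (C : Cmd)
  /-- `x[e₁] := e₂; C` -/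
  | assignAt (x : Name) (e₁ e₂ : Expr) (C : Cmd)
  /-- `let k = e in C`, which declares a key name -/
  | letKey (k : ℕ) (e : Expr) (C : Cmd)
  | par (C₁ C₂ : Cmd)
  | skip
  | bang (C : Cmd)
  /-- `connect c : Chan(S_⊥)_⊥; C` -/
  | connectPub (c : ℕ) (S : Ty) (C : Cmd)
  /-- `accept c : Chan(S_⊥)_⊥; C` -/
  | acceptPub (c : ℕ) (S : Ty) (C : Cmd)
  /-- `connect c : Chan(S_R₁)_R₂ to k as p; C` -/
  | connect (c : ℕ) (S : Ty) (R₁ R₂ : Rights) (k p : Name) (C : Cmd)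
  /-- `accept c : Chan(S_R₁)_R₂ from k as p; C` -/
  | accept (c : ℕ) (S : Ty) (R₁ R₂ : Rights) (k p : Name) (C : Cmd)
  /-- output of `e` on the channel `c` -/
  | output (e : Expr) (c : Name) (C : Cmd)
  /-- input on the channel `c` into a new variable `x` -/
  | input (c : Name) (x : ℕ) (C : Cmd)
  /-- `synchronised {G}; C` -/
  | sync (G C : Cmd)
  /-- `newPrin p RS; C` -/
  | newPrin (p : ℕ) (RS : Finset KeyRef) (C : Cmd)
  /-- `decrypt e with p as x : S_RS then C₁ else C₂` -/
  | decrypt (p : Name) (e : Expr) (x : ℕ) (S : Ty) (RS : Finset KeyRef) (C₁ C₂ : Cmd)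
  /-- `register e with p as q then C₁ else C₂`, which declares the principal name `q` -/
  | register (p : Name) (e : Expr) (q : ℕ) (C₁ C₂ : Cmd)

/-! ### Replacing a program name by a run-time name -/

def Name.subst (x a : ℕ) : Name → Name
  | .prog y => if y = x then .run a else .prog y
  | .run b => .run b

def KeyRef.subst (x a : ℕ) : KeyRef → KeyRef
  | .pub p => .pub (p.subst x a)
  | .key k => .key (k.subst x a)

def substKeys (x a : ℕ) (RS : Finset KeyRef) : Finset KeyRef := RS.image (KeyRef.subst x a)

def substRights (x a : ℕ) (R : Rights) : Rights := WithTop.map (substKeys x a) R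

def Expr.subst (x a : ℕ) : Expr → Expr
  | .var y => .var (y.subst x a)
  | .pub p => .pub (p.subst x a)
  | .release p => .release (p.subst x a)
  | .enc e RS => .enc (e.subst x a) (substKeys x a RS)
  | .op f e₁ e₂ => .op f (e₁.subst x a) (e₂.subst x a)
  | .array m es => .array m fun i => (es i).subst x a
  | .index y e => .index (y.subst x a) (e.subst x a)
  | .lit v => .lit v

def Cmd.subst (x a : ℕ) : Cmd → Cmd
  | .ite e₁ e₂ C₁ C₂ => .ite (e₁.subst x a) (e₂.subst x a) (C₁.subst x a) (C₂.subst x a)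
  | .new y S R e C =>
      .new y S (substRights x a R) (e.subst x a) (if y = x then C else C.subst x a)
  | .assign y e C => .assign (y.subst x a) (e.subst x a) (C.subst x a)
  | .assignAt y e₁ e₂ C => .assignAt (y.subst x a) (e₁.subst x a) (e₂.subst x a) (C.subst x a)
  | .letKey k e C => .letKey k (e.subst x a) (if k = x then C else C.subst x a)
  | .par C₁ C₂ => .par (C₁.subst x a) (C₂.subst x a)
  | .skip => .skip
  | .bang C => .bang (C.subst x a)
  | .connectPub c S C => .connectPub c S (if c = x then C else C.subst x a)
  | .acceptPub c S C => .acceptPub c S (if c = x then C else C.subst x a)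
  | .connect c S R₁ R₂ k p C =>
      .connect c S (substRights x a R₁) (substRights x a R₂) (k.subst x a) (p.subst x a)
        (if c = x then C else C.subst x a)
  | .accept c S R₁ R₂ k p C =>
      .accept c S (substRights x a R₁) (substRights x a R₂) (k.subst x a) (p.subst x a)
        (if c = x then C else C.subst x a)
  | .output e c C => .output (e.subst x a) (c.subst x a) (C.subst x a)
  | .input c y C => .input (c.subst x a) y (if y = x then C else C.subst x a)
  | .sync G C => .sync (G.subst x a) (C.subst x a)
  | .newPrin p RS C => .newPrin p (substKeys x a RS) (if p = x then C else C.subst x a)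
  | .decrypt p e y S RS C₁ C₂ =>
      .decrypt (p.subst x a) (e.subst x a) y S (substKeys x a RS)
        (if y = x then C₁ else C₁.subst x a) (C₂.subst x a)
  | .register p e q C₁ C₂ =>
      .register (p.subst x a) (e.subst x a) q (if q = x then C₁ else C₁.subst x a) (C₂.subst x a)

/-- The substitution recorded by a reduction step, if it executed a declaration. -/
def Cmd.substOpt : Option (ℕ × ℕ) → Cmd → Cmd
  | none, C => C
  | some (x, a), C => C.subst x a

/-- All names declared in a command, with multiplicity. -/
def Cmd.declared : Cmd → List ℕ
  | .ite _ _ C₁ C₂ => C₁.declared ++ C₂.declared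
  | .new x _ _ _ C => x :: C.declared
  | .assign _ _ C => C.declared
  | .assignAt _ _ _ C => C.declared
  | .letKey k _ C => k :: C.declared
  | .par C₁ C₂ => C₁.declared ++ C₂.declared
  | .skip => []
  | .bang C => C.declared
  | .connectPub c _ C => c :: C.declared
  | .acceptPub c _ C => c :: C.declared
  | .connect c _ _ _ _ _ C => c :: C.declared
  | .accept c _ _ _ _ _ C => c :: C.declared
  | .output _ _ C => C.declared
  | .input _ x C => x :: C.declared
  | .sync G C => G.declared ++ C.declared
  | .newPrin p _ C => p :: C.declared
  | .decrypt _ _ x _ _ C₁ C₂ => x :: (C₁.declared ++ C₂.declared)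
  | .register _ _ q C₁ C₂ => q :: (C₁.declared ++ C₂.declared)

/-- The commands `G` that may stand in `synchronised {G}`. -/
def Cmd.IsBlock : Cmd → Prop
  | .ite _ _ G₁ G₂ => G₁.IsBlock ∧ G₂.IsBlock
  | .new _ _ _ _ G => G.IsBlock
  | .assign _ _ G => G.IsBlock
  | .assignAt _ _ _ G => G.IsBlock
  | .decrypt _ _ _ _ _ G₁ G₂ => G₁.IsBlock ∧ G₂.IsBlock
  | .register _ _ _ G₁ G₂ => G₁.IsBlock ∧ G₂.IsBlock
  | .par G₁ G₂ => G₁.IsBlock ∧ G₂.IsBlock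
  | .skip => True
  | _ => False

/-- `G.plug C` is `G{C/skip}`: every final `skip` of the block `G` is replaced by `C`. -/
def Cmd.plug : Cmd → Cmd → Cmd
  | .ite e₁ e₂ G₁ G₂, C => .ite e₁ e₂ (G₁.plug C) (G₂.plug C)
  | .new x S R e G, C => .new x S R e (G.plug C)
  | .assign x e G, C => .assign x e (G.plug C)
  | .assignAt x e₁ e₂ G, C => .assignAt x e₁ e₂ (G.plug C)
  | .decrypt p e x S RS G₁ G₂, C => .decrypt p e x S RS (G₁.plug C) (G₂.plug C)
  | .register p e q G₁ G₂, C => .register p e q (G₁.plug C) (G₂.plug C)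
  | .par G₁ G₂, C => .par (G₁.plug C) (G₂.plug C)
  | .skip, C => C
  | G, _ => G

/-- The parallel threads of a command.  Working with multisets of threads identifies commands up to
associativity and commutativity of `|`, with `skip` as unit. -/
def Cmd.threads : Cmd → Multiset Cmd
  | .par C₁ C₂ => C₁.threads + C₂.threads
  | .skip => 0
  | C => {C}

/-! ### Type system -/

/-- Typing contexts: declared principals and key names, and the types of channels (`(S, R₁, R₂)`
stands for `Chan(S_R₁)_R₂`) and of variables. -/
structure Ctx where
  prin : Set Name
  key : Set Name
  chan : Name → Option (Ty × Rights × Rights)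
  var : Name → Option (Ty × Rights)

def Ctx.addPrin (Γ : Ctx) (p : ℕ) : Ctx := { Γ with prin := insert (.prog p) Γ.prin }

def Ctx.addKey (Γ : Ctx) (k : ℕ) : Ctx := { Γ with key := insert (.prog k) Γ.key }

def Ctx.addChan (Γ : Ctx) (c : ℕ) (S : Ty) (R₁ R₂ : Rights) : Ctx :=
  { Γ with chan := Function.update Γ.chan (.prog c) (some (S, R₁, R₂)) }

def Ctx.addVar (Γ : Ctx) (x : ℕ) (S : Ty) (R : Rights) : Ctx :=
  { Γ with var := Function.update Γ.var (.prog x) (some (S, R)) }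

/-- Well-formed sets of rights: all names in them are declared. -/
def Ctx.WfKeys (Γ : Ctx) (RS : Finset KeyRef) : Prop :=
  (∀ p, KeyRef.pub p ∈ RS → p ∈ Γ.prin) ∧ ∀ k, KeyRef.key k ∈ RS → k ∈ Γ.key

/-- Well-formed rights; the public right is well-formed. -/
def Ctx.WfRights (Γ : Ctx) (R : Rights) : Prop :=
  ∀ RS : Finset KeyRef, R = RS → Γ.WfKeys RS

/-- `ExprTyped Γ e S R`: in the context `Γ`, the expression `e` has type `S_R`. -/
inductive ExprTyped (Γ : Ctx) : Expr → Ty → Rights → Prop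
  | var {x S R} : Γ.var x = some (S, R) → ExprTyped Γ (.var x) S R
  | int (i : ℤ) : ExprTyped Γ (.lit (.int i)) .int ⊤
  | pub {p} : p ∈ Γ.prin → ExprTyped Γ (.pub p) .pubKey ⊤
  | release {p} : p ∈ Γ.prin → ExprTyped Γ (.release p) .secKey ⊤
  | enc {e S R} {RS : Finset KeyRef} : Γ.WfKeys RS → ExprTyped Γ e S R → (RS : Rights) ≤ R →
      ExprTyped Γ (.enc e RS) (.cipher S) ⊤
  | op {f e₁ e₂ R₁ R₂} : ExprTyped Γ e₁ .int R₁ → ExprTyped Γ e₂ .int R₂ →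
      ExprTyped Γ (.op f e₁ e₂) .int (R₁ ⊓ R₂)
  | array {m S R} {es : Fin m → Expr} : Γ.WfRights R → (∀ i, ExprTyped Γ (es i) S R) →
      ExprTyped Γ (.array m es) (.arr S) R
  | index {x e S R₁ R₂} : ExprTyped Γ (.var x) (.arr S) R₁ → ExprTyped Γ e .int R₂ →
      ExprTyped Γ (.index x e) S (R₁ ⊓ R₂)

/-- `CmdTyped pc Γ C`: the command `C` is well-typed with program counter `pc` in the context `Γ`.
The public right is written `⊤` and more confidential rights are smaller. -/
inductive CmdTyped : Rights → Ctx → Cmd → Prop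
  | newPrin {pc Γ p RS C} : Γ.WfKeys RS → pc = ⊤ → CmdTyped pc (Γ.addPrin p) C →
      CmdTyped pc Γ (.newPrin p RS C)
  | new {pc Γ x S R₁ R₂ e C} : Γ.WfRights R₁ → ExprTyped Γ e S R₂ → R₁ ≤ pc ⊓ R₂ →
      (∀ RS : Finset KeyRef, R₁ = RS → ∃ p ∈ Γ.prin, KeyRef.pub p ∈ RS) →
      CmdTyped pc (Γ.addVar x S R₁) C → CmdTyped pc Γ (.new x S R₁ e C)
  | assign {pc Γ x S R₁ R₂ e C} : ExprTyped Γ (.var x) S R₁ → ExprTyped Γ e S R₂ →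
      R₁ ≤ pc ⊓ R₂ → CmdTyped pc Γ C → CmdTyped pc Γ (.assign x e C)
  | assignAt {pc Γ x S R₁ R₂ R₃ e₁ e₂ C} : ExprTyped Γ e₁ .int R₁ → ExprTyped Γ e₂ S R₂ →
      ExprTyped Γ (.var x) (.arr S) R₃ → R₃ ≤ pc ⊓ R₁ ⊓ R₂ → CmdTyped pc Γ C →
      CmdTyped pc Γ (.assignAt x e₁ e₂ C)
  | letKey {pc Γ k e C} : pc = ⊤ → ExprTyped Γ e .pubKey ⊤ → CmdTyped pc (Γ.addKey k) C →
      CmdTyped pc Γ (.letKey k e C)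
  | ite {pc Γ e₁ e₂ S R₁ R₂ C₁ C₂} : ExprTyped Γ e₁ S R₁ → ExprTyped Γ e₂ S R₂ →
      CmdTyped (pc ⊓ R₁ ⊓ R₂) Γ C₁ → CmdTyped (pc ⊓ R₁ ⊓ R₂) Γ C₂ →
      CmdTyped pc Γ (.ite e₁ e₂ C₁ C₂)
  | decrypt {pc Γ p e x S R₂ C₁ C₂} {RS : Finset KeyRef} : Γ.WfKeys RS → KeyRef.pub p ∈ RS →
      p ∈ Γ.prin → ExprTyped Γ e (.cipher S) R₂ → (RS : Rights) ≤ R₂ ⊓ pc →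
      CmdTyped (pc ⊓ R₂) (Γ.addVar x S RS) C₁ → CmdTyped (pc ⊓ R₂) Γ C₂ →
      CmdTyped pc Γ (.decrypt p e x S RS C₁ C₂)
  | register {pc Γ p e q C₁ C₂} : p ∈ Γ.prin → ExprTyped Γ e .secKey ⊤ → pc = ⊤ →
      CmdTyped pc (Γ.addPrin q) C₁ → CmdTyped pc Γ C₂ → CmdTyped pc Γ (.register p e q C₁ C₂)
  | connectPub {pc Γ c S C} : pc = ⊤ → CmdTyped pc (Γ.addChan c S ⊤ ⊤) C →
      CmdTyped pc Γ (.connectPub c S C)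
  | acceptPub {pc Γ c S C} : pc = ⊤ → CmdTyped pc (Γ.addChan c S ⊤ ⊤) C →
      CmdTyped pc Γ (.acceptPub c S C)
  | connect {pc Γ c S R₁ R₂ k p C} : Γ.WfRights R₁ → Γ.WfRights R₂ → p ∈ Γ.prin → k ∈ Γ.key →
      (({KeyRef.pub p, KeyRef.key k} : Finset KeyRef) : Rights) ≤ R₁ → R₁ ≤ R₂ → R₂ ≤ pc →
      CmdTyped R₂ (Γ.addChan c S R₁ R₂) C → CmdTyped pc Γ (.connect c S R₁ R₂ k p C)
  | accept {pc Γ c S R₁ R₂ k p C} : Γ.WfRights R₁ → Γ.WfRights R₂ → p ∈ Γ.prin → k ∈ Γ.key →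
      (({KeyRef.pub p, KeyRef.key k} : Finset KeyRef) : Rights) ≤ R₁ → R₁ ≤ R₂ → R₂ ≤ pc →
      CmdTyped R₂ (Γ.addChan c S R₁ R₂) C → CmdTyped pc Γ (.accept c S R₁ R₂ k p C)
  | output {pc Γ e c S R₁ R₂ R₃ C} : ExprTyped Γ e S R₃ → Γ.chan c = some (S, R₁, R₂) →
      pc = R₂ → R₁ ≤ R₃ →
      CmdTyped pc Γ C → CmdTyped pc Γ (.output e c C)
  | input {pc Γ c x S R₁ R₂ C} : Γ.chan c = some (S, R₁, R₂) → R₂ = pc →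
      CmdTyped pc (Γ.addVar x S R₁) C → CmdTyped pc Γ (.input c x C)
  | par {pc Γ C₁ C₂} : CmdTyped pc Γ C₁ → CmdTyped pc Γ C₂ → CmdTyped pc Γ (.par C₁ C₂)
  | skip {pc Γ} : CmdTyped pc Γ .skip
  | bang {pc Γ C} : CmdTyped pc Γ C → CmdTyped pc Γ (.bang C)
  | sync {pc Γ G C} : G.IsBlock → CmdTyped pc Γ (G.plug C) → CmdTyped pc Γ (.sync G C)

/-! ### Memories and evaluation -/

/-- The content of a memory location: the value of a variable, together with the (evaluated) rights
with which the variable was created, a principal, or a public key.  The rights of a variable are an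
annotation; no reduction depends on them. -/
inductive Cell where
  | var (v : Value) (L : Label)
  | prin (P : Principal)
  | key (k : Key)

abbrev Mem := ℕ → Option Cell

def Mem.get (M : Mem) : Name → Option Cell
  | .run a => M a
  | .prog _ => none

/-- The public key denoted by an element of a right. -/
inductive EvalKey (M : Mem) : KeyRef → Key → Prop
  | pub {p P} : M.get p = some (.prin P) → EvalKey M (.pub p) P.key
  | key {k κ} : M.get k = some (.key κ) → EvalKey M (.key k) κ

/-- `M(RS) = K`. -/
def EvalKeys (M : Mem) (RS : Finset KeyRef) (K : Finset Key) : Prop :=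
  (∀ r ∈ RS, ∃ κ ∈ K, EvalKey M r κ) ∧ ∀ κ ∈ K, ∃ r ∈ RS, EvalKey M r κ

/-- `M(R) = L`. -/
inductive EvalRights (M : Mem) : Rights → Label → Prop
  | top : EvalRights M ⊤ ⊤
  | keys {RS : Finset KeyRef} {K : Finset Key} : EvalKeys M RS K → EvalRights M RS K

/-- `Eval M u e v u'`: in the memory `M` the expression `e` evaluates to `v`; `u` and `u'` are the sets
of names (run-time names, keys and nonces) that have been generated before and after the evaluation.
Run-time errors never block the evaluation, they give the error value. -/
inductive Eval (M : Mem) : Finset ℕ → Expr → Value → Finset ℕ → Prop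
  | var {u x v L} : M.get x = some (.var v L) → Eval M u (.var x) v u
  | pub {u p P} : M.get p = some (.prin P) → Eval M u (.pub p) (.pub P.key) u
  | release {u p P n} : M.get p = some (.prin P) → P.rights ≠ ∅ → n ∉ u →
      Eval M u (.release p) (.encPrin P n P.rights) (insert n u)
  | releaseErr {u p P} : M.get p = some (.prin P) → P.rights = ∅ → Eval M u (.release p) .nav u
  | enc {u u' e RS v K n} : Eval M u e v u' → EvalKeys M RS K → n ∉ u' →
      Eval M u (.enc e RS) (.enc v n K) (insert n u')
  | op {u u₁ u₂ f e₁ e₂ v₁ v₂} : Eval M u e₁ v₁ u₁ → Eval M u₁ e₂ v₂ u₂ →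
      Eval M u (.op f e₁ e₂) (Value.applyOp f v₁ v₂) u₂
  | array {u u' m} {es : Fin m → Expr} {vs : Fin m → Value} (us : Fin (m + 1) → Finset ℕ) :
      us 0 = u → us (Fin.last m) = u' →
      (∀ i : Fin m, Eval M (us i.castSucc) (es i) (vs i) (us i.succ)) →
      Eval M u (.array m es) (.array m vs) u'
  | index {u u' x e w L v} : M.get x = some (.var w L) → Eval M u e v u' →
      Eval M u (.index x e) (w.getAt v) u'
  | lit {u v} : Eval M u (.lit v) v u

/-! ### Reduction -/

/-- A memory together with the finite set of all names generated so far; a name is fresh if it is not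
in this set. -/
structure Store where
  mem : Mem
  used : Finset ℕ

def Mem.set (M : Mem) (a : ℕ) (c : Cell) : Mem := Function.update M a (some c)

/-- `Local σ C ρ σ' C'`: one reduction of a single thread, other than `synchronised`.  If the step
executes a declaration, `ρ` records the declared name and the run-time name that replaces it. -/
inductive Local : Store → Cmd → Option (ℕ × ℕ) → Store → Cmd → Prop
  | iteTrue {M u u₁ u₂ e₁ e₂ v C₁ C₂} : Eval M u e₁ v u₁ → Eval M u₁ e₂ v u₂ →
      Local ⟨M, u⟩ (.ite e₁ e₂ C₁ C₂) none ⟨M, u₂⟩ C₁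
  | iteFalse {M u u₁ u₂ e₁ e₂ v₁ v₂ C₁ C₂} : Eval M u e₁ v₁ u₁ → Eval M u₁ e₂ v₂ u₂ → v₁ ≠ v₂ →
      Local ⟨M, u⟩ (.ite e₁ e₂ C₁ C₂) none ⟨M, u₂⟩ C₂
  | new {M u u' x S R e C v L a} : Eval M u e v u' → EvalRights M R L → a ∉ u' →
      Local ⟨M, u⟩ (.new x S R e C) (some (x, a)) ⟨M.set a (.var v L), insert a u'⟩ (C.subst x a)
  | assign {M u u' a e C v w L} : M a = some (.var w L) → Eval M u e v u' →
      Local ⟨M, u⟩ (.assign (.run a) e C) none ⟨M.set a (.var v L), u'⟩ C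
  | assignAt {M u u₁ u₂ a e₁ e₂ C v₁ v₂ w L} : M a = some (.var w L) → Eval M u e₁ v₁ u₁ →
      Eval M u₁ e₂ v₂ u₂ →
      Local ⟨M, u⟩ (.assignAt (.run a) e₁ e₂ C) none ⟨M.set a (.var (w.setAt v₁ v₂) L), u₂⟩ C
  | letKey {M u u' k e C κ a} : Eval M u e (.pub κ) u' → a ∉ u' →
      Local ⟨M, u⟩ (.letKey k e C) (some (k, a)) ⟨M.set a (.key κ), insert a u'⟩ (C.subst k a)
  | bang {σ C} : Local σ (.bang C) none σ (.par C (.bang C))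
  | newPrin {M u p RS C K κ a} : EvalKeys M RS K → κ ∉ u → a ∉ insert κ u →
      Local ⟨M, u⟩ (.newPrin p RS C) (some (p, a))
        ⟨M.set a (.prin ⟨κ, K⟩), insert a (insert κ u)⟩ (C.subst p a)
  | decryptTrue {M u u' p P e x S RS C₁ C₂ v n K K' a} : M.get p = some (.prin P) →
      Eval M u e (.enc v n K) u' → EvalKeys M RS K' → P.key ∈ K → K' ⊆ K → a ∉ u' →
      Local ⟨M, u⟩ (.decrypt p e x S RS C₁ C₂) (some (x, a))
        ⟨M.set a (.var v (K' : Label)), insert a u'⟩ (C₁.subst x a)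
  | decryptFalse {M u u' p P e x S RS C₁ C₂ w K'} : M.get p = some (.prin P) →
      Eval M u e w u' → EvalKeys M RS K' →
      (¬ ∃ v n K, w = .enc v n K ∧ P.key ∈ K ∧ K' ⊆ K) →
      Local ⟨M, u⟩ (.decrypt p e x S RS C₁ C₂) none ⟨M, u'⟩ C₂
  | registerTrue {M u u' p P e q C₁ C₂ P₁ n a} : M.get p = some (.prin P) →
      Eval M u e (.encPrin P₁ n P₁.rights) u' → P.key ∈ P₁.rights → a ∉ u' →
      Local ⟨M, u⟩ (.register p e q C₁ C₂) (some (q, a))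
        ⟨M.set a (.prin P₁), insert a u'⟩ (C₁.subst q a)
  | registerFalse {M u u' p P e q C₁ C₂ w} : M.get p = some (.prin P) → Eval M u e w u' →
      (¬ ∃ P₁ n, w = .encPrin P₁ n P₁.rights ∧ P.key ∈ P₁.rights) →
      Local ⟨M, u⟩ (.register p e q C₁ C₂) none ⟨M, u'⟩ C₂

/-- `BlockRun σ T C σ' C'`: the threads `T` of a synchronised block are run to completion from `σ`,
ending in `σ'`; `C` is the command that follows the block, and `C'` is the same command after the
names declared in the block have been replaced. -/
inductive BlockRun : Store → Multiset Cmd → Cmd → Store → Cmd → Prop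
  | done {σ C} : BlockRun σ 0 C σ C
  | step {σ σ' σ'' G G' ρ T C C'} : Local σ G ρ σ' G' →
      BlockRun σ' (G'.threads + T) (C.substOpt ρ) σ'' C' → BlockRun σ (G ::ₘ T) C σ'' C'

/-- One reduction of a single thread. -/
inductive ThreadStep : Store → Cmd → Option (ℕ × ℕ) → Store → Cmd → Prop
  | basic {σ C ρ σ' C'} : Local σ C ρ σ' C' → ThreadStep σ C ρ σ' C'
  | sync {σ G C σ' C'} : BlockRun σ G.threads C σ' C' → ThreadStep σ (.sync G C) none σ' C'

/-- A device: a memory and a parallel composition of threads. -/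
structure Device where
  mem : Mem
  threads : Multiset Cmd

/-- A system of `n` devices.  `chans` gives the established channels; each is annotated with the rights
of the values that are sent over it. -/
structure System (n : ℕ) where
  chans : ℕ → Option Label
  used : Finset ℕ
  dev : Fin n → Device

variable {n : ℕ}

def System.setDev (P : System n) (i : Fin n) (D : Device) : System n :=
  { P with dev := Function.update P.dev i D }

/-- A thread `C` of device `i` makes one step (`ρ` as in `Local`). -/
inductive System.RunThread (i : Fin n) (C : Cmd) (ρ : Option (ℕ × ℕ)) :
    System n → System n → Prop
  | intro {P : System n} {T : Multiset Cmd} {σ C'} : (P.dev i).threads = C ::ₘ T →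
      ThreadStep ⟨(P.dev i).mem, P.used⟩ C ρ σ C' →
      RunThread i C ρ P ({ P with used := σ.used }.setDev i ⟨σ.mem, C'.threads + T⟩)

/-- Reduction of systems. -/
inductive System.Step : System n → System n → Prop
  | thread {P P' : System n} {i C ρ} : RunThread i C ρ P P' → Step P P'
  | openPub {P : System n} {i j c₁ c₂ c S C₁ C₂ T₁ T₂} : i ≠ j →
      (P.dev i).threads = .connectPub c₁ S C₁ ::ₘ T₁ →
      (P.dev j).threads = .acceptPub c₂ S C₂ ::ₘ T₂ → c ∉ P.used →
      Step P (({ P with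
          chans := Function.update P.chans c (some ⊤)
          used := insert c P.used }.setDev i
            ⟨(P.dev i).mem, (C₁.subst c₁ c).threads + T₁⟩).setDev j
            ⟨(P.dev j).mem, (C₂.subst c₂ c).threads + T₂⟩)
  | openSecure {P : System n} {i j c₁ c₂ c S R₁ R₂ R₁' R₂' kc ks ps pc C₁ C₂ T₁ T₂ Ps Pc L₁ L₂} :
      i ≠ j →
      (P.dev i).threads = .accept c₁ S R₁ R₂ kc ps C₁ ::ₘ T₁ →
      (P.dev j).threads = .connect c₂ S R₁' R₂' ks pc C₂ ::ₘ T₂ →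
      (P.dev i).mem.get ps = some (.prin Ps) → (P.dev j).mem.get pc = some (.prin Pc) →
      EvalRights (P.dev i).mem R₁ L₁ → EvalRights (P.dev j).mem R₁' L₁ →
      EvalRights (P.dev i).mem R₂ L₂ → EvalRights (P.dev j).mem R₂' L₂ →
      (P.dev i).mem.get kc = some (.key Pc.key) → (P.dev j).mem.get ks = some (.key Ps.key) →
      c ∉ P.used →
      Step P (({ P with
          chans := Function.update P.chans c (some L₁)
          used := insert c P.used }.setDev i
            ⟨(P.dev i).mem, (C₁.subst c₁ c).threads + T₁⟩).setDev j
            ⟨(P.dev j).mem, (C₂.subst c₂ c).threads + T₂⟩)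
  | comm {P : System n} {i j c L e x v u y C₁ C₂ T₁ T₂} : i ≠ j → P.chans c = some L →
      (P.dev i).threads = .output e (.run c) C₁ ::ₘ T₁ →
      (P.dev j).threads = .input (.run c) x C₂ ::ₘ T₂ →
      Eval (P.dev i).mem P.used e v u → y ∉ u →
      Step P (({ P with used := insert y u }.setDev i
            ⟨(P.dev i).mem, C₁.threads + T₁⟩).setDev j
            ⟨(P.dev j).mem.set y (.var v L), (C₂.subst x y).threads + T₂⟩)

/-- Finite sequences of reductions. -/
abbrev System.Steps : System n → System n → Prop := Relation.ReflTransGen System.Step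

/-! ### Initial systems, change of a variable, and equivalence below a right -/

/-- The context of an initial memory: its principals and its public keys. -/
def Ctx.ofMem (M : Mem) : Ctx where
  prin := {p | ∃ P, M.get p = some (.prin P)}
  key := {k | ∃ κ, M.get k = some (.key κ)}
  chan := fun _ => none
  var := fun _ => none

/-- Valid initial systems, all of whose devices are well-typed. -/
structure System.ValidInitial (P : System n) : Prop where
  noChannel : ∀ c, P.chans c = none
  memory : ∀ i a c, (P.dev i).mem a = some c →
    a ∈ P.used ∧ ∃ κ ∈ P.used, c = .prin ⟨κ, ∅⟩ ∨ c = .key κ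
  principal : ∀ i j, i ≠ j → ∀ a b κ,
    (P.dev i).mem a = some (.prin ⟨κ, ∅⟩) → (P.dev j).mem b ≠ some (.prin ⟨κ, ∅⟩)
  typed : ∀ i, ∃ C : Cmd, (P.dev i).threads = C.threads ∧ C.declared.Nodup ∧
    CmdTyped ⊤ (Ctx.ofMem (P.dev i).mem) C

/-- The command `a := v`. -/
def assignValue (a : ℕ) (v : Value) : Cmd := .assign (.run a) (.lit v) .skip

/-- `P` with the additional thread `a := v` on device `i`. -/
def System.withAssign (P : System n) (i : Fin n) (a : ℕ) (v : Value) : System n :=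
  P.setDev i ⟨(P.dev i).mem, assignValue a v ::ₘ (P.dev i).threads⟩

/-- Every variable location of `P` that was created with rights not at least as confidential as `L`
is a location of `Q`, created with the same rights, and the two values agree after obfuscation under
`L`. -/
def System.LowIn (L : Label) (P Q : System n) : Prop :=
  ∀ j y Ly v, (P.dev j).mem y = some (.var v Ly) → ¬ Ly ≤ L →
    ∃ w, (Q.dev j).mem y = some (.var w Ly) ∧ v.erase L = w.erase L

end CloudTypes

/-!
The theorem is a noninterference statement, proved by simulation: the run from `P'` to `P''` is
imitated by a second run that starts after the assignment `a := v`. Smaller rights are more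
confidential, so the observable cells are those whose label is *not* below `L`; if `L = ⊤` nothing
is observable. The relation `System.Sim` between the two runs rests on the following ideas.

*Threads.* Every thread is either common to both runs, or its program counter in the first run is
below `L`. A thread of the second kind changes only cells below `L` (`Local.safe`, `BlockRun.safe`),
so its steps need no counterpart, and the second run never executes such threads of its own. A step
of a common thread is imitated (`Local.sim`); if its outcome depends on data below `L`, then both
runs continue it below `L`. In a synchronised block this is not enough, as the second run has to
complete the block even if it takes other branches there. This is possible because blocks are free
of loops and well-typed expressions always evaluate (`BlockState.exists_run`, `BlockRun.sim`).

*Values.* Equality after obfuscation is not an invariant, as programs can compare ciphertexts, also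
those whose content is hidden. The invariant `VRel` records for each nonce of a hidden ciphertext
the pair of its contents in the two runs. Since nonces are never reused, this record is a partial
function of the nonce, and `VRel` is injective in both directions (`VRel.left_unique`,
`VRel.right_unique`), so that comparisons have the same result in both runs. Decryption of a hidden
ciphertext yields a variable below `L`.

*Names.* Observable cells must have the same locations in both runs. Let `U` be the set of all names
that the first run generates until it ends. The names that only the second run generates are chosen
outside `U`, so a name that is fresh in the first run is fresh in the second run as well.

*Starting point.* Simulating the run from `P` to `P'` by a second run that also starts in `P`
(`System.ValidInitial.sim`, `System.Steps.sim`) shows that in `P'` all threads are well-typed and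
that ciphertexts with the same nonce have the same content (`Value.Conf`). Hence `P'` is related to
the system after the assignment, which differs from it in a cell with label `L` only
(`System.Sim.restart`).
-/

namespace CloudTypes

/-! ### Memories and the evaluation of rights -/

/-- The label of a memory cell; principals and public keys count as public. -/
def Cell.label : Cell → Label
  | .var _ L => L
  | .prin _ => ⊤
  | .key _ => ⊤

/-- Two cells are equal up to the value of a variable. -/
inductive Cell.SameKind : Cell → Cell → Prop
  | var (v w : Value) (L : Label) : SameKind (.var v L) (.var w L)
  | prin (P : Principal) : SameKind (.prin P) (.prin P)
  | key (κ : Key) : SameKind (.key κ) (.key κ)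

theorem Cell.SameKind.rfl {c : Cell} : c.SameKind c := by
  cases c <;> constructor

theorem Cell.SameKind.trans {c₁ c₂ c₃ : Cell} (h : c₁.SameKind c₂) (h' : c₂.SameKind c₃) :
    c₁.SameKind c₃ := by
  cases h <;> cases h' <;> constructor

theorem Cell.SameKind.label_eq {c c' : Cell} (h : c.SameKind c') : c.label = c'.label := by
  cases h <;> rfl

/-- `M'` arises from `M` by allocating new cells and changing the values of variables. -/
def Mem.Ext (M M' : Mem) : Prop := ∀ a c, M a = some c → ∃ c', M' a = some c' ∧ c.SameKind c'

theorem Mem.Ext.rfl {M : Mem} : M.Ext M := fun _ c h => ⟨c, h, .rfl⟩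

theorem Mem.Ext.trans {M₁ M₂ M₃ : Mem} (h : M₁.Ext M₂) (h' : M₂.Ext M₃) : M₁.Ext M₃ := by
  intro a c hc
  obtain ⟨c', hc', hk⟩ := h a c hc
  obtain ⟨c'', hc'', hk'⟩ := h' a c' hc'
  exact ⟨c'', hc'', hk.trans hk'⟩

theorem Mem.set_self (M : Mem) (a : ℕ) (c : Cell) : M.set a c a = some c := by
  simp [Mem.set]

theorem Mem.set_ne (M : Mem) {a b : ℕ} (c : Cell) (h : b ≠ a) : M.set a c b = M b := by
  simp [Mem.set, h]

theorem Mem.get_eq_some {M : Mem} {x : Name} {c : Cell} (h : M.get x = some c) :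
    ∃ a, x = .run a ∧ M a = some c := by
  cases x with
  | prog n => simp [Mem.get] at h
  | run a => exact ⟨a, rfl, h⟩

theorem Mem.Ext.get {M M' : Mem} (h : M.Ext M') {x : Name} {c : Cell} (hx : M.get x = some c) :
    ∃ c', M'.get x = some c' ∧ c.SameKind c' := by
  obtain ⟨a, rfl, ha⟩ := Mem.get_eq_some hx
  exact h a c ha

theorem Mem.Ext.get_prin {M M' : Mem} (h : M.Ext M') {x : Name} {P : Principal}
    (hx : M.get x = some (.prin P)) : M'.get x = some (.prin P) := by
  obtain ⟨c', hc', hk⟩ := h.get hx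
  cases hk; exact hc'

theorem Mem.Ext.get_key {M M' : Mem} (h : M.Ext M') {x : Name} {κ : Key}
    (hx : M.get x = some (.key κ)) : M'.get x = some (.key κ) := by
  obtain ⟨c', hc', hk⟩ := h.get hx
  cases hk; exact hc'

theorem Mem.Ext.get_var {M M' : Mem} (h : M.Ext M') {x : Name} {v : Value} {L : Label}
    (hx : M.get x = some (.var v L)) : ∃ w, M'.get x = some (.var w L) := by
  obtain ⟨c', hc', hk⟩ := h.get hx
  cases hk; exact ⟨_, hc'⟩

/-- Every allocated location is among the generated names. -/
def Mem.Dom (M : Mem) (u : Finset ℕ) : Prop := ∀ a c, M a = some c → a ∈ u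

theorem Mem.Dom.eq_none {M : Mem} {u : Finset ℕ} (h : M.Dom u) {a : ℕ} (ha : a ∉ u) :
    M a = none := by
  by_contra hc
  obtain ⟨c, hc⟩ := Option.ne_none_iff_exists'.mp hc
  exact ha (h a c hc)

theorem Mem.Dom.mono {M : Mem} {u u' : Finset ℕ} (h : M.Dom u) (hu : u ⊆ u') : M.Dom u' :=
  fun a c hc => hu (h a c hc)

theorem Mem.Dom.set {M : Mem} {u : Finset ℕ} (h : M.Dom u) {a : ℕ} (c : Cell) (ha : a ∈ u) :
    (M.set a c).Dom u := by
  intro b c' hb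
  by_cases hba : b = a
  · exact hba ▸ ha
  · rw [Mem.set_ne _ _ hba] at hb; exact h b c' hb

/-- `M'` extends `M`, and every cell that was changed or allocated has a label below `ℓ`. -/
structure Mem.StepLe (ℓ : Label) (M M' : Mem) : Prop where
  ext : M.Ext M'
  label_le : ∀ b c, M' b = some c → M b ≠ some c → c.label ≤ ℓ

theorem Mem.StepLe.rfl {ℓ : Label} {M : Mem} : M.StepLe ℓ M :=
  ⟨.rfl, fun _ _ h h' => absurd h h'⟩

theorem Mem.StepLe.trans {ℓ : Label} {M₁ M₂ M₃ : Mem} (h : M₁.StepLe ℓ M₂) (h' : M₂.StepLe ℓ M₃) :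
    M₁.StepLe ℓ M₃ := by
  refine ⟨h.ext.trans h'.ext, fun b c hc hn => ?_⟩
  by_cases h2 : M₂ b = some c
  · exact h.label_le b c h2 hn
  · exact h'.label_le b c hc h2

theorem Mem.StepLe.mono {ℓ ℓ' : Label} {M M' : Mem} (h : M.StepLe ℓ M') (hl : ℓ ≤ ℓ') :
    M.StepLe ℓ' M' :=
  ⟨h.ext, fun b c hc hn => (h.label_le b c hc hn).trans hl⟩

theorem Mem.StepLe.set {ℓ : Label} {M : Mem} {a : ℕ} {c : Cell} (hc : c.label ≤ ℓ)
    (ha : ∀ c', M a = some c' → c'.SameKind c) : M.StepLe ℓ (M.set a c) := by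
  constructor
  · intro b d hd
    by_cases hb : b = a
    · subst hb; exact ⟨c, Mem.set_self .., ha d hd⟩
    · exact ⟨d, by rw [Mem.set_ne _ _ hb]; exact hd, .rfl⟩
  · intro b d hd hn
    by_cases hb : b = a
    · subst hb; rw [Mem.set_self] at hd; cases hd; exact hc
    · rw [Mem.set_ne _ _ hb] at hd; exact absurd hd hn

theorem Mem.StepLe.set_fresh {ℓ : Label} {M : Mem} {a : ℕ} {c : Cell} (hc : c.label ≤ ℓ)
    (ha : M a = none) : M.StepLe ℓ (M.set a c) :=
  .set hc fun c' h => by rw [ha] at h; cases h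

theorem Mem.Ext.set_fresh {M : Mem} {a : ℕ} (c : Cell) (ha : M a = none) : M.Ext (M.set a c) :=
  (Mem.StepLe.set_fresh (ℓ := ⊤) le_top ha).ext

theorem Mem.StepLe.set_var {ℓ L : Label} {M : Mem} {a : ℕ} {v w : Value}
    (ha : M a = some (.var w L)) (hc : L ≤ ℓ) : M.StepLe ℓ (M.set a (.var v L)) :=
  .set hc fun c' h => by rw [ha] at h; cases h; constructor

theorem EvalKey.mono {M M' : Mem} (h : M.Ext M') {r : KeyRef} {κ : Key} (hr : EvalKey M r κ) :
    EvalKey M' r κ := by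
  cases hr with
  | pub hp => exact .pub (h.get_prin hp)
  | key hk => exact .key (h.get_key hk)

theorem EvalKey.unique {M : Mem} {r : KeyRef} {κ κ' : Key} (h : EvalKey M r κ)
    (h' : EvalKey M r κ') : κ = κ' := by
  cases h with
  | pub hp => cases h' with | pub hp' => rw [hp] at hp'; cases hp'; rfl
  | key hp => cases h' with | key hp' => rw [hp] at hp'; cases hp'; rfl

theorem EvalKeys.map {M M' : Mem} (h : ∀ r κ, EvalKey M r κ → EvalKey M' r κ)
    {RS : Finset KeyRef} {K : Finset Key} (hK : EvalKeys M RS K) : EvalKeys M' RS K := by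
  refine ⟨fun r hr => ?_, fun κ hκ => ?_⟩
  · obtain ⟨κ, hκ, he⟩ := hK.1 r hr; exact ⟨κ, hκ, h _ _ he⟩
  · obtain ⟨r, hr, he⟩ := hK.2 κ hκ; exact ⟨r, hr, h _ _ he⟩

theorem EvalRights.map {M M' : Mem} (h : ∀ r κ, EvalKey M r κ → EvalKey M' r κ)
    {R : Rights} {L : Label} (hR : EvalRights M R L) : EvalRights M' R L := by
  cases hR with
  | top => exact .top
  | keys hK => exact .keys (hK.map h)

theorem EvalRights.mono {M M' : Mem} (h : M.Ext M') {R : Rights} {L : Label}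
    (hR : EvalRights M R L) : EvalRights M' R L := hR.map fun _ _ => EvalKey.mono h

theorem EvalKeys.subset {M : Mem} {RS RS' : Finset KeyRef} {K K' : Finset Key} (h : RS ⊆ RS')
    (hK : EvalKeys M RS K) (hK' : EvalKeys M RS' K') : K ⊆ K' := by
  intro κ hκ
  obtain ⟨r, hr, he⟩ := hK.2 κ hκ
  obtain ⟨κ', hκ', he'⟩ := hK'.1 r (h hr)
  rwa [he.unique he']

theorem EvalRights.le {M : Mem} {R R' : Rights} {L L' : Label} (h : R ≤ R')
    (hR : EvalRights M R L) (hR' : EvalRights M R' L') : L ≤ L' := by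
  cases hR' with
  | top => exact le_top
  | keys hK' =>
    cases hR with
    | top => exact absurd h (by simp)
    | keys hK => exact WithTop.coe_le_coe.2 (hK.subset (WithTop.coe_le_coe.1 h) hK')

theorem EvalRights.unique {M : Mem} {R : Rights} {L L' : Label}
    (h : EvalRights M R L) (h' : EvalRights M R L') : L = L' :=
  le_antisymm (h.le le_rfl h') (h'.le le_rfl h)

theorem EvalKeys.exists_of {M : Mem} {RS : Finset KeyRef} (h : ∀ r ∈ RS, ∃ κ, EvalKey M r κ) :
    ∃ K, EvalKeys M RS K := by
  choose f hf using h
  refine ⟨RS.attach.image fun r => f r.1 r.2, fun r hr => ⟨f r hr, ?_, hf r hr⟩, fun κ hκ => ?_⟩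
  · exact Finset.mem_image.2 ⟨⟨r, hr⟩, Finset.mem_attach .., rfl⟩
  · obtain ⟨r, -, rfl⟩ := Finset.mem_image.1 hκ
    exact ⟨r.1, r.2, hf _ _⟩

theorem EvalRights.inf_exists {M : Mem} {R R' : Rights} {L L' : Label} (h : EvalRights M R L)
    (h' : EvalRights M R' L') : ∃ L'', EvalRights M (R ⊓ R') L'' := by
  cases h with
  | top => exact ⟨L', by simpa using h'⟩
  | keys hK =>
    cases h' with
    | top => exact ⟨_, by simpa using EvalRights.keys hK⟩
    | @keys RS' K' hK' =>
      rename_i RS K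
      have : ∃ K'', EvalKeys M (RS ∩ RS') K'' := by
        refine EvalKeys.exists_of fun r hr => ?_
        obtain ⟨κ, -, hκ⟩ := hK.1 r (Finset.mem_inter.1 hr).1
        exact ⟨κ, hκ⟩
      obtain ⟨K'', hK''⟩ := this
      exact ⟨K'', EvalRights.keys hK''⟩

/-! ### Run-time contexts -/

/-- For every established channel of type `Chan(S_R₁)_R₂`, the values of `R₁` and `R₂`. -/
abbrev ChanLabels := ℕ → Option (Label × Label)

/-- The names of the context `Γ` are run-time names, denoting cells and channels whose labels are
the values of their rights in `Γ`. -/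
structure Ctx.Ok (M : Mem) (χ : ChanLabels) (Γ : Ctx) : Prop where
  prin : ∀ p ∈ Γ.prin, ∃ P, M.get p = some (.prin P)
  key : ∀ k ∈ Γ.key, ∃ κ, M.get k = some (.key κ)
  var : ∀ x S R, Γ.var x = some (S, R) → ∃ v L, M.get x = some (.var v L) ∧ EvalRights M R L
  chan : ∀ c S R₁ R₂, Γ.chan c = some (S, R₁, R₂) → ∃ k L₁ L₂, c = .run k ∧
    χ k = some (L₁, L₂) ∧ EvalRights M R₁ L₁ ∧ EvalRights M R₂ L₂

theorem Ctx.Ok.mono {M M' : Mem} {χ χ' : ChanLabels} {Γ : Ctx} (h : Γ.Ok M χ) (hM : M.Ext M')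
    (hχ : ∀ c p, χ c = some p → χ' c = some p) : Γ.Ok M' χ' where
  prin p hp := (h.prin p hp).imp fun _ => hM.get_prin
  key p hp := (h.key p hp).imp fun _ => hM.get_key
  var x S R hx := by
    obtain ⟨v, L, hv, hR⟩ := h.var x S R hx
    obtain ⟨w, hw⟩ := hM.get_var hv
    exact ⟨w, L, hw, hR.mono hM⟩
  chan c S R₁ R₂ hc := by
    obtain ⟨k, L₁, L₂, hk, hkc, h₁, h₂⟩ := h.chan c S R₁ R₂ hc
    exact ⟨k, L₁, L₂, hk, hχ _ _ hkc, h₁.mono hM, h₂.mono hM⟩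

theorem Ctx.Ok.ext {M M' : Mem} {χ : ChanLabels} {Γ : Ctx} (h : Γ.Ok M χ) (hM : M.Ext M') :
    Γ.Ok M' χ := h.mono hM fun _ _ => id

theorem Ctx.Ok.evalKeys {M : Mem} {χ : ChanLabels} {Γ : Ctx} (h : Γ.Ok M χ)
    {RS : Finset KeyRef} (hw : Γ.WfKeys RS) : ∃ K, EvalKeys M RS K := by
  refine EvalKeys.exists_of fun r hr => ?_
  cases r with
  | pub p => obtain ⟨P, hP⟩ := h.prin p (hw.1 p hr); exact ⟨_, .pub hP⟩
  | key p => obtain ⟨P, hP⟩ := h.key p (hw.2 p hr); exact ⟨_, .key hP⟩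

theorem Ctx.Ok.evalRights {M : Mem} {χ : ChanLabels} {Γ : Ctx} (h : Γ.Ok M χ)
    {R : Rights} (hw : Γ.WfRights R) : ∃ L, EvalRights M R L := by
  cases R using WithTop.recTopCoe with
  | top => exact ⟨⊤, .top⟩
  | coe RS => obtain ⟨K, hK⟩ := h.evalKeys (hw RS rfl); exact ⟨K, .keys hK⟩

theorem ExprTyped.evalRights {M : Mem} {χ : ChanLabels} {Γ : Ctx} (h : Γ.Ok M χ)
    {e : Expr} {S : Ty} {R : Rights} (he : ExprTyped Γ e S R) : ∃ L, EvalRights M R L := by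
  induction he with
  | var hx => obtain ⟨_, L, _, hL⟩ := h.var _ _ _ hx; exact ⟨L, hL⟩
  | int | pub | release | enc => exact ⟨⊤, .top⟩
  | op _ _ h₁ h₂ | index _ _ h₁ h₂ =>
    obtain ⟨L₁, h₁⟩ := h₁
    obtain ⟨L₂, h₂⟩ := h₂
    exact h₁.inf_exists h₂
  | array hw => exact h.evalRights hw

/-! ### Substitution of run-time names in typing derivations -/

/-- The name `run a` does not occur in the right. -/
def Rights.NotIn (a : ℕ) (R : Rights) : Prop :=
  ∀ RS : Finset KeyRef, R = RS → KeyRef.pub (.run a) ∉ RS ∧ KeyRef.key (.run a) ∉ RS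

theorem Rights.NotIn.inf {a : ℕ} {R R' : Rights} (h : Rights.NotIn a R) (h' : Rights.NotIn a R') :
    Rights.NotIn a (R ⊓ R') := by
  intro RS hRS
  cases R using WithTop.recTopCoe with
  | top => exact h' RS (by simpa using hRS)
  | coe R₁ =>
    have hle : (RS : Rights) ≤ (R₁ : Rights) := hRS ▸ inf_le_left
    have hle := WithTop.coe_le_coe.1 hle
    exact ⟨fun hm => (h R₁ rfl).1 (hle hm), fun hm => (h R₁ rfl).2 (hle hm)⟩

theorem EvalRights.notIn {M : Mem} {R : Rights} {L : Label} (h : EvalRights M R L) {a : ℕ}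
    (ha : M a = none) : Rights.NotIn a R := by
  rintro RS rfl
  cases h with
  | keys hK =>
    constructor <;> intro hm <;> obtain ⟨κ, -, hκ⟩ := hK.1 _ hm <;>
      cases hκ <;> simp_all [Mem.get]

theorem EvalRights.subst_eq {M : Mem} {R : Rights} {L : Label} (h : EvalRights M R L) (x a : ℕ) :
    substRights x a R = R := by
  cases h with
  | top => rfl
  | @keys RS K hK =>
    have : substKeys x a RS = RS := by
      have : ∀ r ∈ RS, KeyRef.subst x a r = r := by
        intro r hr
        obtain ⟨κ, -, hκ⟩ := hK.1 _ hr
        cases hκ with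
        | pub hp | key hp =>
          obtain ⟨b, rfl, -⟩ := Mem.get_eq_some hp; rfl
      rw [substKeys, Finset.image_congr (g := id) (fun r hr => this r hr), Finset.image_id]
    simp [substRights, this]

theorem KeyRef.subst_injOn (x a : ℕ) :
    Set.InjOn (KeyRef.subst x a) {r | r ≠ .pub (.run a) ∧ r ≠ .key (.run a)} := by
  have hn : ∀ p q : Name, p ≠ .run a → q ≠ .run a → p.subst x a = q.subst x a → p = q := by
    intro p q hp hq h
    cases p <;> cases q <;> simp only [Name.subst] at h <;> (try split_ifs at h) <;> simp_all
  rintro (p | p) ⟨h₁, h₂⟩ (q | q) ⟨h₃, h₄⟩ h <;> simp only [KeyRef.subst] at h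
  · rw [hn p q (by simpa using h₁) (by simpa using h₃) (by simpa using h)]
  · cases h
  · cases h
  · rw [hn p q (by simpa using h₂) (by simpa using h₄) (by simpa using h)]

/-- Renaming commutes with intersection only where it is injective, so the new name must not occur
in the rights. -/
theorem substRights_inf {x a : ℕ} {R R' : Rights} (h : Rights.NotIn a R) (h' : Rights.NotIn a R') :
    substRights x a (R ⊓ R') = substRights x a R ⊓ substRights x a R' := by
  cases R using WithTop.recTopCoe with
  | top => simp [substRights]
  | coe R₁ =>
    cases R' using WithTop.recTopCoe with
    | top => simp [substRights]
    | coe R₂ =>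
      have : substKeys x a (R₁ ∩ R₂) = substKeys x a R₁ ∩ substKeys x a R₂ := by
        refine Finset.image_inter_of_injOn _ _ ((KeyRef.subst_injOn x a).mono ?_)
        rintro r (hr | hr)
        · exact ⟨fun e => (h R₁ rfl).1 (e ▸ hr), fun e => (h R₁ rfl).2 (e ▸ hr)⟩
        · exact ⟨fun e => (h' R₂ rfl).1 (e ▸ hr), fun e => (h' R₂ rfl).2 (e ▸ hr)⟩
      exact congrArg (fun s : Finset KeyRef => (s : Rights)) this

theorem substRights_mono {x a : ℕ} {R R' : Rights} (h : R ≤ R') :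
    substRights x a R ≤ substRights x a R' :=
  (WithTop.monotone_map_iff.2 fun _ _ hs => Finset.image_subset_image hs) h

/-- `Δ` contains the entries of `Γ`, with `prog x` renamed to `run a`. -/
structure CtxSubst (x a : ℕ) (Γ Δ : Ctx) : Prop where
  prin : ∀ p ∈ Γ.prin, p.subst x a ∈ Δ.prin
  key : ∀ p ∈ Γ.key, p.subst x a ∈ Δ.key
  chan : ∀ c S R₁ R₂, Γ.chan c = some (S, R₁, R₂) →
    Δ.chan (c.subst x a) = some (S, substRights x a R₁, substRights x a R₂)
  var : ∀ y S R, Γ.var y = some (S, R) → Δ.var (y.subst x a) = some (S, substRights x a R)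

/-- The name `run a` does not occur in the rights of the context, nor as a principal or key. -/
structure Ctx.NotIn (a : ℕ) (Γ : Ctx) : Prop where
  prin : .run a ∉ Γ.prin
  key : .run a ∉ Γ.key
  chan : ∀ c S R₁ R₂, Γ.chan c = some (S, R₁, R₂) → Rights.NotIn a R₁ ∧ Rights.NotIn a R₂
  var : ∀ y S R, Γ.var y = some (S, R) → Rights.NotIn a R

theorem Name.subst_prog_ne {x y a : ℕ} (h : y ≠ x) : Name.subst x a (.prog y) = .prog y := by
  simp [Name.subst, h]

theorem Name.subst_eq_prog {x y a : ℕ} {n : Name} (h : Name.subst x a n = .prog y) :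
    n = .prog y := by
  cases n with
  | prog m => by_cases hm : m = x <;> simp_all [Name.subst]
  | run m => simp [Name.subst] at h

section
variable {x a : ℕ} {Γ Δ : Ctx}

theorem CtxSubst.addPrin (h : CtxSubst x a Γ Δ) {p : ℕ} (hp : p ≠ x) :
    CtxSubst x a (Γ.addPrin p) (Δ.addPrin p) where
  prin q hq := by
    rcases Set.mem_insert_iff.1 hq with rfl | hq
    · rw [Name.subst_prog_ne hp]; exact Set.mem_insert ..
    · exact Set.mem_insert_of_mem _ (h.prin q hq)
  key := h.key
  chan := h.chan
  var := h.var

theorem CtxSubst.addKey (h : CtxSubst x a Γ Δ) {p : ℕ} (hp : p ≠ x) :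
    CtxSubst x a (Γ.addKey p) (Δ.addKey p) where
  key q hq := by
    rcases Set.mem_insert_iff.1 hq with rfl | hq
    · rw [Name.subst_prog_ne hp]; exact Set.mem_insert ..
    · exact Set.mem_insert_of_mem _ (h.key q hq)
  prin := h.prin
  chan := h.chan
  var := h.var

theorem CtxSubst.addVar (h : CtxSubst x a Γ Δ) {y : ℕ} (hy : y ≠ x) (S : Ty) (R : Rights) :
    CtxSubst x a (Γ.addVar y S R) (Δ.addVar y S (substRights x a R)) where
  prin := h.prin
  key := h.key
  chan := h.chan
  var z S' R' hz := by
    simp only [Ctx.addVar] at hz ⊢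
    by_cases hzy : z = .prog y
    · subst hzy
      rw [Name.subst_prog_ne hy]
      simp at hz ⊢
      exact ⟨hz.1, by rw [hz.2]⟩
    · rw [Function.update_of_ne hzy] at hz
      rw [Function.update_of_ne fun e => hzy (Name.subst_eq_prog e)]
      exact h.var z S' R' hz

theorem CtxSubst.addChan (h : CtxSubst x a Γ Δ) {y : ℕ} (hy : y ≠ x) (S : Ty) (R₁ R₂ : Rights) :
    CtxSubst x a (Γ.addChan y S R₁ R₂)
      (Δ.addChan y S (substRights x a R₁) (substRights x a R₂)) where
  prin := h.prin
  key := h.key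
  var := h.var
  chan z S' R₁' R₂' hz := by
    simp only [Ctx.addChan] at hz ⊢
    by_cases hzy : z = .prog y
    · subst hzy
      rw [Name.subst_prog_ne hy]
      simp at hz ⊢
      exact ⟨hz.1, by rw [hz.2.1], by rw [hz.2.2]⟩
    · rw [Function.update_of_ne hzy] at hz
      rw [Function.update_of_ne fun e => hzy (Name.subst_eq_prog e)]
      exact h.chan z S' R₁' R₂' hz

theorem Ctx.NotIn.addPrin (h : Γ.NotIn a) (p : ℕ) : (Γ.addPrin p).NotIn a :=
  ⟨by simpa [Ctx.addPrin] using h.prin, h.key, h.chan, h.var⟩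

theorem Ctx.NotIn.addKey (h : Γ.NotIn a) (p : ℕ) : (Γ.addKey p).NotIn a :=
  ⟨h.prin, by simpa [Ctx.addKey] using h.key, h.chan, h.var⟩

theorem Ctx.NotIn.addVar (h : Γ.NotIn a) (y : ℕ) (S : Ty) {R : Rights} (hR : Rights.NotIn a R) :
    (Γ.addVar y S R).NotIn a := by
  refine ⟨h.prin, h.key, h.chan, fun z S' R' hz => ?_⟩
  simp only [Ctx.addVar] at hz
  by_cases hzy : z = .prog y
  · subst hzy; simp at hz; exact hz.2 ▸ hR
  · rw [Function.update_of_ne hzy] at hz; exact h.var z S' R' hz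

theorem Ctx.NotIn.addChan (h : Γ.NotIn a) (y : ℕ) (S : Ty) {R₁ R₂ : Rights}
    (hR₁ : Rights.NotIn a R₁) (hR₂ : Rights.NotIn a R₂) : (Γ.addChan y S R₁ R₂).NotIn a := by
  refine ⟨h.prin, h.key, fun z S' R₁' R₂' hz => ?_, h.var⟩
  simp only [Ctx.addChan] at hz
  by_cases hzy : z = .prog y
  · subst hzy; simp at hz; exact ⟨hz.2.1 ▸ hR₁, hz.2.2 ▸ hR₂⟩
  · rw [Function.update_of_ne hzy] at hz; exact h.chan z S' R₁' R₂' hz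

theorem Ctx.NotIn.wfKeys (h : Γ.NotIn a) {RS : Finset KeyRef} (hw : Γ.WfKeys RS) :
    Rights.NotIn a (RS : Rights) := by
  intro RS' e
  obtain rfl := WithTop.coe_injective e
  exact ⟨fun hm => h.prin (hw.1 _ hm), fun hm => h.key (hw.2 _ hm)⟩

theorem Ctx.NotIn.wfRights (h : Γ.NotIn a) {R : Rights} (hw : Γ.WfRights R) :
    Rights.NotIn a R := by
  rintro RS rfl
  exact h.wfKeys (hw RS rfl) RS rfl

theorem ExprTyped.notIn (h : Γ.NotIn a) {e : Expr} {S : Ty} {R : Rights}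
    (he : ExprTyped Γ e S R) : Rights.NotIn a R := by
  induction he with
  | var hx => exact h.var _ _ _ hx
  | int | pub | release | enc => rintro RS ⟨⟩
  | op _ _ h₁ h₂ | index _ _ h₁ h₂ => exact h₁.inf h₂
  | array hw => exact h.wfRights hw

theorem CtxSubst.wfKeys (h : CtxSubst x a Γ Δ) {RS : Finset KeyRef} (hw : Γ.WfKeys RS) :
    Δ.WfKeys (substKeys x a RS) := by
  constructor <;> intro p hp <;> obtain ⟨r, hr, e⟩ := Finset.mem_image.1 hp <;>
    cases r <;> cases e
  · exact h.prin _ (hw.1 _ hr)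
  · exact h.key _ (hw.2 _ hr)

theorem CtxSubst.wfRights (h : CtxSubst x a Γ Δ) {R : Rights} (hw : Γ.WfRights R) :
    Δ.WfRights (substRights x a R) := by
  intro RS hRS
  cases R using WithTop.recTopCoe with
  | top => cases hRS
  | coe R₁ =>
    obtain rfl : substKeys x a R₁ = RS := WithTop.coe_injective hRS
    exact h.wfKeys (hw R₁ rfl)

theorem ExprTyped.subst (h : CtxSubst x a Γ Δ) (hn : Γ.NotIn a) {e : Expr} {S : Ty} {R : Rights}
    (he : ExprTyped Γ e S R) : ExprTyped Δ (e.subst x a) S (substRights x a R) := by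
  induction he with
  | var hx => exact .var (h.var _ _ _ hx)
  | int i => exact .int i
  | pub hp => exact .pub (h.prin _ hp)
  | release hp => exact .release (h.prin _ hp)
  | enc hw _ hle ih => exact .enc (h.wfKeys hw) ih (substRights_mono hle)
  | op h₁ h₂ ih₁ ih₂ =>
    rw [substRights_inf (h₁.notIn hn) (h₂.notIn hn)]
    exact .op ih₁ ih₂
  | index h₁ h₂ ih₁ ih₂ =>
    rw [substRights_inf (h₁.notIn hn) (h₂.notIn hn)]
    exact .index ih₁ ih₂
  | array hw _ ih => exact .array (h.wfRights hw) ih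

end

/-! ### Substitution, blocks and typing of commands -/

theorem Cmd.declared_subst (x a : ℕ) (C : Cmd) : (C.subst x a).declared = C.declared := by
  induction C <;> simp only [Cmd.subst, Cmd.declared, *] <;> split_ifs <;> simp [*]

theorem Cmd.isBlock_subst (x a : ℕ) {G : Cmd} (h : G.IsBlock) : (G.subst x a).IsBlock := by
  induction G <;> simp only [Cmd.IsBlock, Cmd.subst] at h ⊢ <;> (try split_ifs) <;> simp_all

theorem Cmd.mem_declared_plug {G C : Cmd} {y : ℕ} (h : y ∈ (G.plug C).declared) :
    y ∈ G.declared ∨ y ∈ C.declared := by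
  induction G <;> simp only [Cmd.plug, Cmd.declared, List.mem_cons, List.mem_append] at h ⊢ <;>
    grind

theorem Cmd.subst_plug {x a : ℕ} {G C : Cmd} (hG : G.IsBlock) (hx : x ∉ G.declared) :
    (G.plug C).subst x a = (G.subst x a).plug (C.subst x a) := by
  induction G <;>
    simp only [Cmd.plug, Cmd.declared, List.mem_cons, List.mem_append, not_or, Cmd.IsBlock,
      Cmd.subst] at hG hx ⊢ <;> grind

theorem substRights_eq_coe {x a : ℕ} {R : Rights} {RS : Finset KeyRef}
    (h : substRights x a R = RS) : ∃ RS' : Finset KeyRef, R = RS' ∧ RS = substKeys x a RS' := by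
  cases R using WithTop.recTopCoe with
  | top => cases h
  | coe R => exact ⟨R, rfl, (WithTop.coe_injective h).symm⟩

/-- Typing is preserved when `prog x` is replaced by a run-time name that does not occur in the
rights. -/
theorem CmdTyped.subst {x a : ℕ} {pc : Rights} {Γ Δ : Ctx} {C : Cmd} (hC : CmdTyped pc Γ C)
    (h : CtxSubst x a Γ Δ) (hn : Γ.NotIn a) (hpc : Rights.NotIn a pc) (hx : x ∉ C.declared) :
    CmdTyped (substRights x a pc) Δ (C.subst x a) := by
  induction hC generalizing Δ with
  | newPrin hw hpc' _ ih =>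
    simp only [Cmd.declared, List.mem_cons, not_or] at hx
    simp only [Cmd.subst, if_neg (Ne.symm hx.1)]
    exact .newPrin (h.wfKeys hw) (by rw [hpc']; rfl)
      (ih (h.addPrin (Ne.symm hx.1)) (hn.addPrin _) hpc hx.2)
  | new hw he hle hp _ ih =>
    simp only [Cmd.declared, List.mem_cons, not_or] at hx
    simp only [Cmd.subst, if_neg (Ne.symm hx.1)]
    refine .new (h.wfRights hw) (he.subst h hn)
      (by rw [← substRights_inf hpc (he.notIn hn)]; exact substRights_mono hle) ?_
      (ih (h.addVar (Ne.symm hx.1) _ _) (hn.addVar _ _ (hn.wfRights hw)) hpc hx.2)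
    intro RS hRS
    obtain ⟨RS', hR, rfl⟩ := substRights_eq_coe hRS
    obtain ⟨p, hp, hm⟩ := hp RS' hR
    exact ⟨_, h.prin p hp, Finset.mem_image_of_mem _ hm⟩
  | assign hv he hle _ ih =>
    simp only [Cmd.declared] at hx
    exact .assign (hv.subst h hn) (he.subst h hn)
      (by rw [← substRights_inf hpc (he.notIn hn)]; exact substRights_mono hle) (ih h hn hpc hx)
  | assignAt h₁ h₂ hv hle _ ih =>
    simp only [Cmd.declared] at hx
    exact .assignAt (h₁.subst h hn) (h₂.subst h hn) (hv.subst h hn)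
      (by rw [← substRights_inf hpc (h₁.notIn hn),
            ← substRights_inf (hpc.inf (h₁.notIn hn)) (h₂.notIn hn)]
          exact substRights_mono hle) (ih h hn hpc hx)
  | letKey hpc' he _ ih =>
    simp only [Cmd.declared, List.mem_cons, not_or] at hx
    simp only [Cmd.subst, if_neg (Ne.symm hx.1)]
    exact .letKey (by rw [hpc']; rfl) (he.subst h hn)
      (ih (h.addKey (Ne.symm hx.1)) (hn.addKey _) hpc hx.2)
  | ite h₁ h₂ _ _ ih₁ ih₂ =>
    simp only [Cmd.declared, List.mem_append, not_or] at hx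
    have hp' := (hpc.inf (h₁.notIn hn)).inf (h₂.notIn hn)
    have ih₁ := ih₁ h hn hp' hx.1
    have ih₂ := ih₂ h hn hp' hx.2
    rw [substRights_inf (hpc.inf (h₁.notIn hn)) (h₂.notIn hn), substRights_inf hpc (h₁.notIn hn)]
      at ih₁ ih₂
    exact .ite (h₁.subst h hn) (h₂.subst h hn) ih₁ ih₂
  | decrypt hw hm hp he hle _ _ ih₁ ih₂ =>
    simp only [Cmd.declared, List.mem_cons, List.mem_append, not_or] at hx
    simp only [Cmd.subst, if_neg (Ne.symm hx.1)]
    have hp' := hpc.inf (he.notIn hn)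
    have ih₁ := ih₁ (h.addVar (Ne.symm hx.1) _ _) (hn.addVar _ _ (hn.wfKeys hw)) hp' hx.2.1
    have ih₂ := ih₂ h hn hp' hx.2.2
    rw [substRights_inf hpc (he.notIn hn)] at ih₁ ih₂
    exact .decrypt (h.wfKeys hw) (Finset.mem_image_of_mem (KeyRef.subst x a) hm) (h.prin _ hp)
      (he.subst h hn) (by rw [← substRights_inf (he.notIn hn) hpc]; exact substRights_mono hle)
      ih₁ ih₂
  | register hp he hpc' _ _ ih₁ ih₂ =>
    simp only [Cmd.declared, List.mem_cons, List.mem_append, not_or] at hx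
    simp only [Cmd.subst, if_neg (Ne.symm hx.1)]
    exact .register (h.prin _ hp) (he.subst h hn) (by rw [hpc']; rfl)
      (ih₁ (h.addPrin (Ne.symm hx.1)) (hn.addPrin _) hpc hx.2.1) (ih₂ h hn hpc hx.2.2)
  | connectPub hpc' _ ih =>
    simp only [Cmd.declared, List.mem_cons, not_or] at hx
    simp only [Cmd.subst, if_neg (Ne.symm hx.1)]
    exact .connectPub (by rw [hpc']; rfl)
      (ih (h.addChan (Ne.symm hx.1) _ ⊤ ⊤) (hn.addChan _ _ (by rintro _ ⟨⟩) (by rintro _ ⟨⟩)) hpc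
        hx.2)
  | acceptPub hpc' _ ih =>
    simp only [Cmd.declared, List.mem_cons, not_or] at hx
    simp only [Cmd.subst, if_neg (Ne.symm hx.1)]
    exact .acceptPub (by rw [hpc']; rfl)
      (ih (h.addChan (Ne.symm hx.1) _ ⊤ ⊤) (hn.addChan _ _ (by rintro _ ⟨⟩) (by rintro _ ⟨⟩)) hpc
        hx.2)
  | connect hw₁ hw₂ hp hk hle₁ hle₂ hle₃ _ ih =>
    simp only [Cmd.declared, List.mem_cons, not_or] at hx
    simp only [Cmd.subst, if_neg (Ne.symm hx.1)]
    have hle₁ := substRights_mono (x := x) (a := a) hle₁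
    refine .connect (h.wfRights hw₁) (h.wfRights hw₂) (h.prin _ hp) (h.key _ hk) ?_
      (substRights_mono hle₂) (substRights_mono hle₃)
      (ih (h.addChan (Ne.symm hx.1) _ _ _) (hn.addChan _ _ (hn.wfRights hw₁) (hn.wfRights hw₂))
        (hn.wfRights hw₂) hx.2)
    simpa [substRights, substKeys, KeyRef.subst, Finset.image_insert] using hle₁
  | accept hw₁ hw₂ hp hk hle₁ hle₂ hle₃ _ ih =>
    simp only [Cmd.declared, List.mem_cons, not_or] at hx
    simp only [Cmd.subst, if_neg (Ne.symm hx.1)]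
    have hle₁ := substRights_mono (x := x) (a := a) hle₁
    refine .accept (h.wfRights hw₁) (h.wfRights hw₂) (h.prin _ hp) (h.key _ hk) ?_
      (substRights_mono hle₂) (substRights_mono hle₃)
      (ih (h.addChan (Ne.symm hx.1) _ _ _) (hn.addChan _ _ (hn.wfRights hw₁) (hn.wfRights hw₂))
        (hn.wfRights hw₂) hx.2)
    simpa [substRights, substKeys, KeyRef.subst, Finset.image_insert] using hle₁
  | output he hc hpc' hle _ ih =>
    simp only [Cmd.declared] at hx
    exact .output (he.subst h hn) (h.chan _ _ _ _ hc) (by rw [hpc']) (substRights_mono hle)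
      (ih h hn hpc hx)
  | input hc hpc' _ ih =>
    simp only [Cmd.declared, List.mem_cons, not_or] at hx
    simp only [Cmd.subst, if_neg (Ne.symm hx.1)]
    exact .input (h.chan _ _ _ _ hc) (by rw [hpc'])
      (ih (h.addVar (Ne.symm hx.1) _ _) (hn.addVar _ _ (hn.chan _ _ _ _ hc).1) hpc hx.2)
  | par _ _ ih₁ ih₂ =>
    simp only [Cmd.declared, List.mem_append, not_or] at hx
    exact .par (ih₁ h hn hpc hx.1) (ih₂ h hn hpc hx.2)
  | skip => exact .skip
  | bang _ ih => exact .bang (ih h hn hpc hx)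
  | sync hG _ ih =>
    simp only [Cmd.declared, List.mem_append, not_or] at hx
    refine .sync (Cmd.isBlock_subst _ _ hG) ?_
    rw [← Cmd.subst_plug hG hx.1]
    exact ih h hn hpc fun hm => (Cmd.mem_declared_plug hm).elim hx.1 hx.2

/-- The program name `x` is not declared in `Γ`. -/
structure Ctx.Lacks (x : ℕ) (Γ : Ctx) : Prop where
  prin : .prog x ∉ Γ.prin
  key : .prog x ∉ Γ.key
  chan : Γ.chan (.prog x) = none
  var : Γ.var (.prog x) = none

section
variable {x a : ℕ} {Γ : Ctx}

theorem Ctx.Lacks.addPrin (h : Γ.Lacks x) {y : ℕ} (hy : x ≠ y) : (Γ.addPrin y).Lacks x :=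
  ⟨by simp [Ctx.addPrin, hy, h.prin], h.key, h.chan, h.var⟩

theorem Ctx.Lacks.addKey (h : Γ.Lacks x) {y : ℕ} (hy : x ≠ y) : (Γ.addKey y).Lacks x :=
  ⟨h.prin, by simp [Ctx.addKey, hy, h.key], h.chan, h.var⟩

theorem Ctx.Lacks.addVar (h : Γ.Lacks x) {y : ℕ} (hy : x ≠ y) {S : Ty} {R : Rights} :
    (Γ.addVar y S R).Lacks x :=
  ⟨h.prin, h.key, h.chan, by simp [Ctx.addVar, hy, h.var]⟩

theorem Ctx.Lacks.addChan (h : Γ.Lacks x) {y : ℕ} (hy : x ≠ y) {S : Ty} {R₁ R₂ : Rights} :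
    (Γ.addChan y S R₁ R₂).Lacks x :=
  ⟨h.prin, h.key, by simp [Ctx.addChan, hy, h.chan], h.var⟩

theorem Name.subst_of_ne {p : Name} (h : p ≠ .prog x) : p.subst x a = p := by
  cases p with
  | prog y => exact Name.subst_prog_ne fun e => h (e ▸ rfl)
  | run b => rfl

theorem Ctx.Lacks.subst_prin (h : Γ.Lacks x) {p : Name} (hp : p ∈ Γ.prin) : p.subst x a = p :=
  Name.subst_of_ne fun e => h.prin (e ▸ hp)

theorem Ctx.Lacks.subst_key (h : Γ.Lacks x) {p : Name} (hp : p ∈ Γ.key) : p.subst x a = p :=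
  Name.subst_of_ne fun e => h.key (e ▸ hp)

theorem Ctx.Lacks.subst_chan (h : Γ.Lacks x) {p : Name} {t} (hp : Γ.chan p = some t) :
    p.subst x a = p :=
  Name.subst_of_ne fun e => by rw [e, h.chan] at hp; cases hp

theorem Ctx.Lacks.subst_var (h : Γ.Lacks x) {p : Name} {t} (hp : Γ.var p = some t) :
    p.subst x a = p :=
  Name.subst_of_ne fun e => by rw [e, h.var] at hp; cases hp

theorem Ctx.Lacks.substKeys (h : Γ.Lacks x) {RS : Finset KeyRef} (hw : Γ.WfKeys RS) :
    substKeys x a RS = RS := by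
  have : ∀ r ∈ RS, KeyRef.subst x a r = r := by
    rintro (p | p) hr
    · exact congrArg _ (h.subst_prin (hw.1 p hr))
    · exact congrArg _ (h.subst_key (hw.2 p hr))
  rw [CloudTypes.substKeys, Finset.image_congr (g := id) (fun r hr => this r hr), Finset.image_id]

theorem Ctx.Lacks.substRights (h : Γ.Lacks x) {R : Rights} (hw : Γ.WfRights R) :
    substRights x a R = R := by
  cases R using WithTop.recTopCoe with
  | top => rfl
  | coe RS => exact congrArg (fun s : Finset KeyRef => (s : Rights)) (h.substKeys (hw RS rfl))

theorem ExprTyped.subst_eq (h : Γ.Lacks x) {e : Expr} {S : Ty} {R : Rights}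
    (he : ExprTyped Γ e S R) : e.subst x a = e := by
  induction he with
  | var hx => exact congrArg Expr.var (h.subst_var hx)
  | int i => rfl
  | pub hp => exact congrArg Expr.pub (h.subst_prin hp)
  | release hp => exact congrArg Expr.release (h.subst_prin hp)
  | enc hw _ _ ih => simp [Expr.subst, ih, h.substKeys hw]
  | op _ _ ih₁ ih₂ => simp [Expr.subst, ih₁, ih₂]
  | array _ _ ih => simp [Expr.subst, ih]
  | index _ _ ih₁ ih₂ => simp_all [Expr.subst]

end

theorem Cmd.plug_subst_cancel {x a : ℕ} {G C : Cmd} (hG : G.IsBlock) (hx : x ∉ G.declared)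
    (h : (G.plug C).subst x a = G.plug C) : G.subst x a = G ∧ C.subst x a = C := by
  induction G <;>
    simp only [Cmd.plug, Cmd.declared, List.mem_cons, List.mem_append, not_or, Cmd.IsBlock,
      Cmd.subst] at hG hx h ⊢ <;> grind

/-- A well-typed command contains no free program name that its context does not declare. -/
theorem CmdTyped.subst_eq {x a : ℕ} {pc : Rights} {Γ : Ctx} {C : Cmd} (hC : CmdTyped pc Γ C)
    (h : Γ.Lacks x) (hx : x ∉ C.declared) : C.subst x a = C := by
  induction hC with
  | newPrin hw _ _ ih =>
    simp only [Cmd.declared, List.mem_cons, not_or] at hx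
    simp [Cmd.subst, h.substKeys hw, ih (h.addPrin hx.1) hx.2]
  | new hw he _ _ _ ih =>
    simp only [Cmd.declared, List.mem_cons, not_or] at hx
    simp [Cmd.subst, h.substRights hw, he.subst_eq h, ih (h.addVar hx.1) hx.2]
  | assign hv he _ _ ih =>
    have := hv.subst_eq h (a := a)
    simp_all [Cmd.subst, Cmd.declared, Expr.subst, he.subst_eq h]
  | assignAt h₁ h₂ hv _ _ ih =>
    have := hv.subst_eq h (a := a)
    simp_all [Cmd.subst, Cmd.declared, Expr.subst, h₁.subst_eq h, h₂.subst_eq h]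
  | letKey _ he _ ih =>
    simp only [Cmd.declared, List.mem_cons, not_or] at hx
    simp [Cmd.subst, he.subst_eq h, ih (h.addKey hx.1) hx.2]
  | ite h₁ h₂ _ _ ih₁ ih₂ =>
    simp only [Cmd.declared, List.mem_append, not_or] at hx
    simp [Cmd.subst, h₁.subst_eq h, h₂.subst_eq h, ih₁ h hx.1, ih₂ h hx.2]
  | decrypt hw _ hp he _ _ _ ih₁ ih₂ =>
    simp only [Cmd.declared, List.mem_cons, List.mem_append, not_or] at hx
    simp [Cmd.subst, h.substKeys hw, h.subst_prin hp, he.subst_eq h, ih₁ (h.addVar hx.1) hx.2.1,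
      ih₂ h hx.2.2]
  | register hp he _ _ _ ih₁ ih₂ =>
    simp only [Cmd.declared, List.mem_cons, List.mem_append, not_or] at hx
    simp [Cmd.subst, h.subst_prin hp, he.subst_eq h, ih₁ (h.addPrin hx.1) hx.2.1, ih₂ h hx.2.2]
  | connectPub _ _ ih | acceptPub _ _ ih =>
    simp only [Cmd.declared, List.mem_cons, not_or] at hx
    simp [Cmd.subst, ih (h.addChan hx.1) hx.2]
  | connect hw₁ hw₂ hp hk _ _ _ _ ih | accept hw₁ hw₂ hp hk _ _ _ _ ih =>
    simp only [Cmd.declared, List.mem_cons, not_or] at hx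
    simp [Cmd.subst, h.substRights hw₁, h.substRights hw₂, h.subst_prin hp, h.subst_key hk,
      ih (h.addChan hx.1) hx.2]
  | output he hc _ _ _ ih =>
    simp [Cmd.subst, he.subst_eq h, h.subst_chan hc, ih h hx]
  | input hc _ _ ih =>
    simp only [Cmd.declared, List.mem_cons, not_or] at hx
    simp [Cmd.subst, h.subst_chan hc, ih (h.addVar hx.1) hx.2]
  | par _ _ ih₁ ih₂ =>
    simp only [Cmd.declared, List.mem_append, not_or] at hx
    simp [Cmd.subst, ih₁ h hx.1, ih₂ h hx.2]
  | skip => rfl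
  | bang _ ih => exact congrArg Cmd.bang (ih h hx)
  | sync hG _ ih =>
    simp only [Cmd.declared, List.mem_append, not_or] at hx
    obtain ⟨h₁, h₂⟩ := Cmd.plug_subst_cancel hG hx.1
      (ih h fun hm => (Cmd.mem_declared_plug hm).elim hx.1 hx.2)
    simp [Cmd.subst, h₁, h₂]

theorem Ctx.Ok.lacks {M : Mem} {χ : ChanLabels} {Γ : Ctx} (h : Γ.Ok M χ) (x : ℕ) : Γ.Lacks x where
  prin hp := by obtain ⟨_, hP⟩ := h.prin _ hp; cases hP
  key hp := by obtain ⟨_, hP⟩ := h.key _ hp; cases hP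
  chan := by
    by_contra hc'
    obtain ⟨⟨S, R₁, R₂⟩, hc⟩ := Option.ne_none_iff_exists'.mp hc'
    obtain ⟨_, _, _, ⟨⟩, _⟩ := h.chan _ _ _ _ hc
  var := by
    by_contra hc
    obtain ⟨⟨S, R⟩, hc⟩ := Option.ne_none_iff_exists'.mp hc
    obtain ⟨_, _, ⟨⟩, _⟩ := h.var _ _ _ hc

theorem Ctx.Ok.notIn {M : Mem} {χ : ChanLabels} {Γ : Ctx} (h : Γ.Ok M χ) {a : ℕ} (ha : M a = none) :
    Γ.NotIn a where
  prin hp := by obtain ⟨_, hP⟩ := h.prin _ hp; simp [Mem.get, ha] at hP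
  key hp := by obtain ⟨_, hP⟩ := h.key _ hp; simp [Mem.get, ha] at hP
  chan c S R₁ R₂ hc := by
    obtain ⟨_, _, _, _, _, h₁, h₂⟩ := h.chan _ _ _ _ hc
    exact ⟨h₁.notIn ha, h₂.notIn ha⟩
  var y S R hy := by
    obtain ⟨_, _, _, hR⟩ := h.var _ _ _ hy
    exact hR.notIn ha

/-! ### Run-time contexts extended by an allocated name -/

/-- `Γ` with the principal `run a`. -/
def Ctx.bindPrin (Γ : Ctx) (a : ℕ) : Ctx := { Γ with prin := insert (.run a) Γ.prin }

/-- `Γ` with the key name `run a`. -/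
def Ctx.bindKey (Γ : Ctx) (a : ℕ) : Ctx := { Γ with key := insert (.run a) Γ.key }

/-- `Γ` with the channel `run c : Chan(S_R₁)_R₂`. -/
def Ctx.bindChan (Γ : Ctx) (c : ℕ) (S : Ty) (R₁ R₂ : Rights) : Ctx :=
  { Γ with chan := Function.update Γ.chan (.run c) (some (S, R₁, R₂)) }

/-- `Γ` with the variable `run a : S_R`. -/
def Ctx.bindVar (Γ : Ctx) (a : ℕ) (S : Ty) (R : Rights) : Ctx :=
  { Γ with var := Function.update Γ.var (.run a) (some (S, R)) }

section
variable {M : Mem} {χ : ChanLabels} {Γ : Ctx} {a : ℕ}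

theorem Ctx.Ok.bindPrin (h : Γ.Ok M χ) (ha : M a = none) (P : Principal) :
    (Γ.bindPrin a).Ok (M.set a (.prin P)) χ where
  prin p hp := by
    rcases Set.mem_insert_iff.1 hp with rfl | hp
    · exact ⟨P, Mem.set_self ..⟩
    · exact (h.ext (.set_fresh _ ha)).prin p hp
  key := (h.ext (.set_fresh _ ha)).key
  var := (h.ext (.set_fresh _ ha)).var
  chan := (h.ext (.set_fresh _ ha)).chan

theorem Ctx.Ok.bindKey (h : Γ.Ok M χ) (ha : M a = none) (κ : Key) :
    (Γ.bindKey a).Ok (M.set a (.key κ)) χ where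
  key p hp := by
    rcases Set.mem_insert_iff.1 hp with rfl | hp
    · exact ⟨κ, Mem.set_self ..⟩
    · exact (h.ext (.set_fresh _ ha)).key p hp
  prin := (h.ext (.set_fresh _ ha)).prin
  var := (h.ext (.set_fresh _ ha)).var
  chan := (h.ext (.set_fresh _ ha)).chan

theorem Ctx.Ok.bindVar (h : Γ.Ok M χ) (ha : M a = none) (S : Ty) {R : Rights} {L : Label}
    (hR : EvalRights M R L) (v : Value) : (Γ.bindVar a S R).Ok (M.set a (.var v L)) χ where
  key := (h.ext (.set_fresh _ ha)).key
  prin := (h.ext (.set_fresh _ ha)).prin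
  var y S' R' hy := by
    by_cases hya : y = .run a
    · subst hya
      simp [Ctx.bindVar] at hy
      exact ⟨v, L, Mem.set_self .., hy.2 ▸ hR.mono (.set_fresh _ ha)⟩
    · simp only [Ctx.bindVar, Function.update_of_ne hya] at hy
      exact (h.ext (.set_fresh _ ha)).var y S' R' hy
  chan := (h.ext (.set_fresh _ ha)).chan

theorem Ctx.Ok.bindChan {c : ℕ} (h : Γ.Ok M χ) (S : Ty) {R₁ R₂ : Rights}
    {L₁ L₂ : Label} (hR₁ : EvalRights M R₁ L₁) (hR₂ : EvalRights M R₂ L₂) :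
    (Γ.bindChan c S R₁ R₂).Ok M (Function.update χ c (some (L₁, L₂))) where
  key := h.key
  prin := h.prin
  var := h.var
  chan y S' R₁' R₂' hy := by
    by_cases hya : y = .run c
    · subst hya
      simp [Ctx.bindChan] at hy
      exact ⟨c, L₁, L₂, rfl, by simp, hy.2.1 ▸ hR₁, hy.2.2 ▸ hR₂⟩
    · simp only [Ctx.bindChan, Function.update_of_ne hya] at hy
      obtain ⟨k, L₁', L₂', rfl, hk, h'⟩ := h.chan y S' R₁' R₂' hy
      refine ⟨k, L₁', L₂', rfl, ?_, h'⟩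
      rw [Function.update_of_ne fun e => hya (by rw [e]), hk]

theorem Ctx.Ok.ctxSubst (h : Γ.Ok M χ) (x a : ℕ) : CtxSubst x a Γ Γ where
  prin p hp := by rwa [(h.lacks x).subst_prin hp]
  key p hp := by rwa [(h.lacks x).subst_key hp]
  chan c S R₁ R₂ hc := by
    obtain ⟨_, _, _, _, _, h₁, h₂⟩ := h.chan _ _ _ _ hc
    rwa [(h.lacks x).subst_chan hc, h₁.subst_eq, h₂.subst_eq]
  var c S R hc := by
    obtain ⟨_, _, _, h₁⟩ := h.var _ _ _ hc
    rwa [(h.lacks x).subst_var hc, h₁.subst_eq]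

variable {x : ℕ} {pc : Rights} {ℓ : Label} {C : Cmd}

/-- The executed declaration of a principal: its scope is typed in the context with the new
location. The analogous lemmas below concern the other declarations. -/
theorem CmdTyped.bindPrin (hC : CmdTyped pc (Γ.addPrin x) C) (h : Γ.Ok M χ) (ha : M a = none)
    (hpc : EvalRights M pc ℓ) (hx : x ∉ C.declared) : CmdTyped pc (Γ.bindPrin a) (C.subst x a) := by
  have hs : CtxSubst x a (Γ.addPrin x) (Γ.bindPrin a) :=
    { h.ctxSubst x a with
      prin := by
        intro p hp
        rcases Set.mem_insert_iff.1 hp with rfl | hp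
        · simp [Name.subst, Ctx.bindPrin]
        · exact Set.mem_insert_of_mem _ ((h.ctxSubst x a).prin p hp) }
  have := hC.subst hs ((h.notIn ha).addPrin x) (hpc.notIn ha) hx
  rwa [hpc.subst_eq] at this

theorem CmdTyped.bindKey (hC : CmdTyped pc (Γ.addKey x) C) (h : Γ.Ok M χ) (ha : M a = none)
    (hpc : EvalRights M pc ℓ) (hx : x ∉ C.declared) : CmdTyped pc (Γ.bindKey a) (C.subst x a) := by
  have hs : CtxSubst x a (Γ.addKey x) (Γ.bindKey a) :=
    { h.ctxSubst x a with
      key := by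
        intro p hp
        rcases Set.mem_insert_iff.1 hp with rfl | hp
        · simp [Name.subst, Ctx.bindKey]
        · exact Set.mem_insert_of_mem _ ((h.ctxSubst x a).key p hp) }
  have := hC.subst hs ((h.notIn ha).addKey x) (hpc.notIn ha) hx
  rwa [hpc.subst_eq] at this

theorem CmdTyped.bindVar {S : Ty} {R : Rights} {L : Label} (hC : CmdTyped pc (Γ.addVar x S R) C)
    (h : Γ.Ok M χ) (ha : M a = none) (hpc : EvalRights M pc ℓ) (hR : EvalRights M R L)
    (hx : x ∉ C.declared) : CmdTyped pc (Γ.bindVar a S R) (C.subst x a) := by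
  have hs : CtxSubst x a (Γ.addVar x S R) (Γ.bindVar a S R) :=
    { h.ctxSubst x a with
      var := by
        intro y S' R' hy
        by_cases hyx : y = .prog x
        · subst hyx
          simp [Ctx.addVar] at hy
          obtain ⟨rfl, rfl⟩ := hy
          simp [Name.subst, Ctx.bindVar, hR.subst_eq]
        · simp only [Ctx.addVar, Function.update_of_ne hyx] at hy
          have hya : y.subst x a ≠ .run a := by
            rw [(h.lacks x).subst_var hy]
            rintro rfl
            obtain ⟨_, _, hv, _⟩ := h.var _ _ _ hy
            simp [Mem.get, ha] at hv
          simp only [Ctx.bindVar, Function.update_of_ne hya]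
          exact (h.ctxSubst x a).var _ _ _ hy }
  have := hC.subst hs ((h.notIn ha).addVar x S (hR.notIn ha)) (hpc.notIn ha) hx
  rwa [hpc.subst_eq] at this

theorem CmdTyped.bindChan {c : ℕ} {S : Ty} {R₁ R₂ : Rights} {L₁ L₂ : Label}
    (hC : CmdTyped pc (Γ.addChan x S R₁ R₂) C)
    (h : Γ.Ok M χ) (ha : M c = none) (hc : χ c = none) (hpc : EvalRights M pc ℓ)
    (hR₁ : EvalRights M R₁ L₁) (hR₂ : EvalRights M R₂ L₂)
    (hx : x ∉ C.declared) : CmdTyped pc (Γ.bindChan c S R₁ R₂) (C.subst x c) := by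
  have hs : CtxSubst x c (Γ.addChan x S R₁ R₂) (Γ.bindChan c S R₁ R₂) :=
    { h.ctxSubst x c with
      chan := by
        intro y S' R₁' R₂' hy
        by_cases hyx : y = .prog x
        · subst hyx
          simp [Ctx.addChan] at hy
          obtain ⟨rfl, rfl, rfl⟩ := hy
          simp [Name.subst, Ctx.bindChan, hR₁.subst_eq, hR₂.subst_eq]
        · simp only [Ctx.addChan, Function.update_of_ne hyx] at hy
          have hya : y.subst x c ≠ .run c := by
            rw [(h.lacks x).subst_chan hy]
            rintro rfl
            obtain ⟨_, _, _, hk, hv, _⟩ := h.chan _ _ _ _ hy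
            cases hk
            rw [hc] at hv; cases hv
          simp only [Ctx.bindChan, Function.update_of_ne hya]
          exact (h.ctxSubst x c).chan _ _ _ _ hy }
  have := hC.subst hs ((h.notIn ha).addChan x S (hR₁.notIn ha) (hR₂.notIn ha)) (hpc.notIn ha) hx
  rwa [hpc.subst_eq] at this

end

/-! ### Nonces, values and the evaluation of expressions -/

/-- A record of data attached to nonces: it is single-valued, and its nonces have been generated. -/
structure NonceLog {β : Type} (N : Set (ℕ × β)) (u : Finset ℕ) : Prop where
  functional : ∀ n p q, (n, p) ∈ N → (n, q) ∈ N → p = q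
  used : ∀ p ∈ N, p.1 ∈ u

theorem NonceLog.mono {β : Type} {N : Set (ℕ × β)} {u u' : Finset ℕ} (h : NonceLog N u)
    (hu : u ⊆ u') : NonceLog N u' := ⟨h.functional, fun p hp => hu (h.used p hp)⟩

theorem NonceLog.insert {β : Type} {N : Set (ℕ × β)} {u : Finset ℕ} (h : NonceLog N u) {n : ℕ}
    (hn : n ∉ u) (b : β) : NonceLog (insert (n, b) N) (insert n u) where
  functional m p q hp hq := by
    have hN : ∀ b, (n, b) ∉ N := fun b hb => hn (h.used _ hb)
    rcases Set.mem_insert_iff.1 hp with hp | hp <;> rcases Set.mem_insert_iff.1 hq with hq | hq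
    · cases hp; cases hq; rfl
    · cases hp; exact absurd hq (hN _)
    · cases hq; exact absurd hp (hN _)
    · exact h.functional m p q hp hq
  used p hp := by
    rcases Set.mem_insert_iff.1 hp with rfl | hp
    · exact Finset.mem_insert_self ..
    · exact Finset.mem_insert_of_mem (h.used p hp)

/-- Every ciphertext in the value, at any depth, has the content that `N` records for its nonce. -/
inductive Value.Conf (N : Set (ℕ × Value)) : Value → Prop
  | int (i : ℤ) : Conf N (.int i)
  | pub (k : Key) : Conf N (.pub k)
  | enc {v n K} : (n, v) ∈ N → Conf N v → Conf N (.enc v n K)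
  | encPrin (P n K) : Conf N (.encPrin P n K)
  | array {m} {vs : Fin m → Value} : (∀ i, Conf N (vs i)) → Conf N (.array m vs)
  | nav : Conf N .nav

theorem Value.Conf.mono {N N' : Set (ℕ × Value)} (h : N ⊆ N') {v : Value} (hv : v.Conf N) :
    v.Conf N' := by
  induction hv with
  | int | pub | encPrin | nav => constructor
  | enc hn _ ih => exact .enc (h hn) ih
  | array _ ih => exact .array ih

/-- The relation between the values of an observable variable in two runs. Ciphertexts that `L`
hides have the same nonce and keys, and `N` records the two contents; everything else is equal. In
contrast to `Value.erase`, encapsulated principals are never hidden. -/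
inductive VRel (L : Label) (N : Set (ℕ × Value × Value)) : Value → Value → Prop
  | int (i : ℤ) : VRel L N (.int i) (.int i)
  | pub (k : Key) : VRel L N (.pub k) (.pub k)
  | enc {v w n} {K : Finset Key} : ¬ (K : Label) ≤ L → VRel L N v w →
      VRel L N (.enc v n K) (.enc w n K)
  | hidden {v w n} {K : Finset Key} : (K : Label) ≤ L → (n, v, w) ∈ N →
      VRel L N (.enc v n K) (.enc w n K)
  | encPrin (P n K) : VRel L N (.encPrin P n K) (.encPrin P n K)
  | array {m} {vs ws : Fin m → Value} : (∀ i, VRel L N (vs i) (ws i)) →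
      VRel L N (.array m vs) (.array m ws)
  | nav : VRel L N .nav .nav

section
variable {L : Label} {N N' : Set (ℕ × Value × Value)}

theorem VRel.mono (h : N ⊆ N') {v w : Value} (hv : VRel L N v w) : VRel L N' v w := by
  induction hv with
  | int | pub | encPrin | nav => constructor
  | enc hK _ ih => exact .enc hK ih
  | hidden hK hn => exact .hidden hK (h hn)
  | array _ ih => exact .array ih

/-- Comparisons of related values give the same result in both runs; see also `VRel.left_unique`. -/
theorem VRel.right_unique {u : Finset ℕ} (hN : NonceLog N u) {v w w' : Value} (h : VRel L N v w)
    (h' : VRel L N v w') : w = w' := by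
  induction h generalizing w' with
  | int | pub | encPrin | nav => cases h'; rfl
  | enc hK _ ih =>
    cases h' with
    | enc _ h => rw [ih h]
    | hidden hK' => exact absurd hK' hK
  | hidden hK hn =>
    cases h' with
    | enc hK' => exact absurd hK hK'
    | hidden _ hn' => cases hN.functional _ _ _ hn hn'; rfl
  | array _ ih =>
    cases h' with
    | array h => exact congrArg _ (funext fun i => ih i (h i))

theorem VRel.left_unique {u : Finset ℕ} (hN : NonceLog N u) {v v' w : Value} (h : VRel L N v w)
    (h' : VRel L N v' w) : v = v' := by
  induction h generalizing v' with
  | int | pub | encPrin | nav => cases h'; rfl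
  | enc hK _ ih =>
    cases h' with
    | enc _ h => rw [ih h]
    | hidden hK' => exact absurd hK' hK
  | hidden hK hn =>
    cases h' with
    | enc hK' => exact absurd hK hK'
    | hidden _ hn' => cases hN.functional _ _ _ hn hn'; rfl
  | array _ ih =>
    cases h' with
    | array h => exact congrArg _ (funext fun i => ih i (h i))

theorem VRel.erase_eq {v w : Value} (h : VRel L N v w) : v.erase L = w.erase L := by
  induction h with
  | int | pub | encPrin | nav => rfl
  | enc hK _ ih => simp [Value.erase, hK, ih]
  | hidden hK hn => simp [Value.erase, hK]
  | array _ ih => simp [Value.erase, ih]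

/-- By uniqueness of nonces, a conforming value is related to itself. -/
theorem Value.Conf.vRel {N₀ : Set (ℕ × Value)} {v : Value} (h : v.Conf N₀)
    (hN : ∀ n v, (n, v) ∈ N₀ → (n, v, v) ∈ N) : VRel L N v v := by
  induction h with
  | int | pub | encPrin | nav => constructor
  | @enc v n K hn _ ih =>
    by_cases hK : (K : Label) ≤ L
    · exact .hidden hK (hN _ _ hn)
    · exact .enc hK ih
  | array _ ih => exact .array ih

theorem VRel.applyOp {v₁ v₂ w₁ w₂ : Value} (f : ℤ → ℤ → Option ℤ) (h₁ : VRel L N v₁ w₁)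
    (h₂ : VRel L N v₂ w₂) : VRel L N (Value.applyOp f v₁ v₂) (Value.applyOp f w₁ w₂) := by
  cases h₁ <;> cases h₂ <;> simp only [Value.applyOp] <;> try exact .nav
  cases f _ _ <;> constructor

theorem VRel.getAt {v₁ v₂ w₁ w₂ : Value} (h₁ : VRel L N v₁ w₁)
    (h₂ : VRel L N v₂ w₂) : VRel L N (v₁.getAt v₂) (w₁.getAt w₂) := by
  cases h₁ <;> cases h₂ <;> simp only [Value.getAt] <;> try exact .nav
  split_ifs
  · rename_i h _ _; exact h _
  · exact .nav

theorem VRel.setAt {v₁ v₂ v₃ w₁ w₂ w₃ : Value} (h₁ : VRel L N v₁ w₁)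
    (h₂ : VRel L N v₂ w₂) (h₃ : VRel L N v₃ w₃) : VRel L N (v₁.setAt v₂ v₃) (w₁.setAt w₂ w₃) := by
  cases h₁ with
  | array h =>
    cases h₂ with
    | int i =>
      simp only [Value.setAt]
      split_ifs with hi
      · refine .array fun j => ?_
        by_cases hj : j = ⟨i.toNat, hi.2⟩
        · subst hj; simpa using h₃
        · simpa [Function.update_of_ne hj] using h j
      · exact .array h
    | _ => exact .array h
  | int | pub | encPrin | nav => constructor
  | enc hK h => exact .enc hK h
  | hidden hK h => exact .hidden hK h

end

theorem Value.Conf.applyOp {N : Set (ℕ × Value)} (f : ℤ → ℤ → Option ℤ) (v w : Value) :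
    (Value.applyOp f v w).Conf N := by
  cases v <;> cases w <;> simp only [Value.applyOp] <;> try exact .nav
  cases f _ _ <;> constructor

theorem Value.Conf.getAt {N : Set (ℕ × Value)} {v : Value} (h : v.Conf N) (w : Value) :
    (v.getAt w).Conf N := by
  cases h with
  | array h =>
    cases w <;> simp only [Value.getAt] <;> try exact .nav
    split_ifs
    · exact h _
    · exact .nav
  | _ => exact .nav

theorem Value.Conf.setAt {N : Set (ℕ × Value)} {v₁ v₃ : Value} (h₁ : v₁.Conf N) (v₂ : Value)
    (h₃ : v₃.Conf N) : (v₁.setAt v₂ v₃).Conf N := by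
  cases h₁ with
  | array h =>
    cases v₂ with
    | int i =>
      simp only [Value.setAt]
      split_ifs with hi
      · refine .array fun j => ?_
        by_cases hj : j = ⟨i.toNat, hi.2⟩
        · subst hj; simpa using h₃
        · simpa [Function.update_of_ne hj] using h j
      · exact .array h
    | _ => exact .array h
  | int | pub | encPrin | nav => constructor
  | enc hK h => exact .enc hK h

/-- All values in the memory conform to `N`. -/
def MemConf (N : Set (ℕ × Value)) (M : Mem) : Prop := ∀ a v L, M a = some (.var v L) → v.Conf N

theorem MemConf.mono {N N' : Set (ℕ × Value)} (h : N ⊆ N') {M : Mem} (hM : MemConf N M) :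
    MemConf N' M := fun a v L hv => (hM a v L hv).mono h

theorem MemConf.get {N : Set (ℕ × Value)} {M : Mem} (hM : MemConf N M) {x : Name} {v : Value}
    {L : Label} (hx : M.get x = some (.var v L)) : v.Conf N := by
  obtain ⟨a, rfl, ha⟩ := Mem.get_eq_some hx
  exact hM a v L ha

theorem MemConf.set {N : Set (ℕ × Value)} {M : Mem} (hM : MemConf N M) (a : ℕ) {c : Cell}
    (hc : ∀ v L, c = .var v L → v.Conf N) : MemConf N (M.set a c) := by
  intro b v L hb
  by_cases hba : b = a
  · subst hba; rw [Mem.set_self] at hb; exact hc v L (Option.some.inj hb)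
  · rw [Mem.set_ne _ _ hba] at hb; exact hM b v L hb

theorem Eval.used_subset {M : Mem} {u u' : Finset ℕ} {e : Expr} {v : Value}
    (h : Eval M u e v u') : u ⊆ u' := by
  induction h with
  | var | pub | releaseErr | lit => exact Finset.Subset.refl _
  | release => exact Finset.subset_insert ..
  | enc _ _ _ ih => exact ih.trans (Finset.subset_insert ..)
  | op _ _ ih₁ ih₂ => exact ih₁.trans ih₂
  | array us h0 h1 _ ih =>
    rw [← h0, ← h1]
    exact (Fin.monotone_iff_le_succ.2 ih) (Fin.zero_le _)
  | index _ _ ih => exact ih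

/-- A chain of states, along which an invariant is preserved, can be built step by step. -/
theorem exists_chain {α : Type} {m : ℕ} (I : Fin (m + 1) → α → Prop) (r : Fin m → α → α → Prop)
    (s₀ : α) (h₀ : I 0 s₀)
    (hs : ∀ i s, I i.castSucc s → ∃ s', I i.succ s' ∧ r i s s') :
    ∃ us : Fin (m + 1) → α, us 0 = s₀ ∧ (∀ k, I k (us k)) ∧
      ∀ i, r i (us i.castSucc) (us i.succ) := by
  choose f hf using hs
  let F : ∀ k, {s // I k s} :=
    Fin.induction ⟨s₀, h₀⟩ fun i s => ⟨f i s.1 s.2, (hf i s.1 s.2).1⟩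
  refine ⟨fun k => (F k).1, rfl, fun k => (F k).2, fun i => ?_⟩
  have : F i.succ = ⟨f i (F i.castSucc).1 (F i.castSucc).2, (hf i _ _).1⟩ := Fin.induction_succ ..
  simp only [this]
  exact (hf i _ _).2

/-- Evaluation preserves the uniqueness of nonces. -/
theorem Eval.conf {M : Mem} {u u' : Finset ℕ} {e : Expr} {v : Value} (h : Eval M u e v u')
    {Γ : Ctx} {S : Ty} {R : Rights} (he : ExprTyped Γ e S R) {N : Set (ℕ × Value)}
    (hM : MemConf N M) (hN : NonceLog N u) :
    ∃ N', N ⊆ N' ∧ NonceLog N' u' ∧ v.Conf N' := by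
  induction h generalizing S R N with
  | var hx => exact ⟨N, subset_rfl, hN, hM.get hx⟩
  | pub | releaseErr => exact ⟨N, subset_rfl, hN, by constructor⟩
  | release => exact ⟨N, subset_rfl, hN.mono (Finset.subset_insert ..), by constructor⟩
  | @enc u u' e RS v K n hE hK hn ih =>
    cases he with
    | enc _ he _ =>
      obtain ⟨N', hs, hN', hv⟩ := ih he hM hN
      exact ⟨insert (n, v) N', hs.trans (Set.subset_insert ..), hN'.insert hn v,
        .enc (Set.mem_insert ..) (hv.mono (Set.subset_insert ..))⟩
  | op _ _ ih₁ ih₂ =>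
    cases he with
    | op h₁ h₂ =>
      obtain ⟨N₁, hs₁, hN₁, -⟩ := ih₁ h₁ hM hN
      obtain ⟨N₂, hs₂, hN₂, -⟩ := ih₂ h₂ (hM.mono hs₁) hN₁
      exact ⟨N₂, hs₁.trans hs₂, hN₂, .applyOp ..⟩
  | @array u u' m es vs us h0 h1 _ ih =>
    subst h0 h1
    cases he with
    | array _ he =>
      obtain ⟨Ns, h0, hI, hr⟩ := exists_chain
        (I := fun k N' => N ⊆ N' ∧ NonceLog N' (us k))
        (r := fun i N₁ N₂ => N₁ ⊆ N₂ ∧ (vs i).Conf N₂)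
        N ⟨subset_rfl, hN⟩ fun i N₁ h => by
          obtain ⟨N₂, hs, hN₂, hv⟩ := ih i (he i) (hM.mono h.1) h.2
          exact ⟨N₂, ⟨h.1.trans hs, hN₂⟩, hs, hv⟩
      have hmono : Monotone Ns := Fin.monotone_iff_le_succ.2 fun i => (hr i).1
      exact ⟨Ns (Fin.last m), (hI _).1, (hI _).2,
        .array fun i => (hr i).2.mono (hmono (Fin.le_last _))⟩
  | index hx _ ih =>
    cases he with
    | index h₁ h₂ =>
      obtain ⟨N', hs, hN', -⟩ := ih h₂ hM hN
      exact ⟨N', hs, hN', ((hM.get hx).mono hs).getAt _⟩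
  | lit =>
    cases he
    exact ⟨N, subset_rfl, hN, by constructor⟩

/-- A well-typed expression can be evaluated, and the generated nonces can be chosen outside of `U`.
-/
theorem ExprTyped.exists_eval {M : Mem} {χ : ChanLabels} {Γ : Ctx} (h : Γ.Ok M χ) (U : Finset ℕ)
    {e : Expr} {S : Ty} {R : Rights} (he : ExprTyped Γ e S R) (u : Finset ℕ) :
    ∃ v u', Eval M u e v u' ∧ ∀ n ∈ u', n ∈ U → n ∈ u := by
  induction he generalizing u with
  | var hx =>
    obtain ⟨v, L, hv, -⟩ := h.var _ _ _ hx
    exact ⟨v, u, .var hv, fun _ hn _ => hn⟩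
  | int => exact ⟨_, u, .lit, fun _ hn _ => hn⟩
  | pub hp =>
    obtain ⟨P, hP⟩ := h.prin _ hp
    exact ⟨_, u, .pub hP, fun _ hn _ => hn⟩
  | release hp =>
    obtain ⟨P, hP⟩ := h.prin _ hp
    by_cases hr : P.rights = ∅
    · exact ⟨_, u, .releaseErr hP hr, fun _ hn _ => hn⟩
    · obtain ⟨n, hn⟩ := Infinite.exists_notMem_finset (u ∪ U)
      refine ⟨_, _, .release hP hr (n := n) (fun h => hn (by simp [h])), fun k hk hU => ?_⟩
      rcases Finset.mem_insert.1 hk with rfl | hk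
      · exact absurd (by simp [hU]) hn
      · exact hk
  | enc hw _ _ ih =>
    obtain ⟨v, u', hE, hu⟩ := ih u
    obtain ⟨K, hK⟩ := h.evalKeys hw
    obtain ⟨n, hn⟩ := Infinite.exists_notMem_finset (u' ∪ U)
    refine ⟨_, _, .enc hE hK (n := n) (fun h => hn (by simp [h])), fun k hk hU => ?_⟩
    rcases Finset.mem_insert.1 hk with rfl | hk
    · exact absurd (by simp [hU]) hn
    · exact hu k hk hU
  | op _ _ ih₁ ih₂ =>
    obtain ⟨v₁, u₁, h₁, hu₁⟩ := ih₁ u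
    obtain ⟨v₂, u₂, h₂, hu₂⟩ := ih₂ u₁
    exact ⟨_, _, .op h₁ h₂, fun n hn hU => hu₁ n (hu₂ n hn hU) hU⟩
  | index hx _ _ ih =>
    cases hx with
    | var hx =>
      obtain ⟨w, L, hw, -⟩ := h.var _ _ _ hx
      obtain ⟨v, u', hE, hu⟩ := ih u
      exact ⟨_, _, .index hw hE, hu⟩
  | @array m S R es hw _ ih =>
    obtain ⟨us, h0, hI, hr⟩ := exists_chain
      (I := fun _ u' => ∀ n ∈ u', n ∈ U → n ∈ u) (r := fun i u₁ u₂ => ∃ v, Eval M u₁ (es i) v u₂)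
      u (fun _ hn _ => hn) fun i u₁ hu₁ => by
        obtain ⟨v, u₂, hE, hu₂⟩ := ih i u₁
        exact ⟨u₂, fun n hn hU => hu₁ n (hu₂ n hn hU) hU, v, hE⟩
    choose vs hvs using hr
    exact ⟨_, _, .array us h0 rfl hvs, hI _⟩

/-! ### Related memories -/

/-- Cells of the same kind and label, with related values. -/
inductive Cell.Rel (L : Label) (N : Set (ℕ × Value × Value)) : Cell → Cell → Prop
  | var {v w} (Lx : Label) : VRel L N v w → Rel L N (.var v Lx) (.var w Lx)
  | prin (P : Principal) : Rel L N (.prin P) (.prin P)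
  | key (κ : Key) : Rel L N (.key κ) (.key κ)

theorem Cell.Rel.mono {L : Label} {N N' : Set (ℕ × Value × Value)} (h : N ⊆ N') {c c' : Cell}
    (hc : c.Rel L N c') : c.Rel L N' c' := by
  cases hc with
  | var Lx hv => exact .var Lx (hv.mono h)
  | prin P => exact .prin P
  | key κ => exact .key κ

/-- The two memories agree, in the sense of `VRel`, on all cells with a label not below `L`. -/
structure MRel (L : Label) (N : Set (ℕ × Value × Value)) (M M' : Mem) : Prop where
  left : ∀ a c, M a = some c → ¬ c.label ≤ L → ∃ c', M' a = some c' ∧ c.Rel L N c'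
  right : ∀ a c', M' a = some c' → ¬ c'.label ≤ L → ∃ c, M a = some c ∧ c.Rel L N c'

section
variable {L : Label} {N N' : Set (ℕ × Value × Value)} {M M₁ M' : Mem}

theorem MRel.mono (h : N ⊆ N') (hM : MRel L N M M') : MRel L N' M M' where
  left a c hc hl := (hM.left a c hc hl).imp fun _ h' => ⟨h'.1, h'.2.mono h⟩
  right a c hc hl := (hM.right a c hc hl).imp fun _ h' => ⟨h'.1, h'.2.mono h⟩

theorem MRel.get_prin (h : MRel L N M M') (hL : L ≠ ⊤) {x : Name} {P : Principal}
    (hx : M.get x = some (.prin P)) : M'.get x = some (.prin P) := by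
  obtain ⟨a, rfl, ha⟩ := Mem.get_eq_some hx
  obtain ⟨c', hc', hr⟩ := h.left a _ ha (by simpa [Cell.label] using hL)
  cases hr; exact hc'

theorem MRel.get_key (h : MRel L N M M') (hL : L ≠ ⊤) {x : Name} {P : Key}
    (hx : M.get x = some (.key P)) : M'.get x = some (.key P) := by
  obtain ⟨a, rfl, ha⟩ := Mem.get_eq_some hx
  obtain ⟨c', hc', hr⟩ := h.left a _ ha (by simpa [Cell.label] using hL)
  cases hr; exact hc'

theorem MRel.get_var (h : MRel L N M M') {x : Name} {v w : Value} {Lx Ly : Label}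
    (hx : M.get x = some (.var v Lx)) (hy : M'.get x = some (.var w Ly)) (hl : ¬ Lx ≤ L) :
    VRel L N v w := by
  obtain ⟨a, rfl, ha⟩ := Mem.get_eq_some hx
  obtain ⟨c', hc', hr⟩ := h.left a _ ha hl
  cases hr
  cases hc'.symm.trans hy
  assumption

theorem MRel.evalKey (h : MRel L N M M') (hL : L ≠ ⊤) (r : KeyRef) (κ : Key)
    (hr : EvalKey M r κ) : EvalKey M' r κ := by
  cases hr with
  | pub hp => exact .pub (h.get_prin hL hp)
  | key hk => exact .key (h.get_key hL hk)

/-- A change of the first memory below `L` is invisible. -/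
theorem MRel.stepLe_left (h : MRel L N M M') (hs : M.StepLe L M₁) : MRel L N M₁ M' where
  left a c hc hl := h.left a c (by_contra fun hn => hl (hs.label_le a c hc hn)) hl
  right a c' hc' hl := by
    obtain ⟨c, hc, hr⟩ := h.right a c' hc' hl
    obtain ⟨d, hd, hk⟩ := hs.ext a c hc
    by_cases hcd : M a = some d
    · cases hc.symm.trans hcd; exact ⟨c, hd, hr⟩
    · refine absurd (hs.label_le a d hd hcd) ?_
      rw [← hk.label_eq]
      cases hr <;> exact hl

/-- A change of the second memory below `L` is invisible. -/
theorem MRel.stepLe_right (h : MRel L N M M') (hs : M'.StepLe L M₁) : MRel L N M M₁ where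
  right a c hc hl := h.right a c (by_contra fun hn => hl (hs.label_le a c hc hn)) hl
  left a c' hc' hl := by
    obtain ⟨c, hc, hr⟩ := h.left a c' hc' hl
    obtain ⟨d, hd, hk⟩ := hs.ext a c hc
    by_cases hcd : M' a = some d
    · cases hc.symm.trans hcd; exact ⟨c, hd, hr⟩
    · refine absurd (hs.label_le a d hd hcd) ?_
      rw [← hk.label_eq]
      cases hr <;> exact hl

/-- Both memories are changed at the same location, to cells of the same label. -/
theorem MRel.set (h : MRel L N M M') (a : ℕ) {c c' : Cell} (hl : c.label = c'.label)
    (hc : ¬ c.label ≤ L → c.Rel L N c') : MRel L N (M.set a c) (M'.set a c') where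
  left b d hd hdl := by
    by_cases hb : b = a
    · subst hb
      rw [Mem.set_self] at hd; cases hd
      exact ⟨c', Mem.set_self .., hc hdl⟩
    · rw [Mem.set_ne _ _ hb] at hd ⊢; exact h.left b d hd hdl
  right b d hd hdl := by
    by_cases hb : b = a
    · subst hb
      rw [Mem.set_self] at hd; cases hd
      exact ⟨c, Mem.set_self .., hc (hl ▸ hdl)⟩
    · rw [Mem.set_ne _ _ hb] at hd ⊢; exact h.right b d hd hdl

theorem not_le_of_inf {R R' : Rights} {Lx L₁ L₂ : Label} (h : EvalRights M (R ⊓ R') Lx)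
    (h₁ : EvalRights M R L₁) (h₂ : EvalRights M R' L₂) (hl : ¬ Lx ≤ L) : ¬ L₁ ≤ L ∧ ¬ L₂ ≤ L :=
  ⟨fun h' => hl ((h.le inf_le_left h₁).trans h'), fun h' => hl ((h.le inf_le_right h₂).trans h')⟩

theorem union_sdiff_union_sdiff {u u₁ u₂ : Finset ℕ} (D : Finset ℕ) (h₁ : u ⊆ u₁) (h₂ : u₁ ⊆ u₂) :
    (D ∪ u₁ \ u) ∪ u₂ \ u₁ = D ∪ u₂ \ u := by
  ext n
  simp only [Finset.mem_union, Finset.mem_sdiff]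
  have := @h₁ n
  have := @h₂ n
  tauto

/-- A well-typed expression evaluates in related memories with the same fresh nonces, to related
values if its type is not below `L`. -/
theorem Eval.sim {χ : ChanLabels} {Γ : Ctx} (hL : L ≠ ⊤) {u u' : Finset ℕ} {e : Expr} {v : Value}
    (hE : Eval M u e v u') {S : Ty} {R : Rights} (he : ExprTyped Γ e S R) (hΓ : Γ.Ok M χ)
    (hΓ' : Γ.Ok M' χ) (hM : MRel L N M M') (hN : NonceLog N u) {D : Finset ℕ}
    (hD : ∀ n ∈ u', n ∉ u → n ∉ D) :
    ∃ w D' N', Eval M' D e w D' ∧ D' = D ∪ u' \ u ∧ N ⊆ N' ∧ NonceLog N' u' ∧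
      ∀ Lx, EvalRights M R Lx → ¬ Lx ≤ L → VRel L N' v w := by
  induction hE generalizing S R N D with
  | var hx =>
    cases he with
    | var hΓx =>
      obtain ⟨w, Ly, hw, -⟩ := hΓ'.var _ _ _ hΓx
      refine ⟨w, D, N, .var hw, by simp, subset_rfl, hN, fun Lx hLx hl => ?_⟩
      obtain ⟨v', Lx', hv', hLx'⟩ := hΓ.var _ _ _ hΓx
      cases hx.symm.trans hv'
      exact hM.get_var hx hw (hLx.unique hLx' ▸ hl)
  | pub hp =>
    exact ⟨_, D, N, .pub (hM.get_prin hL hp), by simp, subset_rfl, hN, fun _ _ _ => .pub _⟩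
  | @release u p P n hp hr hn =>
    refine ⟨_, insert n D, N, .release (hM.get_prin hL hp) hr (hD n (by simp) hn), ?_, subset_rfl,
      hN.mono (Finset.subset_insert ..), fun _ _ _ => .encPrin ..⟩
    ext k; simp only [Finset.mem_insert, Finset.mem_union, Finset.mem_sdiff]
    constructor
    · rintro (rfl | h) <;> tauto
    · tauto
  | releaseErr hp hr =>
    exact ⟨_, D, N, .releaseErr (hM.get_prin hL hp) hr, by simp, subset_rfl, hN,
      fun _ _ _ => .nav⟩
  | @enc u u₁ e RS v K n hE hK hn ih =>
    cases he with
    | enc hw he hle =>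
      have hu := hE.used_subset
      obtain ⟨w, D', N', hE', rfl, hs, hN', hv⟩ := ih he hM hN (D := D) fun k hk hku =>
        hD k (Finset.mem_insert_of_mem hk) hku
      have hnD : n ∉ D := hD n (by simp) fun h => hn (hu h)
      refine ⟨_, insert n (D ∪ u₁ \ u), insert (n, v, w) N',
        .enc hE' (hK.map (hM.evalKey hL)) (by simp [hnD, hn]), ?_,
        hs.trans (Set.subset_insert ..), hN'.insert hn _, fun _ _ _ => ?_⟩
      · ext k
        have := @hu k
        simp only [Finset.mem_insert, Finset.mem_union, Finset.mem_sdiff]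
        constructor
        · rintro (rfl | h) <;> tauto
        · tauto
      · by_cases hKL : (K : Label) ≤ L
        · exact .hidden hKL (Set.mem_insert ..)
        · obtain ⟨Lx, hLx⟩ := he.evalRights hΓ
          have hK' := (EvalRights.keys hK).le hle hLx
          exact .enc hKL ((hv Lx hLx fun h => hKL (hK'.trans h)).mono (Set.subset_insert ..))
  | @op u u₁ u₂ f e₁ e₂ v₁ v₂ hE₁ hE₂ ih₁ ih₂ =>
    cases he with
    | op h₁ h₂ =>
      have hu₁ := hE₁.used_subset
      have hu₂ := hE₂.used_subset
      obtain ⟨w₁, D₁, N₁, hE₁', rfl, hs₁, hN₁, hv₁⟩ := ih₁ h₁ hM hN (D := D) fun k hk hku =>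
        hD k (hu₂ hk) hku
      obtain ⟨w₂, D₂, N₂, hE₂', rfl, hs₂, hN₂, hv₂⟩ := ih₂ h₂ (hM.mono hs₁) hN₁
        (D := D ∪ u₁ \ u) fun k hk hku => by
          have := hD k hk fun h => hku (hu₁ h)
          simp [this, hku]
      refine ⟨_, _, N₂, .op hE₁' hE₂', union_sdiff_union_sdiff D hu₁ hu₂, hs₁.trans hs₂, hN₂,
        fun Lx hLx hl => ?_⟩
      obtain ⟨L₁, hL₁⟩ := h₁.evalRights hΓ
      obtain ⟨L₂, hL₂⟩ := h₂.evalRights hΓ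
      have hl := not_le_of_inf hLx hL₁ hL₂ hl
      exact ((hv₁ L₁ hL₁ hl.1).mono hs₂).applyOp f (hv₂ L₂ hL₂ hl.2)
  | @array u u' m es vs us h0 h1 hEs ih =>
    subst h0 h1
    cases he with
    | array hw he =>
      have hmono : Monotone us := Fin.monotone_iff_le_succ.2 fun i => (hEs i).used_subset
      obtain ⟨Ns, h0, hI, hr⟩ := exists_chain
        (I := fun k N' => N ⊆ N' ∧ NonceLog N' (us k))
        (r := fun i N₁ N₂ => N₁ ⊆ N₂ ∧ ∃ w,
          Eval M' (D ∪ us i.castSucc \ us 0) (es i) w (D ∪ us i.succ \ us 0) ∧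
          ∀ Lx, EvalRights M R Lx → ¬ Lx ≤ L → VRel L N₂ (vs i) w)
        N ⟨subset_rfl, hN⟩ fun i N₁ h => by
          obtain ⟨w, D', N₂, hE, rfl, hs, hN₂, hv⟩ := ih i (he i) (hM.mono h.1) h.2
            (D := D ∪ us i.castSucc \ us 0) fun k hk hku => by
              have := hD k (hmono (Fin.le_last _) hk) fun h => hku (hmono (Fin.zero_le _) h)
              simp [this, hku]
          refine ⟨N₂, ⟨h.1.trans hs, hN₂⟩, hs, w, ?_, hv⟩
          rwa [union_sdiff_union_sdiff D (hmono (Fin.zero_le _))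
            (hmono (Fin.castSucc_le_succ i))] at hE
      have hNmono : Monotone Ns := Fin.monotone_iff_le_succ.2 fun i => (hr i).1
      choose ws hws hv using fun i => (hr i).2
      refine ⟨.array m ws, _, Ns (Fin.last m), .array (fun k => D ∪ us k \ us 0) (by simp) rfl hws,
        rfl, (hI _).1, (hI _).2, fun Lx hLx hl => ?_⟩
      exact .array fun i => (hv i Lx hLx hl).mono (hNmono (Fin.le_last _))
  | index hx hE ih =>
    cases he with
    | index h₁ h₂ =>
      obtain ⟨w₂, D', N', hE', rfl, hs, hN', hv₂⟩ := ih h₂ hM hN hD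
      cases h₁ with
      | var hΓx =>
        obtain ⟨w₁, Ly, hw₁, -⟩ := hΓ'.var _ _ _ hΓx
        refine ⟨_, _, N', .index hw₁ hE', rfl, hs, hN', fun Lx hLx hl => ?_⟩
        obtain ⟨v', L₁, hv', hL₁⟩ := hΓ.var _ _ _ hΓx
        cases hx.symm.trans hv'
        obtain ⟨L₂, hL₂⟩ := h₂.evalRights hΓ
        have hl := not_le_of_inf hLx hL₁ hL₂ hl
        exact ((hM.get_var hx hw₁ hl.1).mono hs).getAt (hv₂ L₂ hL₂ hl.2)
  | lit =>
    cases he with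
    | int i => exact ⟨_, D, N, .lit, by simp, subset_rfl, hN, fun _ _ _ => .int i⟩

end

/-! ### Reductions of a single thread -/

/-- `C` is well-typed in a run-time context, with a program counter whose label is below `ℓ`. -/
def Safe (M : Mem) (χ : ChanLabels) (ℓ : Label) (C : Cmd) : Prop :=
  ∃ Γ pc ℓ', Ctx.Ok M χ Γ ∧ CmdTyped pc Γ C ∧ EvalRights M pc ℓ' ∧ ℓ' ≤ ℓ

/-- `C` is well-typed in a run-time context that fits both memories. -/
def SafeBoth (M M' : Mem) (χ : ChanLabels) (C : Cmd) : Prop :=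
  ∃ Γ pc ℓ, Ctx.Ok M χ Γ ∧ Ctx.Ok M' χ Γ ∧ CmdTyped pc Γ C ∧ EvalRights M pc ℓ

theorem Safe.mono {M M' : Mem} {χ χ' : ChanLabels} {ℓ : Label} {C : Cmd} (h : Safe M χ ℓ C)
    (hM : M.Ext M') (hχ : ∀ c p, χ c = some p → χ' c = some p) : Safe M' χ' ℓ C := by
  obtain ⟨Γ, pc, ℓ', hΓ, hC, hpc, hl⟩ := h
  exact ⟨Γ, pc, ℓ', hΓ.mono hM hχ, hC, hpc.mono hM, hl⟩

theorem Safe.ext {M M' : Mem} {χ : ChanLabels} {ℓ : Label} {C : Cmd} (h : Safe M χ ℓ C)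
    (hM : M.Ext M') : Safe M' χ ℓ C := h.mono hM fun _ _ => id

theorem Safe.le {M : Mem} {χ : ChanLabels} {ℓ ℓ' : Label} {C : Cmd} (h : Safe M χ ℓ C)
    (hl : ℓ ≤ ℓ') : Safe M χ ℓ' C := by
  obtain ⟨Γ, pc, ℓ₀, hΓ, hC, hpc, hl₀⟩ := h
  exact ⟨Γ, pc, ℓ₀, hΓ, hC, hpc, hl₀.trans hl⟩

theorem SafeBoth.mono {M M' M₁ M₁' : Mem} {χ χ' : ChanLabels} {C : Cmd} (h : SafeBoth M M' χ C)
    (hM : M.Ext M₁) (hM' : M'.Ext M₁') (hχ : ∀ c p, χ c = some p → χ' c = some p) :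
    SafeBoth M₁ M₁' χ' C := by
  obtain ⟨Γ, pc, ℓ', hΓ, hΓ', hC, hpc⟩ := h
  exact ⟨Γ, pc, ℓ', hΓ.mono hM hχ, hΓ'.mono hM' hχ, hC, hpc.mono hM⟩

theorem SafeBoth.ext {M M' M₁ M₁' : Mem} {χ : ChanLabels} {C : Cmd} (h : SafeBoth M M' χ C)
    (hM : M.Ext M₁) (hM' : M'.Ext M₁') : SafeBoth M₁ M₁' χ C := h.mono hM hM' fun _ _ => id

theorem SafeBoth.safe {M M' : Mem} {χ : ChanLabels} {C : Cmd} (h : SafeBoth M M' χ C) :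
    Safe M χ ⊤ C := by
  obtain ⟨Γ, pc, ℓ', hΓ, -, hC, hpc⟩ := h
  exact ⟨Γ, pc, ℓ', hΓ, hC, hpc, le_top⟩

/-- The name that the first action of the command declares is not declared again in its scope. -/
def Cmd.HeadFresh : Cmd → Prop
  | .new x _ _ _ C => x ∉ C.declared
  | .letKey x _ C => x ∉ C.declared
  | .connectPub x _ C => x ∉ C.declared
  | .acceptPub x _ C => x ∉ C.declared
  | .connect x _ _ _ _ _ C => x ∉ C.declared
  | .accept x _ _ _ _ _ C => x ∉ C.declared
  | .input _ x C => x ∉ C.declared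
  | .newPrin x _ C => x ∉ C.declared
  | .decrypt _ _ x _ _ C _ => x ∉ C.declared
  | .register _ _ x C _ => x ∉ C.declared
  | _ => True

theorem Cmd.headFresh_of_nodup {C : Cmd} (h : C.declared.Nodup) : C.HeadFresh := by
  cases C <;> simp_all [Cmd.HeadFresh, Cmd.declared]

theorem Cmd.headFresh_plug {G K : Cmd} (hG : G.IsBlock) (hs : G ≠ .skip)
    (h : (G.declared ++ K.declared).Nodup) : (G.plug K).HeadFresh := by
  have key : ∀ x (G : Cmd), x ∉ G.declared → x ∉ K.declared → x ∉ (G.plug K).declared :=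
    fun x G h₁ h₂ h₃ => (Cmd.mem_declared_plug h₃).elim h₁ h₂
  cases G <;> simp_all [Cmd.HeadFresh, Cmd.declared, Cmd.plug, Cmd.IsBlock]

/-- The commands whose first action a block can always execute. -/
def Cmd.IsAct : Cmd → Prop
  | .ite .. | .new .. | .assign .. | .assignAt .. | .decrypt .. | .register .. => True
  | _ => False

theorem Local.raw {σ σ' : Store} {C C' : Cmd} {ρ} (h : Local σ C ρ σ' C')
    (hd : σ.mem.Dom σ.used) :
    σ.mem.Ext σ'.mem ∧ σ'.mem.Dom σ'.used ∧ σ.used ⊆ σ'.used := by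
  have alloc : ∀ (M : Mem) (u u' : Finset ℕ) (a : ℕ) (c : Cell), M.Dom u → u ⊆ u' → a ∉ u' →
      M.Ext (M.set a c) ∧ (M.set a c).Dom (insert a u') ∧ u ⊆ insert a u' := by
    intro M u u' a c hd hu ha
    refine ⟨.set_fresh _ ((hd.mono hu).eq_none ha), ?_, hu.trans (Finset.subset_insert ..)⟩
    exact ((hd.mono hu).mono (Finset.subset_insert ..)).set _ (Finset.mem_insert_self ..)
  have keep : ∀ (M : Mem) (u u' : Finset ℕ), M.Dom u → u ⊆ u' →
      M.Ext M ∧ M.Dom u' ∧ u ⊆ u' := fun M u u' hd hu => ⟨.rfl, hd.mono hu, hu⟩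
  cases h with
  | iteTrue h₁ h₂ => exact keep _ _ _ hd (h₁.used_subset.trans h₂.used_subset)
  | iteFalse h₁ h₂ => exact keep _ _ _ hd (h₁.used_subset.trans h₂.used_subset)
  | new h _ ha => exact alloc _ _ _ _ _ hd h.used_subset ha
  | assign ha h =>
    exact ⟨(Mem.StepLe.set_var ha le_rfl).ext, (hd.mono h.used_subset).set _
      (h.used_subset (hd _ _ ha)), h.used_subset⟩
  | assignAt ha h₁ h₂ =>
    have hu := h₁.used_subset.trans h₂.used_subset
    exact ⟨(Mem.StepLe.set_var ha le_rfl).ext, (hd.mono hu).set _ (hu (hd _ _ ha)), hu⟩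
  | letKey h ha => exact alloc _ _ _ _ _ hd h.used_subset ha
  | bang => exact keep _ _ _ hd subset_rfl
  | newPrin _ _ ha => exact alloc _ _ _ _ _ hd (Finset.subset_insert ..) ha
  | decryptTrue _ h _ _ _ ha => exact alloc _ _ _ _ _ hd h.used_subset ha
  | decryptFalse _ h => exact keep _ _ _ hd h.used_subset
  | registerTrue _ h _ ha => exact alloc _ _ _ _ _ hd h.used_subset ha
  | registerFalse _ h => exact keep _ _ _ hd h.used_subset

/-- The name recorded by a reduction. -/
def declOf : Option (ℕ × ℕ) → Multiset ℕ
  | none => 0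
  | some (x, _) => {x}

theorem Local.declared_le {σ σ' : Store} {C C' : Cmd} {ρ} (h : Local σ C ρ σ' C') :
    (∃ B, C = .bang B) ∨ declOf ρ + (C'.declared : Multiset ℕ) ≤ (C.declared : Multiset ℕ) := by
  have aux : ∀ (x : ℕ) (l : List ℕ), ({x} : Multiset ℕ) + (l : Multiset ℕ) = ((x :: l : List ℕ)) :=
    fun _ _ => rfl
  cases h <;> first
    | exact Or.inl ⟨_, rfl⟩
    | (right
       simp only [declOf, Cmd.declared, Cmd.declared_subst, zero_add, aux, Multiset.coe_le,
         List.subperm_cons]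
       first
        | exact List.Subperm.refl _
        | exact (List.sublist_append_left _ _).subperm
        | exact (List.sublist_append_right _ _).subperm
        | exact ((List.sublist_append_right _ _).trans (List.sublist_cons_self _ _)).subperm)

section
variable {χ : ChanLabels} {Γ : Ctx} {pc : Rights} {ℓ : Label}

/-- Both branches of a conditional are typed below the label of the condition. -/
theorem Local.ite_safe {σ σ' : Store} {e₁ e₂ : Expr} {C₁ C₂ C' : Cmd} {ρ} {R₁ R₂ : Rights}
    (h : Local σ (.ite e₁ e₂ C₁ C₂) ρ σ' C') (hΓ : Γ.Ok σ.mem χ)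
    (h₁ : CmdTyped (pc ⊓ R₁ ⊓ R₂) Γ C₁) (h₂ : CmdTyped (pc ⊓ R₁ ⊓ R₂) Γ C₂)
    (hpc : EvalRights σ.mem (pc ⊓ R₁ ⊓ R₂) ℓ) :
    σ.mem.StepLe ℓ σ'.mem ∧ Safe σ'.mem χ ℓ C' := by
  cases h with
  | iteTrue => exact ⟨.rfl, Γ, _, ℓ, hΓ, h₁, hpc, le_rfl⟩
  | iteFalse => exact ⟨.rfl, Γ, _, ℓ, hΓ, h₂, hpc, le_rfl⟩

theorem Local.decrypt_safe {σ σ' : Store} {p : Name} {e : Expr} {x : ℕ} {S : Ty}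
    {RS : Finset KeyRef} {C₁ C₂ C' : Cmd} {ρ} {R₂ : Rights} {L' : Label}
    (h : Local σ (.decrypt p e x S RS C₁ C₂) ρ σ' C') (hd : σ.mem.Dom σ.used) (hΓ : Γ.Ok σ.mem χ)
    (hle : (RS : Rights) ≤ R₂) (hx : x ∉ C₁.declared)
    (h₁ : CmdTyped (pc ⊓ R₂) (Γ.addVar x S RS) C₁) (h₂ : CmdTyped (pc ⊓ R₂) Γ C₂)
    (hpc : EvalRights σ.mem (pc ⊓ R₂) ℓ) (hR₂ : EvalRights σ.mem R₂ L') :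
    σ.mem.StepLe L' σ'.mem ∧ Safe σ'.mem χ ℓ C' := by
  cases h with
  | decryptTrue _ hE hK _ _ ha =>
    have ha := (hd.mono hE.used_subset).eq_none ha
    have hR := EvalRights.keys hK
    exact ⟨.set_fresh (hR.le hle hR₂) ha, _, _, ℓ, hΓ.bindVar ha S hR _,
      h₁.bindVar hΓ ha hpc hR hx, hpc.mono (.set_fresh _ ha), le_rfl⟩
  | decryptFalse => exact ⟨.rfl, Γ, _, ℓ, hΓ, h₂, hpc, le_rfl⟩

/-- Subject reduction, and confinement: a thread changes only cells below its program counter. -/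
theorem Local.safe {σ σ' : Store} {C C' : Cmd} {ρ} (h : Local σ C ρ σ' C')
    (hd : σ.mem.Dom σ.used) (hΓ : Γ.Ok σ.mem χ) (hC : CmdTyped pc Γ C)
    (hpc : EvalRights σ.mem pc ℓ) (hx : C.HeadFresh) :
    σ.mem.StepLe ℓ σ'.mem ∧ Safe σ'.mem χ ℓ C' := by
  cases h with
  | iteTrue h₁ h₂ =>
    cases hC with
    | ite t₁ t₂ c₁ c₂ =>
      obtain ⟨L₁, hL₁⟩ := t₁.evalRights hΓ
      obtain ⟨L₂, hL₂⟩ := t₂.evalRights hΓ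
      obtain ⟨L₃, hL₃⟩ := hpc.inf_exists hL₁
      obtain ⟨L₄, hL₄⟩ := hL₃.inf_exists hL₂
      exact ⟨.rfl, Γ, _, L₄, hΓ, c₁, hL₄, hL₄.le (inf_le_left.trans inf_le_left) hpc⟩
  | iteFalse h₁ h₂ =>
    cases hC with
    | ite t₁ t₂ c₁ c₂ =>
      obtain ⟨L₁, hL₁⟩ := t₁.evalRights hΓ
      obtain ⟨L₂, hL₂⟩ := t₂.evalRights hΓ
      obtain ⟨L₃, hL₃⟩ := hpc.inf_exists hL₁
      obtain ⟨L₄, hL₄⟩ := hL₃.inf_exists hL₂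
      exact ⟨.rfl, Γ, _, L₄, hΓ, c₂, hL₄, hL₄.le (inf_le_left.trans inf_le_left) hpc⟩
  | new hE hR ha =>
    cases hC with
    | new hw he hle _ hC =>
      have ha := (hd.mono hE.used_subset).eq_none ha
      exact ⟨.set_fresh (hR.le (hle.trans inf_le_left) hpc) ha, _, _, ℓ, hΓ.bindVar ha _ hR _,
        hC.bindVar hΓ ha hpc hR hx, hpc.mono (.set_fresh _ ha), le_rfl⟩
  | assign ha hE =>
    cases hC with
    | assign hv he hle hC =>
      cases hv with
      | var hv =>
        obtain ⟨_, _, hv, hR⟩ := hΓ.var _ _ _ hv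
        cases ha.symm.trans hv
        have hs := fun v => Mem.StepLe.set_var (v := v) ha (hR.le (hle.trans inf_le_left) hpc)
        exact ⟨hs _, Γ, pc, ℓ, hΓ.ext (hs _).ext, hC, hpc.mono (hs _).ext, le_rfl⟩
  | assignAt ha h₁ h₂ =>
    cases hC with
    | assignAt t₁ t₂ hv hle hC =>
      cases hv with
      | var hv =>
        obtain ⟨_, _, hv, hR⟩ := hΓ.var _ _ _ hv
        cases ha.symm.trans hv
        have hs := fun v => Mem.StepLe.set_var (v := v) ha
          (hR.le (hle.trans (inf_le_left.trans inf_le_left)) hpc)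
        exact ⟨hs _, Γ, pc, ℓ, hΓ.ext (hs _).ext, hC, hpc.mono (hs _).ext, le_rfl⟩
  | letKey hE ha =>
    cases hC with
    | letKey htop he hC =>
      have ha := (hd.mono hE.used_subset).eq_none ha
      have hl : ℓ = ⊤ := by subst htop; cases hpc; rfl
      exact ⟨.set_fresh (hl ▸ le_top) ha, _, _, ℓ, hΓ.bindKey ha _, hC.bindKey hΓ ha hpc hx,
        hpc.mono (.set_fresh _ ha), le_rfl⟩
  | bang =>
    cases hC with
    | bang hC => exact ⟨.rfl, Γ, pc, ℓ, hΓ, .par hC (.bang hC), hpc, le_rfl⟩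
  | newPrin hK hκ ha =>
    cases hC with
    | newPrin hw htop hC =>
      have ha := (hd.mono (Finset.subset_insert ..)).eq_none ha
      have hl : ℓ = ⊤ := by subst htop; cases hpc; rfl
      exact ⟨.set_fresh (hl ▸ le_top) ha, _, _, ℓ, hΓ.bindPrin ha _, hC.bindPrin hΓ ha hpc hx,
        hpc.mono (.set_fresh _ ha), le_rfl⟩
  | registerTrue hp hE _ ha =>
    cases hC with
    | register hp he htop h₁ h₂ =>
      have ha := (hd.mono hE.used_subset).eq_none ha
      have hl : ℓ = ⊤ := by subst htop; cases hpc; rfl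
      exact ⟨.set_fresh (hl ▸ le_top) ha, _, _, ℓ, hΓ.bindPrin ha _, h₁.bindPrin hΓ ha hpc hx,
        hpc.mono (.set_fresh _ ha), le_rfl⟩
  | registerFalse hp hE _ =>
    cases hC with
    | register hp he htop h₁ h₂ => exact ⟨.rfl, Γ, pc, ℓ, hΓ, h₂, hpc, le_rfl⟩
  | decryptTrue hp hE hK hm hs ha =>
    cases hC with
    | decrypt hw hm' hp' he hle h₁ h₂ =>
      obtain ⟨L₂, hL₂⟩ := he.evalRights hΓ
      obtain ⟨L₃, hL₃⟩ := hpc.inf_exists hL₂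
      have ha := (hd.mono hE.used_subset).eq_none ha
      have hR := EvalRights.keys hK
      exact ⟨.set_fresh (hR.le (hle.trans inf_le_right) hpc) ha, _, _, L₃, hΓ.bindVar ha _ hR _,
        h₁.bindVar hΓ ha hL₃ hR hx, hL₃.mono (.set_fresh _ ha), hL₃.le inf_le_left hpc⟩
  | decryptFalse =>
    cases hC with
    | decrypt hw hm' hp' he hle h₁ h₂ =>
      obtain ⟨L₂, hL₂⟩ := he.evalRights hΓ
      obtain ⟨L₃, hL₃⟩ := hpc.inf_exists hL₂
      exact ⟨.rfl, Γ, _, L₃, hΓ, h₂, hL₃, hL₃.le inf_le_left hpc⟩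

/-- A typed thread preserves the uniqueness of nonces. -/
theorem Local.conf {σ σ' : Store} {C C' : Cmd} {ρ} (h : Local σ C ρ σ' C')
    (hC : CmdTyped pc Γ C) {N : Set (ℕ × Value)} (hM : MemConf N σ.mem) (hN : NonceLog N σ.used) :
    ∃ N', N ⊆ N' ∧ NonceLog N' σ'.used ∧ MemConf N' σ'.mem := by
  cases h with
  | iteTrue h₁ h₂ | iteFalse h₁ h₂ =>
    cases hC with
    | ite t₁ t₂ c₁ c₂ =>
      obtain ⟨N₁, hs₁, hN₁, -⟩ := h₁.conf t₁ hM hN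
      obtain ⟨N₂, hs₂, hN₂, -⟩ := h₂.conf t₂ (hM.mono hs₁) hN₁
      exact ⟨N₂, hs₁.trans hs₂, hN₂, hM.mono (hs₁.trans hs₂)⟩
  | new hE hR ha =>
    cases hC with
    | new hw he hle _ hC =>
      obtain ⟨N', hs, hN', hv⟩ := hE.conf he hM hN
      exact ⟨N', hs, hN'.mono (Finset.subset_insert ..), (hM.mono hs).set _ (by
        rintro _ _ ⟨⟩; exact hv)⟩
  | assign ha hE =>
    cases hC with
    | assign _ he hle hC =>
      obtain ⟨N', hs, hN', hv⟩ := hE.conf he hM hN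
      exact ⟨N', hs, hN', (hM.mono hs).set _ (by rintro _ _ ⟨⟩; exact hv)⟩
  | assignAt ha h₁ h₂ =>
    cases hC with
    | assignAt t₁ t₂ hv hle hC =>
      obtain ⟨N₁, hs₁, hN₁, -⟩ := h₁.conf t₁ hM hN
      obtain ⟨N₂, hs₂, hN₂, hv⟩ := h₂.conf t₂ (hM.mono hs₁) hN₁
      have hM' := hM.mono (hs₁.trans hs₂)
      exact ⟨N₂, hs₁.trans hs₂, hN₂, hM'.set _ (by
        rintro _ _ ⟨⟩; exact (hM' _ _ _ ha).setAt _ hv)⟩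
  | letKey hE ha =>
    cases hC with
    | letKey _ he _ =>
      obtain ⟨N', hs, hN', hv⟩ := hE.conf he hM hN
      exact ⟨N', hs, hN'.mono (Finset.subset_insert ..), (hM.mono hs).set _ (by rintro _ _ ⟨⟩)⟩
  | bang => exact ⟨N, subset_rfl, hN, hM⟩
  | newPrin =>
    exact ⟨N, subset_rfl, hN.mono ((Finset.subset_insert ..).trans (Finset.subset_insert ..)),
      hM.set _ (by rintro _ _ ⟨⟩)⟩
  | decryptTrue _ hE =>
    cases hC with
    | decrypt _ _ _ he =>
      obtain ⟨N', hs, hN', hv⟩ := hE.conf he hM hN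
      refine ⟨N', hs, hN'.mono (Finset.subset_insert ..), (hM.mono hs).set _ ?_⟩
      rintro _ _ ⟨⟩
      cases hv with
      | enc _ hv => exact hv
  | decryptFalse _ hE =>
    cases hC with
    | decrypt _ _ _ he =>
      obtain ⟨N', hs, hN', -⟩ := hE.conf he hM hN
      exact ⟨N', hs, hN', hM.mono hs⟩
  | registerTrue _ hE =>
    cases hC with
    | register _ he =>
      obtain ⟨N', hs, hN', hv⟩ := hE.conf he hM hN
      exact ⟨N', hs, hN'.mono (Finset.subset_insert ..), (hM.mono hs).set _ (by rintro _ _ ⟨⟩)⟩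
  | registerFalse _ hE =>
    cases hC with
    | register _ he =>
      obtain ⟨N', hs, hN', -⟩ := hE.conf he hM hN
      exact ⟨N', hs, hN', hM.mono hs⟩

/-- Progress, with fresh names outside of `U`. -/
theorem CmdTyped.progress {M : Mem} {C : Cmd} (hC : CmdTyped pc Γ C) (hΓ : Γ.Ok M χ)
    (hA : C.IsAct) (u U : Finset ℕ) :
    ∃ ρ σ' C', Local ⟨M, u⟩ C ρ σ' C' ∧ ∀ n ∈ σ'.used, n ∈ U → n ∈ u := by
  have alloc : ∀ {u u' : Finset ℕ}, (∀ n ∈ u', n ∈ U → n ∈ u) →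
      ∃ a, a ∉ u' ∧ ∀ n ∈ insert a u', n ∈ U → n ∈ u := by
    intro u u' h
    obtain ⟨a, ha⟩ := Infinite.exists_notMem_finset (u' ∪ U)
    refine ⟨a, fun h => ha (by simp [h]), fun n hn hU => ?_⟩
    rcases Finset.mem_insert.1 hn with rfl | hn
    · exact absurd (by simp [hU]) ha
    · exact h n hn hU
  cases hC with
  | ite t₁ t₂ =>
    obtain ⟨v₁, u₁, h₁, hu₁⟩ := t₁.exists_eval hΓ U u
    obtain ⟨v₂, u₂, h₂, hu₂⟩ := t₂.exists_eval hΓ U u₁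
    have hu : ∀ n ∈ u₂, n ∈ U → n ∈ u := fun n hn hU => hu₁ n (hu₂ n hn hU) hU
    by_cases hv : v₁ = v₂
    · subst hv; exact ⟨_, _, _, .iteTrue h₁ h₂, hu⟩
    · exact ⟨_, _, _, .iteFalse h₁ h₂ hv, hu⟩
  | new hw he =>
    obtain ⟨v, u₁, hE, hu⟩ := he.exists_eval hΓ U u
    obtain ⟨L, hL⟩ := hΓ.evalRights hw
    obtain ⟨a, ha, hu⟩ := alloc hu
    exact ⟨_, _, _, .new hE hL ha, hu⟩
  | assign hv he =>
    obtain ⟨v, u₁, hE, hu⟩ := he.exists_eval hΓ U u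
    cases hv with
    | var hv =>
      obtain ⟨_, _, hv, hR⟩ := hΓ.var _ _ _ hv
      obtain ⟨a, rfl, ha⟩ := Mem.get_eq_some hv
      exact ⟨_, _, _, .assign ha hE, hu⟩
  | assignAt t₁ t₂ hv =>
    obtain ⟨v₁, u₁, h₁, hu₁⟩ := t₁.exists_eval hΓ U u
    obtain ⟨v₂, u₂, h₂, hu₂⟩ := t₂.exists_eval hΓ U u₁
    cases hv with
    | var hv =>
      obtain ⟨_, _, hv, hR⟩ := hΓ.var _ _ _ hv
      obtain ⟨a, rfl, ha⟩ := Mem.get_eq_some hv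
      exact ⟨_, _, _, .assignAt ha h₁ h₂, fun n hn hU => hu₁ n (hu₂ n hn hU) hU⟩
  | decrypt hw _ hp he =>
    obtain ⟨v, u₁, hE, hu⟩ := he.exists_eval hΓ U u
    obtain ⟨P, hP⟩ := hΓ.prin _ hp
    obtain ⟨K', hK'⟩ := hΓ.evalKeys hw
    by_cases h : ∃ w n K, v = .enc w n K ∧ P.key ∈ K ∧ K' ⊆ K
    · obtain ⟨w, n, K, rfl, h₁, h₂⟩ := h
      obtain ⟨a, ha, hu⟩ := alloc hu
      exact ⟨_, _, _, .decryptTrue hP hE hK' h₁ h₂ ha, hu⟩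
    · exact ⟨_, _, _, .decryptFalse hP hE hK' h, hu⟩
  | register hp he =>
    obtain ⟨v, u₁, hE, hu⟩ := he.exists_eval hΓ U u
    obtain ⟨P, hP⟩ := hΓ.prin _ hp
    by_cases h : ∃ P₁ n, v = .encPrin P₁ n P₁.rights ∧ P.key ∈ P₁.rights
    · obtain ⟨P₁, n, rfl, h₁⟩ := h
      obtain ⟨a, ha, hu⟩ := alloc hu
      exact ⟨_, _, _, .registerTrue hP hE h₁ ha, hu⟩
    · exact ⟨_, _, _, .registerFalse hP hE h, hu⟩
  | _ => exact hA.elim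

end

/-! ### Blocks and their continuation -/

theorem Cmd.plug_skip (G : Cmd) : G.plug .skip = G := by
  induction G <;> simp_all [Cmd.plug]

theorem Cmd.subst_plug' {x a : ℕ} {G K : Cmd} (hG : G.IsBlock ∨ K = .skip) (hx : x ∉ G.declared) :
    (G.plug K).subst x a = (G.subst x a).plug (K.subst x a) := by
  rcases hG with hG | rfl
  · exact Cmd.subst_plug hG hx
  · rw [Cmd.plug_skip, show Cmd.subst x a .skip = .skip from rfl, Cmd.plug_skip]

/-- The continuation of a block takes part in the reductions of the block. -/
theorem Local.plug {σ σ' : Store} {G G' K : Cmd} {ρ} (h : Local σ G ρ σ' G')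
    (hG : G.IsBlock ∨ K = .skip) (hx : G.HeadFresh) :
    Local σ (G.plug K) ρ σ' (G'.plug (K.substOpt ρ)) := by
  rcases hG with hG | rfl
  · cases h with
    | iteTrue h₁ h₂ => exact .iteTrue h₁ h₂
    | iteFalse h₁ h₂ hn => exact .iteFalse h₁ h₂ hn
    | @new _ _ _ _ _ _ _ G _ _ _ hE hR ha =>
      simp only [Cmd.substOpt]
      rw [← Cmd.subst_plug (G := G) hG hx]
      exact .new hE hR ha
    | assign ha hE => exact .assign ha hE
    | assignAt ha h₁ h₂ => exact .assignAt ha h₁ h₂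
    | decryptTrue hp hE hK hm hs ha =>
      simp only [Cmd.substOpt]
      rw [← Cmd.subst_plug hG.1 hx]
      exact .decryptTrue hp hE hK hm hs ha
    | decryptFalse hp hE hK hn => exact .decryptFalse hp hE hK hn
    | registerTrue hp hE hm ha =>
      simp only [Cmd.substOpt]
      rw [← Cmd.subst_plug hG.1 hx]
      exact .registerTrue hp hE hm ha
    | registerFalse hp hE hn => exact .registerFalse hp hE hn
    | letKey | bang | newPrin => exact hG.elim
  · have : Cmd.substOpt ρ .skip = .skip := by rcases ρ with _ | ⟨x, a⟩ <;> rfl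
    rwa [this, Cmd.plug_skip, Cmd.plug_skip]

/-- Conversely, a reduction of a block with its continuation is one of the block. -/
theorem Local.plug_inv {σ σ' : Store} {G C' K : Cmd} {ρ} (h : Local σ (G.plug K) ρ σ' C')
    (hG : G.IsBlock ∨ K = .skip) (hA : G.IsAct) (hx : G.HeadFresh) :
    ∃ G', Local σ G ρ σ' G' ∧ C' = G'.plug (K.substOpt ρ) := by
  rcases hG with hG | rfl
  · cases G with
    | ite =>
      simp only [Cmd.plug] at h
      cases h with
      | iteTrue h₁ h₂ => exact ⟨_, .iteTrue h₁ h₂, rfl⟩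
      | iteFalse h₁ h₂ hn => exact ⟨_, .iteFalse h₁ h₂ hn, rfl⟩
    | new =>
      simp only [Cmd.plug] at h
      cases h with
      | new hE hR ha => exact ⟨_, .new hE hR ha, Cmd.subst_plug hG hx⟩
    | assign =>
      simp only [Cmd.plug] at h
      cases h with
      | assign ha hE => exact ⟨_, .assign ha hE, rfl⟩
    | assignAt =>
      simp only [Cmd.plug] at h
      cases h with
      | assignAt ha h₁ h₂ => exact ⟨_, .assignAt ha h₁ h₂, rfl⟩
    | decrypt =>
      simp only [Cmd.plug] at h
      cases h with
      | decryptTrue hp hE hK hm hs ha =>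
        exact ⟨_, .decryptTrue hp hE hK hm hs ha, Cmd.subst_plug hG.1 hx⟩
      | decryptFalse hp hE hK hn => exact ⟨_, .decryptFalse hp hE hK hn, rfl⟩
    | register =>
      simp only [Cmd.plug] at h
      cases h with
      | registerTrue hp hE hm ha => exact ⟨_, .registerTrue hp hE hm ha, Cmd.subst_plug hG.1 hx⟩
      | registerFalse hp hE hn => exact ⟨_, .registerFalse hp hE hn, rfl⟩
    | _ => exact hA.elim
  · have : Cmd.substOpt ρ .skip = .skip := by rcases ρ with _ | ⟨x, a⟩ <;> rfl
    rw [Cmd.plug_skip] at h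
    exact ⟨C', h, by rw [this, Cmd.plug_skip]⟩

theorem Cmd.IsAct.plug {G : Cmd} (h : G.IsAct) (K : Cmd) : (G.plug K).IsAct := by
  cases G <;> first | exact h.elim | trivial

/-! ### Simulation of a reduction of a single thread -/

/-- The relation between the stores of two runs. `U` is the finite set of all names that the first
run ever generates; the names that only the second run has generated lie outside of `U`, so that the
second run can always generate the same names as the first. -/
structure StoreSim (L : Label) (U : Finset ℕ) (N : Set (ℕ × Value × Value)) (σ τ : Store) :
    Prop where
  dom_left : σ.mem.Dom σ.used
  dom_right : τ.mem.Dom τ.used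
  rel : MRel L N σ.mem τ.mem
  log : NonceLog N σ.used
  fresh : ∀ n ∈ τ.used, n ∈ U → n ∈ σ.used

section
variable {L : Label} {U : Finset ℕ} {N : Set (ℕ × Value × Value)}

theorem StoreSim.left {σ σ' τ : Store} (h : StoreSim L U N σ τ) (hs : σ.mem.StepLe L σ'.mem)
    (hd : σ'.mem.Dom σ'.used) (hu : σ.used ⊆ σ'.used) : StoreSim L U N σ' τ :=
  ⟨hd, h.dom_right, h.rel.stepLe_left hs, h.log.mono hu, fun n hn hU => hu (h.fresh n hn hU)⟩

theorem StoreSim.right {σ τ τ' : Store} (h : StoreSim L U N σ τ) (hs : τ.mem.StepLe L τ'.mem)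
    (hd : τ'.mem.Dom τ'.used) (hu : ∀ n ∈ τ'.used, n ∈ U → n ∈ τ.used) : StoreSim L U N σ τ' :=
  ⟨h.dom_left, hd, h.rel.stepLe_right hs, h.log, fun n hn hU => h.fresh n (hu n hn hU) hU⟩

theorem StoreSim.eval (hL : L ≠ ⊤) {χ : ChanLabels} {Γ : Ctx} {M M' : Mem} {u u' D : Finset ℕ}
    {e : Expr} {v : Value} {S : Ty} {R : Rights} (h : StoreSim L U N ⟨M, u⟩ ⟨M', D⟩)
    (hE : Eval M u e v u') (hU : u' ⊆ U) (he : ExprTyped Γ e S R) (hΓ : Γ.Ok M χ)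
    (hΓ' : Γ.Ok M' χ) :
    ∃ w D' N', Eval M' D e w D' ∧ N ⊆ N' ∧ StoreSim L U N' ⟨M, u'⟩ ⟨M', D'⟩ ∧
      ∀ Lx, EvalRights M R Lx → ¬ Lx ≤ L → VRel L N' v w := by
  obtain ⟨w, D', N', hE', rfl, hs, hN', hv⟩ := hE.sim hL he hΓ hΓ' h.rel h.log (D := D)
    fun n hn hnu hnD => hnu (h.fresh n hnD (hU hn))
  refine ⟨w, _, N', hE', hs, ⟨h.dom_left.mono hE.used_subset, h.dom_right.mono hE'.used_subset,
    h.rel.mono hs, hN', fun n hn hnU => ?_⟩, hv⟩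
  rcases Finset.mem_union.1 hn with hn | hn
  · exact hE.used_subset (h.fresh n hn hnU)
  · exact (Finset.mem_sdiff.1 hn).1

theorem StoreSim.notMem {M M' : Mem} {u D : Finset ℕ} (h : StoreSim L U N ⟨M, u⟩ ⟨M', D⟩) {a : ℕ}
    (ha : a ∉ u) (haU : a ∈ U) : a ∉ D := fun hD => ha (h.fresh a hD haU)

theorem StoreSim.use {M M' : Mem} {u D : Finset ℕ} (h : StoreSim L U N ⟨M, u⟩ ⟨M', D⟩) (a : ℕ) :
    StoreSim L U N ⟨M, insert a u⟩ ⟨M', insert a D⟩ :=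
  ⟨h.dom_left.mono (Finset.subset_insert ..), h.dom_right.mono (Finset.subset_insert ..), h.rel,
    h.log.mono (Finset.subset_insert ..), fun n hn hU => by
      rcases Finset.mem_insert.1 hn with rfl | hn
      · exact Finset.mem_insert_self ..
      · exact Finset.mem_insert_of_mem (h.fresh n hn hU)⟩

theorem StoreSim.set {M M' : Mem} {u D : Finset ℕ} (h : StoreSim L U N ⟨M, u⟩ ⟨M', D⟩) {a : ℕ}
    {c c' : Cell} (ha : a ∈ u) (ha' : a ∈ D) (hl : c.label = c'.label)
    (hc : ¬ c.label ≤ L → c.Rel L N c') :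
    StoreSim L U N ⟨M.set a c, u⟩ ⟨M'.set a c', D⟩ :=
  ⟨h.dom_left.set _ ha, h.dom_right.set _ ha', h.rel.set a hl hc, h.log, h.fresh⟩

theorem StoreSim.alloc {M M' : Mem} {u D : Finset ℕ} (h : StoreSim L U N ⟨M, u⟩ ⟨M', D⟩) {a : ℕ}
    {c c' : Cell} (hl : c.label = c'.label) (hc : ¬ c.label ≤ L → c.Rel L N c') :
    StoreSim L U N ⟨M.set a c, insert a u⟩ ⟨M'.set a c', insert a D⟩ :=
  (h.use a).set (Finset.mem_insert_self ..) (Finset.mem_insert_self ..) hl hc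

variable {χ : ChanLabels} {Γ : Ctx} {pc : Rights} {ℓ : Label}

/-- The second run executes the same action as the first.  Either the same happens, or the action
depends on data below `L`, and then both threads continue below `L`. -/
theorem Local.sim (hL : L ≠ ⊤) {σ σ' τ : Store} {C C' K : Cmd} {ρ} (h : Local σ C ρ σ' C')
    (hs : StoreSim L U N σ τ) (hU : σ'.used ⊆ U) (hΓ : Γ.Ok σ.mem χ) (hΓ' : Γ.Ok τ.mem χ)
    (hG : C.IsBlock ∨ K = .skip) (hC : CmdTyped pc Γ (C.plug K)) (hpc : EvalRights σ.mem pc ℓ)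
    (hx : (C.plug K).HeadFresh) (hx' : C.HeadFresh) :
    ∃ N' τ' ρ' C'', Local τ C ρ' τ' C'' ∧ N ⊆ N' ∧ StoreSim L U N' σ' τ' ∧
      ((ρ' = ρ ∧ C'' = C' ∧ SafeBoth σ'.mem τ'.mem χ (C'.plug (K.substOpt ρ))) ∨
        (Safe σ'.mem χ L (C'.plug (K.substOpt ρ)) ∧
          Safe τ'.mem χ L (C''.plug (K.substOpt ρ')))) := by
  obtain ⟨MQ, D⟩ := τ
  -- The two runs may take different branches if both confine their effects below `L`.
  have diverge (hA : C.IsAct)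
      (hP : σ.mem.StepLe L σ'.mem ∧ Safe σ'.mem χ L (C'.plug (K.substOpt ρ)))
      (hQ : ∀ ρ' τ' C'', Local ⟨MQ, D⟩ (C.plug K) ρ' τ' C'' →
        Mem.StepLe L MQ τ'.mem ∧ Safe τ'.mem χ L C'') :
      ∃ N' τ' ρ' C'', Local ⟨MQ, D⟩ C ρ' τ' C'' ∧ N ⊆ N' ∧ StoreSim L U N' σ' τ' ∧
      ((ρ' = ρ ∧ C'' = C' ∧ SafeBoth σ'.mem τ'.mem χ (C'.plug (K.substOpt ρ))) ∨
        (Safe σ'.mem χ L (C'.plug (K.substOpt ρ)) ∧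
          Safe τ'.mem χ L (C''.plug (K.substOpt ρ')))) := by
    obtain ⟨ρ', τ', C'', h', hf⟩ := hC.progress hΓ' (hA.plug K) D U
    obtain ⟨hs', hsafe⟩ := hQ _ _ _ h'
    obtain ⟨-, hd, hu⟩ := h.raw hs.dom_left
    obtain ⟨-, hd', -⟩ := h'.raw hs.dom_right
    obtain ⟨G'', h₂, rfl⟩ := h'.plug_inv hG hA hx'
    exact ⟨N, τ', ρ', G'', h₂, subset_rfl, (hs.left hP.1 hd hu).right hs' hd' hf,
      Or.inr ⟨hP.2, hsafe⟩⟩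
  have hplug := h.plug hG hx'
  have toQ : ∀ {R L'}, EvalRights σ.mem R L' → EvalRights MQ R L' :=
    fun h => h.map (hs.rel.evalKey hL)
  have htop : ¬ (⊤ : Label) ≤ L := by simpa using hL
  cases C with
  | ite e₁ e₂ C₁ C₂ =>
    simp only [Cmd.plug] at hC hx hplug diverge
    cases hC with
    | @ite _ _ _ _ S R₁ R₂ _ _ t₁ t₂ c₁ c₂ =>
      obtain ⟨L₁, hL₁⟩ := t₁.evalRights hΓ
      obtain ⟨L₂, hL₂⟩ := t₂.evalRights hΓ
      obtain ⟨L₃, hL₃⟩ := hpc.inf_exists hL₁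
      obtain ⟨L₄, hL₄⟩ := hL₃.inf_exists hL₂
      by_cases hl : L₄ ≤ L ∧ (L₁ ≤ L ∨ L₂ ≤ L)
      · refine diverge trivial ?_ ?_
        · obtain ⟨h₁, Γ₁, pc₁, ℓ₁, h₂, h₃, h₄, h₅⟩ := hplug.ite_safe hΓ c₁ c₂ hL₄
          exact ⟨h₁.mono hl.1, Γ₁, pc₁, ℓ₁, h₂, h₃, h₄, h₅.trans hl.1⟩
        · intro ρ' τ' C'' h'
          obtain ⟨h₁, Γ₁, pc₁, ℓ₁, h₂, h₃, h₄, h₅⟩ := h'.ite_safe hΓ' c₁ c₂ (toQ hL₄)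
          exact ⟨h₁.mono hl.1, Γ₁, pc₁, ℓ₁, h₂, h₃, h₄, h₅.trans hl.1⟩
      · have hl₁ : ¬ L₁ ≤ L := fun h' => hl
          ⟨(hL₄.le (inf_le_left.trans inf_le_right) hL₁).trans h', Or.inl h'⟩
        have hl₂ : ¬ L₂ ≤ L := fun h' => hl ⟨(hL₄.le inf_le_right hL₂).trans h', Or.inr h'⟩
        cases h with
        | iteTrue h₁ h₂ =>
          obtain ⟨w₁, D₁, N₁, E₁, hs₁, hS₁, hv₁⟩ :=
            hs.eval hL h₁ (h₂.used_subset.trans hU) t₁ hΓ hΓ'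
          obtain ⟨w₂, D₂, N₂, E₂, hs₂, hS₂, hv₂⟩ := hS₁.eval hL h₂ hU t₂ hΓ hΓ'
          obtain rfl := ((hv₁ _ hL₁ hl₁).mono hs₂).right_unique hS₂.log (hv₂ _ hL₂ hl₂)
          exact ⟨N₂, _, _, _, .iteTrue E₁ E₂, hs₁.trans hs₂, hS₂,
            Or.inl ⟨rfl, rfl, Γ, _, L₄, hΓ, hΓ', c₁, hL₄⟩⟩
        | iteFalse h₁ h₂ hne =>
          obtain ⟨w₁, D₁, N₁, E₁, hs₁, hS₁, hv₁⟩ :=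
            hs.eval hL h₁ (h₂.used_subset.trans hU) t₁ hΓ hΓ'
          obtain ⟨w₂, D₂, N₂, E₂, hs₂, hS₂, hv₂⟩ := hS₁.eval hL h₂ hU t₂ hΓ hΓ'
          refine ⟨N₂, _, _, _, .iteFalse E₁ E₂ ?_, hs₁.trans hs₂, hS₂,
            Or.inl ⟨rfl, rfl, Γ, _, L₄, hΓ, hΓ', c₂, hL₄⟩⟩
          rintro rfl
          exact hne (((hv₁ _ hL₁ hl₁).mono hs₂).left_unique hS₂.log (hv₂ _ hL₂ hl₂))
  | decrypt p e x S RS C₁ C₂ =>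
    simp only [Cmd.plug] at hC hx hplug diverge
    cases hC with
    | @decrypt _ _ _ _ _ _ R₂ _ _ _ hw hm hp he hle h₁ h₂ =>
      obtain ⟨L₂, hL₂⟩ := he.evalRights hΓ
      obtain ⟨L₃, hL₃⟩ := hpc.inf_exists hL₂
      by_cases hl : L₂ ≤ L
      · have hl₃ := (hL₃.le inf_le_right hL₂).trans hl
        refine diverge trivial ?_ ?_
        · obtain ⟨g₁, Γ₁, pc₁, ℓ₁, g₂, g₃, g₄, g₅⟩ :=
            hplug.decrypt_safe hs.dom_left hΓ (hle.trans inf_le_left) hx h₁ h₂ hL₃ hL₂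
          exact ⟨g₁.mono hl, Γ₁, pc₁, ℓ₁, g₂, g₃, g₄, g₅.trans hl₃⟩
        · intro ρ' τ' C'' h'
          obtain ⟨g₁, Γ₁, pc₁, ℓ₁, g₂, g₃, g₄, g₅⟩ :=
            h'.decrypt_safe hs.dom_right hΓ' (hle.trans inf_le_left) hx h₁ h₂ (toQ hL₃) (toQ hL₂)
          exact ⟨g₁.mono hl, Γ₁, pc₁, ℓ₁, g₂, g₃, g₄, g₅.trans hl₃⟩
      · cases h with
        | decryptTrue hP hE hK hk hsub ha =>
          obtain ⟨w, D₁, N₁, E₁, hs₁, hS₁, hv⟩ :=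
            hs.eval hL hE ((Finset.subset_insert ..).trans hU) he hΓ hΓ'
          have haP := hS₁.dom_left.eq_none ha
          have haQ' := hS₁.notMem ha (hU (Finset.mem_insert_self ..))
          have haQ := hS₁.dom_right.eq_none haQ'
          have hR := EvalRights.keys hK
          have hplg := fun a => Cmd.subst_plug' (a := a) (G := C₁) (hG.imp_left And.left) hx'
          cases hv _ hL₂ hl with
          | enc hKL hvw =>
            exact ⟨N₁, _, _, _, .decryptTrue (hs.rel.get_prin hL hP) E₁ (hK.map (hs.rel.evalKey hL))
              hk hsub haQ', hs₁, hS₁.alloc rfl fun _ => .var _ hvw, Or.inl ⟨rfl, rfl, _, _, L₃,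
              hΓ.bindVar haP S hR _, hΓ'.bindVar haQ S (toQ hR) _,
              hplg _ ▸ h₁.bindVar hΓ haP hL₃ hR hx,
              hL₃.mono (.set_fresh _ haP)⟩⟩
          | hidden hKL hn =>
            -- the new variable has the rights `K' ⊆ K`, hence it lies below `L`
            exact ⟨N₁, _, _, _, .decryptTrue (hs.rel.get_prin hL hP) E₁ (hK.map (hs.rel.evalKey hL))
              hk hsub haQ', hs₁, hS₁.alloc rfl fun hnl =>
                absurd ((WithTop.coe_le_coe.2 hsub).trans hKL) hnl, Or.inl ⟨rfl, rfl, _, _, L₃,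
              hΓ.bindVar haP S hR _, hΓ'.bindVar haQ S (toQ hR) _,
              hplg _ ▸ h₁.bindVar hΓ haP hL₃ hR hx,
              hL₃.mono (.set_fresh _ haP)⟩⟩
        | decryptFalse hP hE hK hne =>
          obtain ⟨w, D₁, N₁, E₁, hs₁, hS₁, hv⟩ := hs.eval hL hE hU he hΓ hΓ'
          refine ⟨N₁, _, _, _, .decryptFalse (hs.rel.get_prin hL hP) E₁
            (hK.map (hs.rel.evalKey hL)) ?_, hs₁, hS₁,
            Or.inl ⟨rfl, rfl, Γ, _, L₃, hΓ, hΓ', h₂, hL₃⟩⟩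
          rintro ⟨w', n, K, rfl, hk⟩
          cases hv _ hL₂ hl <;> exact hne ⟨_, _, _, rfl, hk⟩
  | new x S R₁ e C =>
    simp only [Cmd.plug] at hC hx
    cases hC with
    | @new _ _ _ _ _ R₂ _ _ hw he hle _ hC =>
      cases h with
      | new hE hR ha =>
        obtain ⟨w, D₁, N₁, E₁, hs₁, hS₁, hv⟩ :=
          hs.eval hL hE ((Finset.subset_insert ..).trans hU) he hΓ hΓ'
        have haP := hS₁.dom_left.eq_none ha
        have haQ' := hS₁.notMem ha (hU (Finset.mem_insert_self ..))
        have haQ := hS₁.dom_right.eq_none haQ'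
        obtain ⟨L₂, hL₂⟩ := he.evalRights hΓ
        exact ⟨N₁, _, _, _, .new E₁ (toQ hR) haQ', hs₁,
          hS₁.alloc rfl fun hnl => .var _ (hv _ hL₂ fun h =>
            hnl ((hR.le (hle.trans inf_le_right) hL₂).trans h)), Or.inl ⟨rfl, rfl, _, _, ℓ,
          hΓ.bindVar haP S hR _, hΓ'.bindVar haQ S (toQ hR) _,
          Cmd.subst_plug' (G := C) hG hx' ▸ hC.bindVar hΓ haP hpc hR hx,
          hpc.mono (.set_fresh _ haP)⟩⟩
  | assign x e C =>
    simp only [Cmd.plug] at hC hx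
    cases hC with
    | @assign _ _ _ S R₁ R₂ _ _ hvx he hle hC =>
      cases h with
      | assign ha hE =>
        obtain ⟨w, D₁, N₁, E₁, hs₁, hS₁, hv⟩ := hs.eval hL hE hU he hΓ hΓ'
        cases hvx with
        | var hvx =>
          obtain ⟨_, _, ha', hR⟩ := hΓ.var _ _ _ hvx
          cases ha.symm.trans ha'
          obtain ⟨w', _, hb, hR'⟩ := hΓ'.var _ _ _ hvx
          cases (toQ hR).unique hR'
          obtain ⟨L₂, hL₂⟩ := he.evalRights hΓ
          have hlP := fun v => (Mem.StepLe.set_var (v := v) ha le_rfl).ext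
          have hlQ := fun v => (Mem.StepLe.set_var (v := v) hb le_rfl).ext
          exact ⟨N₁, _, _, _, .assign hb E₁, hs₁,
            hS₁.set (hS₁.dom_left _ _ ha) (hS₁.dom_right _ _ hb) rfl fun hnl => .var _ (hv _ hL₂
              fun h => hnl ((hR.le (hle.trans inf_le_right) hL₂).trans h)),
            Or.inl ⟨rfl, rfl, Γ, pc, ℓ, hΓ.ext (hlP _), hΓ'.ext (hlQ _), hC, hpc.mono (hlP _)⟩⟩
  | assignAt x e₁ e₂ C =>
    simp only [Cmd.plug] at hC hx
    cases hC with
    | @assignAt _ _ _ S R₁ R₂ R₃ _ _ _ t₁ t₂ hvx hle hC =>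
      cases h with
      | assignAt ha h₁ h₂ =>
        obtain ⟨w₁, D₁, N₁, E₁, hs₁, hS₁, hv₁⟩ := hs.eval hL h₁ (h₂.used_subset.trans hU) t₁ hΓ hΓ'
        obtain ⟨w₂, D₂, N₂, E₂, hs₂, hS₂, hv₂⟩ := hS₁.eval hL h₂ hU t₂ hΓ hΓ'
        cases hvx with
        | var hvx =>
          obtain ⟨_, _, ha', hR⟩ := hΓ.var _ _ _ hvx
          cases ha.symm.trans ha'
          obtain ⟨w', _, hb, hR'⟩ := hΓ'.var _ _ _ hvx
          cases (toQ hR).unique hR'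
          obtain ⟨L₁, hL₁⟩ := t₁.evalRights hΓ
          obtain ⟨L₂, hL₂⟩ := t₂.evalRights hΓ
          have hlP := fun v => (Mem.StepLe.set_var (v := v) ha le_rfl).ext
          have hlQ := fun v => (Mem.StepLe.set_var (v := v) hb le_rfl).ext
          refine ⟨N₂, _, _, _, .assignAt hb E₁ E₂, hs₁.trans hs₂,
            hS₂.set (hS₂.dom_left _ _ ha) (hS₂.dom_right _ _ hb) rfl fun hnl => .var _ ?_,
            Or.inl ⟨rfl, rfl, Γ, pc, ℓ, hΓ.ext (hlP _), hΓ'.ext (hlQ _), hC, hpc.mono (hlP _)⟩⟩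
          exact (hS₂.rel.get_var (x := .run _) ha hb hnl).setAt
            ((hv₁ _ hL₁ fun h => hnl
              ((hR.le (hle.trans (inf_le_left.trans inf_le_right)) hL₁).trans h)).mono hs₂)
            (hv₂ _ hL₂ fun h => hnl ((hR.le (hle.trans inf_le_right) hL₂).trans h))
  | letKey k e C =>
    obtain rfl := hG.resolve_left id
    rw [Cmd.plug_skip] at hC
    cases hC with
    | letKey ht he hC =>
      cases h with
      | letKey hE ha =>
        obtain ⟨w, D₁, N₁, E₁, hs₁, hS₁, hv⟩ :=
          hs.eval hL hE ((Finset.subset_insert ..).trans hU) he hΓ hΓ'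
        have haP := hS₁.dom_left.eq_none ha
        have haQ' := hS₁.notMem ha (hU (Finset.mem_insert_self ..))
        have haQ := hS₁.dom_right.eq_none haQ'
        cases hv _ .top htop
        exact ⟨N₁, _, _, _, .letKey E₁ haQ', hs₁, hS₁.alloc rfl fun _ => .key _,
          Or.inl ⟨rfl, rfl, _, _, ℓ, hΓ.bindKey haP _, hΓ'.bindKey haQ _,
            by simpa only [Cmd.substOpt, Cmd.subst, Cmd.plug_skip] using
              hC.bindKey hΓ haP hpc hx',
            hpc.mono (.set_fresh _ haP)⟩⟩
  | bang C =>
    obtain rfl := hG.resolve_left id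
    rw [Cmd.plug_skip] at hC
    cases hC with
    | bang hC =>
      cases h with
      | bang =>
        exact ⟨N, _, _, _, .bang, subset_rfl, hs,
          Or.inl ⟨rfl, rfl, Γ, pc, ℓ, hΓ, hΓ', .par ((Cmd.plug_skip C).symm ▸ hC) (.bang hC), hpc⟩⟩
  | newPrin p RS C =>
    obtain rfl := hG.resolve_left id
    rw [Cmd.plug_skip] at hC
    cases hC with
    | newPrin hw ht hC =>
      cases h with
      | @newPrin _ _ _ _ _ _ κ _ hK hκ ha =>
        have hκQ := hs.notMem hκ (hU (by simp))
        have hs' := hs.use κ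
        have haQ' := hs'.notMem ha (hU (Finset.mem_insert_self ..))
        have haP := hs'.dom_left.eq_none ha
        have haQ := hs'.dom_right.eq_none haQ'
        exact ⟨N, _, _, _, .newPrin (hK.map (hs.rel.evalKey hL)) hκQ haQ', subset_rfl,
          hs'.alloc rfl fun _ => .prin _,
          Or.inl ⟨rfl, rfl, _, _, ℓ, hΓ.bindPrin haP _, hΓ'.bindPrin haQ _,
            by simpa only [Cmd.substOpt, Cmd.subst, Cmd.plug_skip] using
              hC.bindPrin hΓ haP hpc hx',
            hpc.mono (.set_fresh _ haP)⟩⟩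
  | register p e q C₁ C₂ =>
    simp only [Cmd.plug] at hC hx
    cases hC with
    | register hp he ht h₁ h₂ =>
      cases h with
      | registerTrue hP hE hk ha =>
        obtain ⟨w, D₁, N₁, E₁, hs₁, hS₁, hv⟩ :=
          hs.eval hL hE ((Finset.subset_insert ..).trans hU) he hΓ hΓ'
        have haP := hS₁.dom_left.eq_none ha
        have haQ' := hS₁.notMem ha (hU (Finset.mem_insert_self ..))
        have haQ := hS₁.dom_right.eq_none haQ'
        -- the released principal is public, hence the same in both runs
        cases hv _ .top htop
        exact ⟨N₁, _, _, _, .registerTrue (hs.rel.get_prin hL hP) E₁ hk haQ', hs₁,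
          hS₁.alloc rfl fun _ => .prin _,
          Or.inl ⟨rfl, rfl, _, _, ℓ, hΓ.bindPrin haP _, hΓ'.bindPrin haQ _,
            Cmd.subst_plug' (hG.imp_left And.left) hx' ▸ h₁.bindPrin hΓ haP hpc hx,
            hpc.mono (.set_fresh _ haP)⟩⟩
      | registerFalse hP hE hne =>
        obtain ⟨w, D₁, N₁, E₁, hs₁, hS₁, hv⟩ := hs.eval hL hE hU he hΓ hΓ'
        refine ⟨N₁, _, _, _, .registerFalse (hs.rel.get_prin hL hP) E₁ ?_, hs₁, hS₁,
          Or.inl ⟨rfl, rfl, Γ, _, ℓ, hΓ, hΓ', h₂, hpc⟩⟩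
        rintro ⟨P₁, n, rfl, hk⟩
        cases hv _ .top htop
        exact hne ⟨_, _, rfl, hk⟩
  | _ => cases h

end

/-! ### Synchronised blocks -/

/-- Neither `skip` nor a parallel composition. -/
def Cmd.IsThread : Cmd → Prop
  | .par .. | .skip => False
  | _ => True

theorem Cmd.isThread_of_mem {C t : Cmd} (h : t ∈ C.threads) : t.IsThread := by
  induction C with
  | par _ _ ih₁ ih₂ => exact (Multiset.mem_add.1 h).elim ih₁ ih₂
  | skip => exact absurd h (Multiset.notMem_zero _)
  | _ => obtain rfl := Multiset.mem_singleton.1 h; trivial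

theorem Cmd.IsThread.isAct {G : Cmd} (h : G.IsThread) (hG : G.IsBlock) : G.IsAct := by
  cases G <;> first | exact h.elim | exact hG.elim | trivial

theorem Cmd.IsBlock.threads {G : Cmd} (h : G.IsBlock) : ∀ t ∈ G.threads, t.IsBlock := by
  induction G with
  | par _ _ ih₁ ih₂ => exact fun t ht => (Multiset.mem_add.1 ht).elim (ih₁ h.1 t) (ih₂ h.2 t)
  | skip => exact fun t ht => absurd ht (Multiset.notMem_zero _)
  | _ => intro t ht; obtain rfl := Multiset.mem_singleton.1 ht; exact h

theorem CmdTyped.threads {pc : Rights} {Γ : Ctx} {C : Cmd} (h : CmdTyped pc Γ C) :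
    ∀ t ∈ C.threads, CmdTyped pc Γ t := by
  induction C with
  | par _ _ ih₁ ih₂ =>
    cases h with
    | par h₁ h₂ => exact fun t ht => (Multiset.mem_add.1 ht).elim (ih₁ h₁ t) (ih₂ h₂ t)
  | skip => exact fun t ht => absurd ht (Multiset.notMem_zero _)
  | _ => intro t ht; obtain rfl := Multiset.mem_singleton.1 ht; exact h

theorem CmdTyped.plug_threads {pc : Rights} {Γ : Ctx} {G K : Cmd} (h : CmdTyped pc Γ (G.plug K)) :
    (∀ t ∈ G.threads, CmdTyped pc Γ (t.plug K)) ∧ (G.threads = 0 → CmdTyped pc Γ K) := by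
  induction G with
  | par _ _ ih₁ ih₂ =>
    cases h with
    | par h₁ h₂ =>
      exact ⟨fun t ht => (Multiset.mem_add.1 ht).elim ((ih₁ h₁).1 t) ((ih₂ h₂).1 t),
        fun h0 => (ih₁ h₁).2 (add_eq_zero.1 h0).1⟩
  | skip => exact ⟨fun t ht => absurd ht (Multiset.notMem_zero _), fun _ => h⟩
  | _ =>
    exact ⟨fun t ht => by obtain rfl := Multiset.mem_singleton.1 ht; exact h,
      fun h0 => absurd h0 (Multiset.singleton_ne_zero _)⟩

section
variable {M M' : Mem} {χ : ChanLabels} {ℓ : Label} {G K C : Cmd}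

theorem Safe.threads (h : Safe M χ ℓ C) : ∀ t ∈ C.threads, Safe M χ ℓ t := by
  obtain ⟨Γ, pc, ℓ', hΓ, hC, hpc, hl⟩ := h
  exact fun t ht => ⟨Γ, pc, ℓ', hΓ, hC.threads t ht, hpc, hl⟩

theorem SafeBoth.threads (h : SafeBoth M M' χ C) : ∀ t ∈ C.threads, SafeBoth M M' χ t := by
  obtain ⟨Γ, pc, ℓ', hΓ, hΓ', hC, hpc⟩ := h
  exact fun t ht => ⟨Γ, pc, ℓ', hΓ, hΓ', hC.threads t ht, hpc⟩

theorem Safe.plug_threads (h : Safe M χ ℓ (G.plug K)) :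
    (∀ t ∈ G.threads, Safe M χ ℓ (t.plug K)) ∧ (G.threads = 0 → Safe M χ ℓ K) := by
  obtain ⟨Γ, pc, ℓ', hΓ, hC, hpc, hl⟩ := h
  exact ⟨fun t ht => ⟨Γ, pc, ℓ', hΓ, hC.plug_threads.1 t ht, hpc, hl⟩,
    fun h0 => ⟨Γ, pc, ℓ', hΓ, hC.plug_threads.2 h0, hpc, hl⟩⟩

theorem SafeBoth.plug_threads (h : SafeBoth M M' χ (G.plug K)) :
    (∀ t ∈ G.threads, SafeBoth M M' χ (t.plug K)) ∧ (G.threads = 0 → SafeBoth M M' χ K) := by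
  obtain ⟨Γ, pc, ℓ', hΓ, hΓ', hC, hpc⟩ := h
  exact ⟨fun t ht => ⟨Γ, pc, ℓ', hΓ, hΓ', hC.plug_threads.1 t ht, hpc⟩,
    fun h0 => ⟨Γ, pc, ℓ', hΓ, hΓ', hC.plug_threads.2 h0, hpc⟩⟩

end

/-- The names declared in a multiset of threads. -/
def declaredAll (T : Multiset Cmd) : Multiset ℕ := T.bind fun t => (t.declared : Multiset ℕ)

theorem declaredAll_cons (G : Cmd) (T : Multiset Cmd) :
    declaredAll (G ::ₘ T) = (G.declared : Multiset ℕ) + declaredAll T := Multiset.cons_bind ..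

theorem declaredAll_add (T T' : Multiset Cmd) :
    declaredAll (T + T') = declaredAll T + declaredAll T' := Multiset.add_bind ..

theorem declaredAll_threads (C : Cmd) : declaredAll C.threads = (C.declared : Multiset ℕ) := by
  induction C with
  | par _ _ ih₁ ih₂ =>
    simp only [Cmd.threads, declaredAll_add, ih₁, ih₂, Cmd.declared, Multiset.coe_add]
  | skip => rfl
  | _ => exact Multiset.singleton_bind ..

theorem mem_declaredAll {T : Multiset Cmd} {G : Cmd} (hG : G ∈ T) {x : ℕ} (hx : x ∈ G.declared) :
    x ∈ declaredAll T := Multiset.mem_bind.2 ⟨G, hG, hx⟩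

theorem Cmd.declared_substOpt (ρ : Option (ℕ × ℕ)) (K : Cmd) :
    (K.substOpt ρ).declared = K.declared := by
  rcases ρ with _ | ⟨x, a⟩
  · rfl
  · exact Cmd.declared_subst ..

theorem Local.isBlock {σ σ' : Store} {G G' : Cmd} {ρ} (h : Local σ G ρ σ' G') (hG : G.IsBlock) :
    G'.IsBlock := by
  cases h with
  | iteTrue => exact hG.1
  | iteFalse => exact hG.2
  | new => exact Cmd.isBlock_subst _ _ hG
  | assign | assignAt => exact hG
  | decryptTrue => exact Cmd.isBlock_subst _ _ hG.1
  | decryptFalse => exact hG.2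
  | registerTrue => exact Cmd.isBlock_subst _ _ hG.1
  | registerFalse => exact hG.2
  | letKey | bang | newPrin => exact hG.elim

/-- The threads `T` are those of a block that is followed by `K`; no name is declared twice. -/
structure BlockState (T : Multiset Cmd) (K : Cmd) : Prop where
  block : ∀ G ∈ T, G.IsBlock
  thread : ∀ G ∈ T, G.IsThread
  nodup : (declaredAll T + (K.declared : Multiset ℕ)).Nodup

theorem BlockState.of_sync {G C : Cmd} (hG : G.IsBlock) (h : (Cmd.sync G C).declared.Nodup) :
    BlockState G.threads C where
  block := hG.threads
  thread _ := Cmd.isThread_of_mem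
  nodup := by rw [declaredAll_threads]; exact h

theorem BlockState.headFresh {T : Multiset Cmd} {K G : Cmd} (h : BlockState T K) (hG : G ∈ T) :
    G.HeadFresh ∧ (G.plug K).HeadFresh := by
  obtain ⟨T, rfl⟩ := Multiset.exists_cons_of_mem hG
  have hn : ((G.declared : Multiset ℕ) + (K.declared : Multiset ℕ)).Nodup := by
    refine Multiset.nodup_of_le ?_ h.nodup
    rw [declaredAll_cons, add_right_comm]
    exact Multiset.le_add_right ..
  have hn : (G.declared ++ K.declared).Nodup := hn
  refine ⟨Cmd.headFresh_of_nodup hn.of_append_left, Cmd.headFresh_plug (h.block G hG) ?_ hn⟩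
  rintro rfl
  exact h.thread _ hG

theorem BlockState.declOf_add_nodup {T : Multiset Cmd} {K G G' : Cmd} {σ σ' : Store} {ρ}
    (h : BlockState (G ::ₘ T) K) (hs : Local σ G ρ σ' G') :
    (declOf ρ + (declaredAll (G'.threads + T) + (K.declared : Multiset ℕ))).Nodup := by
  refine Multiset.nodup_of_le ?_ h.nodup
  rw [declaredAll_cons, declaredAll_add, declaredAll_threads, ← add_assoc, ← add_assoc]
  refine add_le_add_left (add_le_add_left ?_ _) _
  refine hs.declared_le.resolve_left ?_
  rintro ⟨B, rfl⟩
  exact h.block _ (Multiset.mem_cons_self ..)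

theorem BlockState.step {T : Multiset Cmd} {K G G' : Cmd} {σ σ' : Store} {ρ}
    (h : BlockState (G ::ₘ T) K) (hs : Local σ G ρ σ' G') :
    BlockState (G'.threads + T) (K.substOpt ρ) where
  block t ht := (Multiset.mem_add.1 ht).elim
    ((hs.isBlock (h.block G (Multiset.mem_cons_self ..))).threads t)
    fun ht => h.block t (Multiset.mem_cons_of_mem ht)
  thread t ht := (Multiset.mem_add.1 ht).elim Cmd.isThread_of_mem
    fun ht => h.thread t (Multiset.mem_cons_of_mem ht)
  nodup := by
    rw [Cmd.declared_substOpt]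
    exact Multiset.nodup_of_le (Multiset.le_add_left ..) (h.declOf_add_nodup hs)

section
variable {T : Multiset Cmd} {K G G' G₂ : Cmd} {σ σ' : Store} {ρ : Option (ℕ × ℕ)} {M M' : Mem}
  {χ : ChanLabels} {ℓ : Label}

/-- A closed continuation is not affected by the declarations of the block. -/
theorem BlockState.substOpt_eq_of_safe (h : BlockState (G ::ₘ T) K) (hs : Local σ G ρ σ' G')
    (hK : Safe M χ ℓ K) : K.substOpt ρ = K := by
  obtain ⟨Γ, pc, _, hΓ, hK, -⟩ := hK
  have hn := h.declOf_add_nodup hs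
  rcases ρ with _ | ⟨x, a⟩
  · rfl
  · refine hK.subst_eq (hΓ.lacks x) fun hx => ?_
    exact Multiset.disjoint_left.1 (Multiset.nodup_add.1 hn).2.2 (Multiset.mem_singleton_self x)
      (Multiset.mem_add.2 (Or.inr hx))

/-- If another thread of the block is closed, its declarations cannot be used in the continuation.
-/
theorem BlockState.substOpt_eq (h : BlockState (G ::ₘ T) K) (hs : Local σ G ρ σ' G')
    (hG₂ : G₂ ∈ T) (hK : Safe M χ ℓ (G₂.plug K)) : K.substOpt ρ = K := by
  obtain ⟨Γ, pc, _, hΓ, hK, -⟩ := hK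
  have hn := h.declOf_add_nodup hs
  rcases ρ with _ | ⟨x, a⟩
  · rfl
  · have hd := Multiset.disjoint_left.1 (Multiset.nodup_add.1 hn).2.2
      (Multiset.mem_singleton_self x)
    have hx₁ : x ∉ K.declared := fun hx => hd (Multiset.mem_add.2 (Or.inr hx))
    have hx₂ : x ∉ G₂.declared := fun hx => hd (Multiset.mem_add.2 (Or.inl
      (mem_declaredAll (Multiset.mem_add.2 (Or.inr hG₂)) hx)))
    exact (Cmd.plug_subst_cancel (h.block G₂ (Multiset.mem_cons_of_mem hG₂)) hx₂
      (hK.subst_eq (hΓ.lacks x) fun hx => (Cmd.mem_declared_plug hx).elim hx₂ hx₁)).2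

theorem BlockState.safe_step (h : BlockState (G ::ₘ T) K) (hs : Local σ G ρ σ' G')
    (hd : σ.mem.Dom σ.used) (hG : Safe σ.mem χ ℓ (G.plug K)) :
    σ.mem.StepLe ℓ σ'.mem ∧ Safe σ'.mem χ ℓ (G'.plug (K.substOpt ρ)) := by
  obtain ⟨h₁, h₂⟩ := h.headFresh (Multiset.mem_cons_self ..)
  obtain ⟨Γ, pc, ℓ', hΓ, hC, hpc, hl⟩ := hG
  obtain ⟨hst, Γ₁, pc₁, ℓ₁, hs₁, hs₂, hs₃, hs₄⟩ :=
    (hs.plug (Or.inl (h.block G (Multiset.mem_cons_self ..))) h₁).safe hd hΓ hC hpc h₂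
  exact ⟨hst.mono hl, Γ₁, pc₁, ℓ₁, hs₁, hs₂, hs₃, hs₄.trans hl⟩

theorem BlockState.safe_rest (h : BlockState (G ::ₘ T) K) (hs : Local σ G ρ σ' G')
    (hM : M.Ext M') (hG₂ : G₂ ∈ T) (hK : Safe M χ ℓ (G₂.plug K)) :
    Safe M' χ ℓ (G₂.plug (K.substOpt ρ)) := by
  rw [h.substOpt_eq hs hG₂ hK]
  exact hK.ext hM

end

theorem BlockRun.raw {σ σ' : Store} {T : Multiset Cmd} {K K' : Cmd} (h : BlockRun σ T K σ' K')
    (hd : σ.mem.Dom σ.used) :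
    σ.mem.Ext σ'.mem ∧ σ'.mem.Dom σ'.used ∧ σ.used ⊆ σ'.used := by
  induction h with
  | done => exact ⟨.rfl, hd, subset_rfl⟩
  | step hs _ ih =>
    obtain ⟨h₁, h₂, h₃⟩ := hs.raw hd
    obtain ⟨h₁', h₂', h₃'⟩ := ih h₂
    exact ⟨h₁.trans h₁', h₂', h₃.trans h₃'⟩

/-- Subject reduction, confinement and uniqueness of nonces for blocks. -/
theorem BlockRun.safe {χ : ChanLabels} {ℓ : Label} {σ σ' : Store} {T : Multiset Cmd} {K K' : Cmd}
    (h : BlockRun σ T K σ' K') (hd : σ.mem.Dom σ.used) (hT : BlockState T K)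
    (hG : ∀ G ∈ T, Safe σ.mem χ ℓ (G.plug K)) (hK : T = 0 → Safe σ.mem χ ℓ K) :
    σ.mem.StepLe ℓ σ'.mem ∧ Safe σ'.mem χ ℓ K' ∧ K'.declared = K.declared ∧
      ∀ N : Set (ℕ × Value), MemConf N σ.mem → NonceLog N σ.used →
        ∃ N', N ⊆ N' ∧ NonceLog N' σ'.used ∧ MemConf N' σ'.mem := by
  induction h with
  | done => exact ⟨.rfl, hK rfl, rfl, fun N hM hN => ⟨N, subset_rfl, hN, hM⟩⟩
  | @step σ σ₁ σ' G G' ρ T K K' hs _ ih =>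
    have hG0 := hG G (Multiset.mem_cons_self ..)
    obtain ⟨h₁, h₂⟩ := hT.safe_step hs hd hG0
    obtain ⟨-, hd₁, -⟩ := hs.raw hd
    have h₂ := h₂.plug_threads
    obtain ⟨i₁, i₂, i₃, i₄⟩ := ih hd₁ (hT.step hs)
      (fun G₂ hG₂ => (Multiset.mem_add.1 hG₂).elim (h₂.1 G₂) fun hm =>
        hT.safe_rest hs h₁.ext hm (hG G₂ (Multiset.mem_cons_of_mem hm)))
      (fun h0 => h₂.2 (add_eq_zero.1 h0).1)
    refine ⟨h₁.trans i₁, i₂, i₃.trans (Cmd.declared_substOpt ..), fun N hM hN => ?_⟩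
    obtain ⟨Γ, pc, _, hΓ, hC, -⟩ := hG0
    obtain ⟨N₁, hs₁, hN₁, hM₁⟩ := (hs.plug (Or.inl (hT.block G (Multiset.mem_cons_self ..)))
      (hT.headFresh (Multiset.mem_cons_self ..)).1).conf hC hM hN
    obtain ⟨N₂, hs₂, hN₂, hM₂⟩ := i₄ N₁ hM₁ hN₁
    exact ⟨N₂, hs₁.trans hs₂, hN₂, hM₂⟩

/-- The number of actions in a block. -/
def Cmd.blockSize : Cmd → ℕ
  | .ite _ _ G₁ G₂ => G₁.blockSize + G₂.blockSize + 1
  | .new _ _ _ _ G => G.blockSize + 1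
  | .assign _ _ G => G.blockSize + 1
  | .assignAt _ _ _ G => G.blockSize + 1
  | .decrypt _ _ _ _ _ G₁ G₂ => G₁.blockSize + G₂.blockSize + 1
  | .register _ _ _ G₁ G₂ => G₁.blockSize + G₂.blockSize + 1
  | .par G₁ G₂ => G₁.blockSize + G₂.blockSize
  | _ => 0

theorem Cmd.blockSize_subst (x a : ℕ) (G : Cmd) : (G.subst x a).blockSize = G.blockSize := by
  induction G <;> simp only [Cmd.subst, Cmd.blockSize] <;> (try split_ifs) <;> simp [*]

theorem Cmd.blockSize_threads (G : Cmd) : (G.threads.map Cmd.blockSize).sum = G.blockSize := by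
  induction G <;> simp_all [Cmd.threads, Cmd.blockSize]

theorem Local.blockSize_lt {σ σ' : Store} {G G' : Cmd} {ρ} (h : Local σ G ρ σ' G')
    (hG : G.IsBlock) : G'.blockSize < G.blockSize := by
  cases h <;> first
    | exact hG.elim
    | (simp only [Cmd.blockSize, Cmd.blockSize_subst]; omega)

/-- A well-typed block can be run to completion, with fresh names outside of `U`. -/
theorem BlockState.exists_run {χ : ChanLabels} {ℓ : Label} (U : Finset ℕ) {σ : Store}
    {T : Multiset Cmd} {K : Cmd} (hT : BlockState T K) (hd : σ.mem.Dom σ.used)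
    (hG : ∀ G ∈ T, Safe σ.mem χ ℓ (G.plug K)) :
    ∃ σ' K', BlockRun σ T K σ' K' ∧ σ.mem.StepLe ℓ σ'.mem ∧ σ'.mem.Dom σ'.used ∧
      ∀ n ∈ σ'.used, n ∈ U → n ∈ σ.used := by
  obtain ⟨n, hn⟩ : ∃ n, n = (T.map Cmd.blockSize).sum := ⟨_, rfl⟩
  induction n using Nat.strong_induction_on generalizing σ T K with
  | _ n ih =>
    rcases T.empty_or_exists_mem with rfl | ⟨G, hGT⟩
    · exact ⟨σ, K, .done, .rfl, hd, fun _ hn _ => hn⟩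
    · obtain ⟨T, rfl⟩ := Multiset.exists_cons_of_mem hGT
      have hb := hT.block G hGT
      have hA := (hT.thread G hGT).isAct hb
      have hG0 := hG G hGT
      obtain ⟨Γ, pc, _, hΓ, hC, -⟩ := id hG0
      obtain ⟨ρ, σ₁, C', hstep, hf⟩ := hC.progress hΓ (hA.plug K) σ.used U
      obtain ⟨G', hs, rfl⟩ := hstep.plug_inv (Or.inl hb) hA (hT.headFresh hGT).1
      obtain ⟨h₁, h₂⟩ := hT.safe_step hs hd hG0
      obtain ⟨-, hd₁, -⟩ := hs.raw hd
      have h₂ := h₂.plug_threads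
      have hlt := hs.blockSize_lt hb
      obtain ⟨σ', K', hr, i₁, i₂, i₃⟩ := ih _ (by
          rw [hn, Multiset.map_cons, Multiset.sum_cons, Multiset.map_add, Multiset.sum_add,
            Cmd.blockSize_threads]
          exact Nat.add_lt_add_right hlt _) (hT.step hs) hd₁
        (fun G₂ hG₂ => (Multiset.mem_add.1 hG₂).elim (h₂.1 G₂) fun hm =>
          hT.safe_rest hs h₁.ext hm (hG G₂ (Multiset.mem_cons_of_mem hm))) rfl
      exact ⟨σ', K', .step hs hr, h₁.trans i₁, i₂, fun k hk hU => hf k (i₃ k hk hU) hU⟩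

/-- The relation between two runs of a block. The threads `T` are common to both runs; `H` and `J`
are the threads of the first and the second run that continue below `L`. As long as there are common
threads, the continuation is the same in both runs. The last field says that the continuation is
either common, or typed below `L` when the block is completed. -/
structure BlockSim (L : Label) (χ : ChanLabels) (M M' : Mem) (T H J : Multiset Cmd)
    (K K' : Cmd) : Prop where
  left : BlockState (T + H) K
  right : BlockState (T + J) K'
  both : ∀ G ∈ T, SafeBoth M M' χ (G.plug K)
  cont : T ≠ 0 → K = K'
  highLeft : ∀ G ∈ H, Safe M χ L (G.plug K)
  highRight : ∀ G ∈ J, Safe M' χ L (G.plug K')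
  mode : (H = 0 ∧ J = 0 ∧ K = K' ∧ (T = 0 → SafeBoth M M' χ K)) ∨ H ≠ 0 ∨ Safe M χ L K

/-- The second run can execute the same block. Afterwards the continuation is either common to both
runs, or typed below `L` in the first run. -/
theorem BlockRun.sim {L : Label} {U : Finset ℕ} (hL : L ≠ ⊤) {χ : ChanLabels} {σ σ' : Store}
    {T₀ : Multiset Cmd} {K K' : Cmd} (h : BlockRun σ T₀ K σ' K') {N : Set (ℕ × Value × Value)}
    {τ : Store} {T H J : Multiset Cmd} {KQ : Cmd} (hT₀ : T₀ = T + H) (hs : StoreSim L U N σ τ)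
    (hU : σ'.used ⊆ U) (hB : BlockSim L χ σ.mem τ.mem T H J K KQ) :
    ∃ N' τ' KQ', BlockRun τ (T + J) KQ τ' KQ' ∧ N ⊆ N' ∧ StoreSim L U N' σ' τ' ∧
      ((K' = KQ' ∧ SafeBoth σ'.mem τ'.mem χ K') ∨ Safe σ'.mem χ L K') := by
  induction h generalizing N τ T H J KQ with
  | @done σ K =>
    obtain ⟨rfl, rfl⟩ := add_eq_zero.1 hT₀.symm
    rcases hB.mode with ⟨-, rfl, rfl, hK⟩ | hH | hK
    · exact ⟨N, τ, K, .done, subset_rfl, hs, Or.inl ⟨rfl, hK rfl⟩⟩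
    · exact absurd rfl hH
    · obtain ⟨τ', KQ', hr, h₁, h₂, h₃⟩ := hB.right.exists_run U hs.dom_right (by
        rw [zero_add]; exact hB.highRight)
      exact ⟨N, τ', KQ', hr, subset_rfl, hs.right h₁ h₂ h₃, Or.inr hK⟩
  | @step σ σ₁ σ' G G' ρ T₁ K K' hstep hrun ih =>
    obtain ⟨hext, hd₁, hu₁⟩ := hstep.raw hs.dom_left
    have hU₁ := (hrun.raw hd₁).2.2.trans hU
    have hleft := hB.left
    rcases Multiset.mem_add.1 (hT₀ ▸ Multiset.mem_cons_self G T₁) with hG | hG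
    · obtain ⟨T, rfl⟩ := Multiset.exists_cons_of_mem hG
      rw [Multiset.cons_add] at hT₀ hleft
      have hright := hB.right
      rw [Multiset.cons_add] at hright
      obtain rfl := (Multiset.cons_inj_right _).1 hT₀
      obtain rfl := hB.cont Multiset.cons_ne_zero
      obtain ⟨Γ, pc, ℓ, hΓ, hΓ', hC, hpc⟩ := hB.both G hG
      have hf := hleft.headFresh (Multiset.mem_cons_self ..)
      obtain ⟨N₁, τ₁, ρ', G'', hstep', hN, hs₁, hres⟩ := hstep.sim hL hs hU₁ hΓ hΓ'
        (Or.inl (hB.left.block G (Multiset.mem_add.2 (Or.inl hG)))) hC hpc hf.2 hf.1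
      have hext' := (hstep'.raw hs.dom_right).1
      have restT : ∀ G₂ ∈ T, K.substOpt ρ = K ∧ K.substOpt ρ' = K := fun G₂ hG₂ => by
        have := (hB.both G₂ (Multiset.mem_cons_of_mem hG₂)).safe
        exact ⟨hleft.substOpt_eq hstep (Multiset.mem_add.2 (Or.inl hG₂)) this,
          hright.substOpt_eq hstep' (Multiset.mem_add.2 (Or.inl hG₂)) this⟩
      have restBoth : ∀ G₂ ∈ T, SafeBoth σ₁.mem τ₁.mem χ (G₂.plug (K.substOpt ρ)) :=
        fun G₂ hG₂ => by
          rw [(restT G₂ hG₂).1]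
          exact (hB.both G₂ (Multiset.mem_cons_of_mem hG₂)).ext hext hext'
      have restH : ∀ G₂ ∈ H, Safe σ₁.mem χ L (G₂.plug (K.substOpt ρ)) := fun G₂ hG₂ =>
        hleft.safe_rest hstep hext (Multiset.mem_add.2 (Or.inr hG₂)) (hB.highLeft G₂ hG₂)
      have restJ : ∀ G₂ ∈ J, Safe τ₁.mem χ L (G₂.plug (K.substOpt ρ')) := fun G₂ hG₂ =>
        hright.safe_rest hstep' hext' (Multiset.mem_add.2 (Or.inr hG₂)) (hB.highRight G₂ hG₂)
      rcases hres with ⟨rfl, rfl, hboth⟩ | ⟨hP, hQ⟩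
      · have hthr := hboth.plug_threads
        obtain ⟨N', τ', KQ', hr, hN', hs', hfin⟩ := ih (T := G''.threads + T) (H := H) (J := J)
          (KQ := K.substOpt ρ') (add_assoc _ _ _).symm hs₁ hU
          { left := by rw [add_assoc]; exact hleft.step hstep
            right := by rw [add_assoc]; exact hright.step hstep'
            both := fun G₂ hG₂ => (Multiset.mem_add.1 hG₂).elim (hthr.1 G₂) (restBoth G₂)
            cont := fun _ => rfl
            highLeft := restH
            highRight := restJ
            mode := by
              rcases hB.mode with ⟨h₁, h₂, -, -⟩ | h₁ | h₁
              · exact Or.inl ⟨h₁, h₂, rfl, fun h0 => hthr.2 (add_eq_zero.1 h0).1⟩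
              · exact Or.inr (Or.inl h₁)
              · rw [hleft.substOpt_eq_of_safe hstep h₁]
                exact Or.inr (Or.inr (h₁.ext hext)) }
        rw [add_assoc] at hr
        exact ⟨N', τ', KQ', by rw [Multiset.cons_add]; exact .step hstep' hr, hN.trans hN', hs',
          hfin⟩
      · have hthP := hP.plug_threads
        have hthQ := hQ.plug_threads
        obtain ⟨N', τ', KQ', hr, hN', hs', hfin⟩ := ih (T := T) (H := G'.threads + H)
          (J := G''.threads + J) (KQ := K.substOpt ρ') (add_left_comm _ _ _) hs₁ hU
          { left := by rw [add_left_comm]; exact hleft.step hstep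
            right := by rw [add_left_comm]; exact hright.step hstep'
            both := restBoth
            cont := fun h0 => by
              obtain ⟨G₂, hG₂⟩ := Multiset.exists_mem_of_ne_zero h0
              rw [(restT G₂ hG₂).1, (restT G₂ hG₂).2]
            highLeft := fun G₂ hG₂ => (Multiset.mem_add.1 hG₂).elim (hthP.1 G₂) (restH G₂)
            highRight := fun G₂ hG₂ => (Multiset.mem_add.1 hG₂).elim (hthQ.1 G₂) (restJ G₂)
            mode := by
              by_cases h0 : G'.threads = 0
              · exact Or.inr (Or.inr (hthP.2 h0))
              · exact Or.inr (Or.inl fun h => h0 (add_eq_zero.1 h).1) }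
        rw [add_left_comm] at hr
        exact ⟨N', τ', KQ', by rw [Multiset.cons_add]; exact .step hstep' hr, hN.trans hN', hs',
          hfin⟩
    · -- the second run does not take part in the step of a thread below `L`
      obtain ⟨H, rfl⟩ := Multiset.exists_cons_of_mem hG
      rw [Multiset.add_cons] at hT₀ hleft
      obtain rfl := (Multiset.cons_inj_right _).1 hT₀
      obtain ⟨h₁, h₂⟩ := hleft.safe_step hstep hs.dom_left (hB.highLeft G hG)
      have hthr := h₂.plug_threads
      have restT : ∀ G₂ ∈ T, K.substOpt ρ = K := fun G₂ hG₂ =>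
        hleft.substOpt_eq hstep (Multiset.mem_add.2 (Or.inl hG₂)) (hB.both G₂ hG₂).safe
      obtain ⟨N', τ', KQ', hr, hN', hs', hfin⟩ := ih (T := T) (H := G'.threads + H) (J := J)
        (KQ := KQ) (add_left_comm _ _ _) (hs.left h₁ hd₁ hu₁) hU
        { left := by rw [add_left_comm]; exact hleft.step hstep
          right := hB.right
          both := fun G₂ hG₂ => by
            rw [restT G₂ hG₂]; exact (hB.both G₂ hG₂).ext hext .rfl
          cont := fun h0 => by
            obtain ⟨G₂, hG₂⟩ := Multiset.exists_mem_of_ne_zero h0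
            rw [restT G₂ hG₂, hB.cont h0]
          highLeft := fun G₂ hG₂ => (Multiset.mem_add.1 hG₂).elim (hthr.1 G₂) fun hm =>
            hleft.safe_rest hstep hext (Multiset.mem_add.2 (Or.inr hm))
              (hB.highLeft G₂ (Multiset.mem_cons_of_mem hm))
          highRight := hB.highRight
          mode := by
            by_cases h0 : G'.threads = 0
            · exact Or.inr (Or.inr (hthr.2 h0))
            · exact Or.inr (Or.inl fun h => h0 (add_eq_zero.1 h).1) }
      exact ⟨N', τ', KQ', hr, hN', hs', hfin⟩

/-! ### Reductions of a thread, including synchronised blocks -/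

theorem Cmd.nodup_threads {C : Cmd} (h : C.declared.Nodup) : ∀ t ∈ C.threads, t.declared.Nodup := by
  intro t ht
  obtain ⟨T, hT⟩ := Multiset.exists_cons_of_mem ht
  have h : (C.declared : Multiset ℕ).Nodup := h
  rw [← declaredAll_threads, hT, declaredAll_cons] at h
  exact (Multiset.nodup_add.1 h).1

theorem Local.nodup {σ σ' : Store} {C C' : Cmd} {ρ} (h : Local σ C ρ σ' C')
    (hC : C.declared.Nodup) : ∀ t ∈ C'.threads, t.declared.Nodup := by
  rcases h.declared_le with ⟨B, rfl⟩ | hle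
  · cases h
    intro t ht
    rcases Multiset.mem_add.1 (show t ∈ B.threads + {Cmd.bang B} from ht) with ht | ht
    · exact Cmd.nodup_threads (C := B) hC t ht
    · obtain rfl := Multiset.mem_singleton.1 ht; exact hC
  · have hC : (C.declared : Multiset ℕ).Nodup := hC
    exact Cmd.nodup_threads (Multiset.nodup_add.1 (Multiset.nodup_of_le hle hC)).2.1

theorem ThreadStep.raw {σ σ' : Store} {C C' : Cmd} {ρ} (h : ThreadStep σ C ρ σ' C')
    (hd : σ.mem.Dom σ.used) :
    σ.mem.Ext σ'.mem ∧ σ'.mem.Dom σ'.used ∧ σ.used ⊆ σ'.used := by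
  cases h with
  | basic h => exact h.raw hd
  | sync h => exact h.raw hd

/-- Subject reduction, confinement and uniqueness of nonces for threads. -/
theorem ThreadStep.safe {χ : ChanLabels} {ℓ : Label} {σ σ' : Store} {C C' : Cmd} {ρ}
    (h : ThreadStep σ C ρ σ' C') (hd : σ.mem.Dom σ.used) (hC : Safe σ.mem χ ℓ C)
    (hn : C.declared.Nodup) :
    σ.mem.StepLe ℓ σ'.mem ∧ Safe σ'.mem χ ℓ C' ∧ (∀ t ∈ C'.threads, t.declared.Nodup) ∧
      ∀ N : Set (ℕ × Value), MemConf N σ.mem → NonceLog N σ.used →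
        ∃ N', N ⊆ N' ∧ NonceLog N' σ'.used ∧ MemConf N' σ'.mem := by
  obtain ⟨Γ, pc, ℓ', hΓ, hC, hpc, hl⟩ := hC
  cases h with
  | basic h =>
    obtain ⟨hst, Γ₁, pc₁, ℓ₁, h₁, h₂, h₃, h₄⟩ := h.safe hd hΓ hC hpc (Cmd.headFresh_of_nodup hn)
    exact ⟨hst.mono hl, ⟨Γ₁, pc₁, ℓ₁, h₁, h₂, h₃, h₄.trans hl⟩, h.nodup hn,
      fun N hM hN => h.conf hC hM hN⟩
  | sync h =>
    cases hC with
    | sync hG hC =>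
      have hs : Safe σ.mem χ ℓ (Cmd.plug _ _) := ⟨Γ, pc, ℓ', hΓ, hC, hpc, hl⟩
      obtain ⟨h₁, h₂, h₃, h₄⟩ := h.safe hd (.of_sync hG hn) hs.plug_threads.1 hs.plug_threads.2
      exact ⟨h₁, h₂, Cmd.nodup_threads (h₃ ▸ (List.nodup_append.1 hn).2.1), h₄⟩

/-- The second run can execute the same thread. Either the thread remains common to both runs, or it
continues below `L`. -/
theorem ThreadStep.sim {L : Label} {U : Finset ℕ} (hL : L ≠ ⊤) {χ : ChanLabels} {σ σ' τ : Store}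
    {C C' : Cmd} {ρ} {N : Set (ℕ × Value × Value)} (h : ThreadStep σ C ρ σ' C')
    (hs : StoreSim L U N σ τ) (hU : σ'.used ⊆ U) (hC : SafeBoth σ.mem τ.mem χ C)
    (hn : C.declared.Nodup) :
    ∃ N' τ' ρ' C'', ThreadStep τ C ρ' τ' C'' ∧ N ⊆ N' ∧ StoreSim L U N' σ' τ' ∧
      ((C' = C'' ∧ SafeBoth σ'.mem τ'.mem χ C') ∨ Safe σ'.mem χ L C') := by
  obtain ⟨Γ, pc, ℓ, hΓ, hΓ', hC, hpc⟩ := hC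
  cases h with
  | basic h =>
    have hf := Cmd.headFresh_of_nodup hn
    obtain ⟨N', τ', ρ', C'', h', hN, hs', hres⟩ := h.sim (K := .skip) hL hs hU hΓ hΓ' (Or.inr rfl)
      (by rwa [Cmd.plug_skip]) hpc (by rwa [Cmd.plug_skip]) hf
    have hskip : ∀ ρ, Cmd.substOpt ρ .skip = .skip := by rintro (_ | ⟨x, a⟩) <;> rfl
    rw [hskip, Cmd.plug_skip] at hres
    exact ⟨N', τ', ρ', C'', .basic h', hN, hs',
      hres.imp (fun h => ⟨h.2.1.symm, h.2.2⟩) fun h => h.1⟩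
  | @sync G _ _ _ h =>
    cases hC with
    | sync hG hC =>
      have hb : SafeBoth σ.mem τ.mem χ (Cmd.plug _ _) := ⟨Γ, pc, ℓ, hΓ, hΓ', hC, hpc⟩
      have hst := BlockState.of_sync hG hn
      obtain ⟨N', τ', KQ', hr, hN, hs', hres⟩ := h.sim hL (T := G.threads) (H := 0) (J := 0)
        (add_zero _).symm hs hU
        { left := by rwa [add_zero]
          right := by rwa [add_zero]
          both := hb.plug_threads.1
          cont := fun _ => rfl
          highLeft := fun G hG => absurd hG (Multiset.notMem_zero _)
          highRight := fun G hG => absurd hG (Multiset.notMem_zero _)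
          mode := Or.inl ⟨rfl, rfl, rfl, hb.plug_threads.2⟩ }
      rw [add_zero] at hr
      exact ⟨N', τ', none, KQ', .sync hr, hN, hs', hres⟩

/-! ### The relation between two runs of a system -/

/-- The relation between the threads of a device in two runs: some threads are common to both runs,
the other threads of the first run are typed below `L`, and nothing is required of the other threads
of the second run, which are never executed. -/
def DevSim (L : Label) (χ : ChanLabels) (M M' : Mem) (TP TQ : Multiset Cmd) : Prop :=
  ∃ T H J, TP = T + H ∧ TQ = T + J ∧ (∀ C ∈ T, SafeBoth M M' χ C) ∧ (∀ C ∈ H, Safe M χ L C) ∧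
    ∀ C ∈ T + H, C.declared.Nodup

section
variable {L : Label} {χ χ' : ChanLabels} {M M' M₁ M₁' : Mem} {TP TQ : Multiset Cmd} {C : Cmd}

theorem DevSim.mono (h : DevSim L χ M M' TP TQ) (hM : M.Ext M₁) (hM' : M'.Ext M₁')
    (hχ : ∀ c p, χ c = some p → χ' c = some p) : DevSim L χ' M₁ M₁' TP TQ := by
  obtain ⟨T, H, J, h₁, h₂, h₃, h₄, h₅⟩ := h
  exact ⟨T, H, J, h₁, h₂, fun C hC => (h₃ C hC).mono hM hM' hχ,
    fun C hC => (h₄ C hC).mono hM hχ, h₅⟩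

theorem DevSim.addRight (h : DevSim L χ M M' TP TQ) (J : Multiset Cmd) :
    DevSim L χ M M' TP (J + TQ) := by
  obtain ⟨T, H, J', h₁, rfl, h⟩ := h
  exact ⟨T, H, J + J', h₁, add_left_comm .., h⟩

theorem DevSim.addLeft (h : DevSim L χ M M' TP TQ) (hC : Safe M χ L C)
    (hn : ∀ t ∈ C.threads, t.declared.Nodup) : DevSim L χ M M' (C.threads + TP) TQ := by
  obtain ⟨T, H, J, rfl, rfl, h₁, h₂, h₃⟩ := h
  refine ⟨T, C.threads + H, J, add_left_comm .., rfl, h₁, fun t ht => ?_, fun t ht => ?_⟩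
  · exact (Multiset.mem_add.1 ht).elim (hC.threads t) (h₂ t)
  · rw [add_left_comm] at ht
    exact (Multiset.mem_add.1 ht).elim (hn t) (h₃ t)

theorem DevSim.addBoth (h : DevSim L χ M M' TP TQ) (hC : SafeBoth M M' χ C)
    (hn : ∀ t ∈ C.threads, t.declared.Nodup) :
    DevSim L χ M M' (C.threads + TP) (C.threads + TQ) := by
  obtain ⟨T, H, J, rfl, rfl, h₁, h₂, h₃⟩ := h
  refine ⟨C.threads + T, H, J, (add_assoc ..).symm, (add_assoc ..).symm, fun t ht => ?_, h₂,
    fun t ht => ?_⟩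
  · exact (Multiset.mem_add.1 ht).elim (hC.threads t) (h₁ t)
  · rw [add_assoc] at ht
    exact (Multiset.mem_add.1 ht).elim (hn t) (h₃ t)

/-- A thread of the first run is common to both runs or typed below `L`. -/
theorem DevSim.pick (h : DevSim L χ M M' (C ::ₘ TP) TQ) :
    C.declared.Nodup ∧ DevSim L χ M M' TP TQ ∧
      (Safe M χ L C ∨ SafeBoth M M' χ C ∧ ∃ TQ', TQ = C ::ₘ TQ' ∧ DevSim L χ M M' TP TQ') := by
  obtain ⟨T, H, J, h0, rfl, h₁, h₂, h₃⟩ := h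
  have hC : C ∈ T + H := h0 ▸ Multiset.mem_cons_self ..
  rcases Multiset.mem_add.1 hC with hC' | hC'
  · obtain ⟨T, rfl⟩ := Multiset.exists_cons_of_mem hC'
    rw [Multiset.cons_add, Multiset.cons_inj_right] at h0
    have hsim : DevSim L χ M M' TP (T + J) :=
      ⟨T, H, J, h0, rfl, fun t ht => h₁ t (Multiset.mem_cons_of_mem ht), h₂, fun t ht =>
        h₃ t (by rw [Multiset.cons_add]; exact Multiset.mem_cons_of_mem ht)⟩
    refine ⟨h₃ C hC, ?_, Or.inr ⟨h₁ C hC', T + J, Multiset.cons_add .., hsim⟩⟩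
    rw [Multiset.cons_add, ← Multiset.singleton_add]
    exact hsim.addRight _
  · obtain ⟨H, rfl⟩ := Multiset.exists_cons_of_mem hC'
    rw [Multiset.add_cons, Multiset.cons_inj_right] at h0
    exact ⟨h₃ C hC, ⟨T, H, J, h0, rfl, h₁, fun t ht => h₂ t (Multiset.mem_cons_of_mem ht),
      fun t ht => h₃ t (by rw [Multiset.add_cons]; exact Multiset.mem_cons_of_mem ht)⟩,
      Or.inl (h₂ C hC')⟩

end

/-- The relation between a device in two runs. `u` and `w` are the names generated in the runs; `N₀`
records the contents of the ciphertexts of the first run, and `N` the pairs of contents of the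
ciphertexts hidden by `L` in both runs. -/
structure Device.Sim (L : Label) (N₀ : Set (ℕ × Value)) (N : Set (ℕ × Value × Value))
    (χ : ChanLabels) (u w : Finset ℕ) (D E : Device) : Prop where
  domLeft : D.mem.Dom u
  domRight : E.mem.Dom w
  rel : MRel L N D.mem E.mem
  conf : MemConf N₀ D.mem
  threads : DevSim L χ D.mem E.mem D.threads E.threads

theorem Device.Sim.mono {L : Label} {N₀ N₀' : Set (ℕ × Value)} {N N' : Set (ℕ × Value × Value)}
    {χ χ' : ChanLabels} {u u' w w' : Finset ℕ} {D E : Device} (h : D.Sim L N₀ N χ u w E)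
    (hN₀ : N₀ ⊆ N₀') (hN : N ⊆ N') (hχ : ∀ c p, χ c = some p → χ' c = some p) (hu : u ⊆ u')
    (hw : w ⊆ w') : D.Sim L N₀' N' χ' u' w' E :=
  ⟨h.domLeft.mono hu, h.domRight.mono hw, h.rel.mono hN, h.conf.mono hN₀,
    h.threads.mono .rfl .rfl hχ⟩

variable {n : ℕ}

/-- The relation between the systems of two runs.  `U` contains all names that the first run will
generate; the second run does not generate a name in `U` before the first run. -/
structure System.Sim (L : Label) (U : Finset ℕ) (N₀ : Set (ℕ × Value))
    (N : Set (ℕ × Value × Value)) (χ : ChanLabels) (P Q : System n) : Prop where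
  dev : ∀ j, (P.dev j).Sim L N₀ N χ P.used Q.used (Q.dev j)
  log₀ : NonceLog N₀ P.used
  log : NonceLog N P.used
  fresh : ∀ n ∈ Q.used, n ∈ U → n ∈ P.used
  chan : ∀ c L₁ L₂, χ c = some (L₁, L₂) →
    c ∈ P.used ∧ P.chans c = some L₁ ∧ L₁ ≤ L₂ ∧ (¬ L₂ ≤ L → Q.chans c = some L₁)

theorem System.Sim.store {L : Label} {U : Finset ℕ} {N₀ : Set (ℕ × Value)}
    {N : Set (ℕ × Value × Value)} {χ : ChanLabels} {P Q : System n} (h : P.Sim L U N₀ N χ Q)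
    (i : Fin n) : StoreSim L U N ⟨(P.dev i).mem, P.used⟩ ⟨(Q.dev i).mem, Q.used⟩ :=
  ⟨(h.dev i).domLeft, (h.dev i).domRight, (h.dev i).rel, h.log, h.fresh⟩

theorem System.setDev_self (P : System n) (i : Fin n) (D : Device) : (P.setDev i D).dev i = D := by
  simp [System.setDev]

theorem System.setDev_ne (P : System n) {i k : Fin n} (D : Device) (h : k ≠ i) :
    (P.setDev i D).dev k = P.dev k := by
  simp [System.setDev, h]

/-- Two devices are replaced. -/
theorem System.setDev_setDev {p : Fin n → Device → Prop} (P : System n) {i j : Fin n}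
    {D D' : Device} (hij : i ≠ j) (hi : p i D) (hj : p j D')
    (h : ∀ k, k ≠ i → k ≠ j → p k (P.dev k)) :
    ∀ k, p k (((P.setDev i D).setDev j D').dev k) := by
  intro k
  by_cases hkj : k = j
  · subst hkj; rwa [System.setDev_self]
  · rw [System.setDev_ne _ _ hkj]
    by_cases hki : k = i
    · subst hki; rwa [System.setDev_self]
    · rw [System.setDev_ne _ _ hki]; exact h k hki hkj

theorem System.Step.raw {P P' : System n} (h : P.Step P') (hd : ∀ j, (P.dev j).mem.Dom P.used) :
    (∀ j, (P'.dev j).mem.Dom P'.used) ∧ (∀ j, (P.dev j).mem.Ext (P'.dev j).mem) ∧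
      P.used ⊆ P'.used := by
  suffices h : P.used ⊆ P'.used ∧
      ∀ k, (P'.dev k).mem.Dom P'.used ∧ (P.dev k).mem.Ext (P'.dev k).mem from
    ⟨fun k => (h.2 k).1, fun k => (h.2 k).2, h.1⟩
  cases h with
  | thread h =>
    obtain ⟨hT, hs⟩ := h
    rename_i i _ _ _ σ C'
    obtain ⟨h₁, h₂, h₃⟩ := hs.raw (hd i)
    refine ⟨h₃, fun j => ?_⟩
    by_cases hj : j = i
    · subst hj; rw [System.setDev_self]; exact ⟨h₂, h₁⟩
    · rw [System.setDev_ne _ _ hj]; exact ⟨(hd j).mono h₃, .rfl⟩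
  | openPub hij | openSecure hij =>
    have hu := fun c => Finset.subset_insert c P.used
    exact ⟨hu _, System.setDev_setDev (p := fun k D => D.mem.Dom _ ∧ (P.dev k).mem.Ext D.mem) _ hij
      ⟨(hd _).mono (hu _), .rfl⟩ ⟨(hd _).mono (hu _), .rfl⟩
      fun k _ _ => ⟨(hd k).mono (hu _), .rfl⟩⟩
  | @comm _ _ _ _ _ _ _ u y _ _ _ _ hij _ _ _ hE hy =>
    have hu := hE.used_subset.trans (Finset.subset_insert y u)
    exact ⟨hu, System.setDev_setDev (p := fun k D => D.mem.Dom _ ∧ (P.dev k).mem.Ext D.mem) _ hij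
      ⟨(hd _).mono hu, .rfl⟩
      ⟨((hd _).mono hu).set _ (Finset.mem_insert_self ..),
        .set_fresh _ (((hd _).mono hE.used_subset).eq_none hy)⟩
      fun k _ _ => ⟨(hd k).mono hu, .rfl⟩⟩

theorem System.Steps.raw {P P' : System n} (h : P.Steps P') (hd : ∀ j, (P.dev j).mem.Dom P.used) :
    (∀ j, (P'.dev j).mem.Dom P'.used) ∧ (∀ j, (P.dev j).mem.Ext (P'.dev j).mem) ∧
      P.used ⊆ P'.used := by
  induction h with
  | refl => exact ⟨hd, fun _ => .rfl, subset_rfl⟩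
  | tail _ hs ih =>
    obtain ⟨h₁, h₂, h₃⟩ := hs.raw ih.1
    exact ⟨h₁, fun j => (ih.2.1 j).trans (h₂ j), ih.2.2.trans h₃⟩

/-! ### Threads that use or open channels -/

section
variable {L : Label} {χ : ChanLabels} {M M' : Mem} {ℓ : Label} {C : Cmd}

theorem Safe.output {c : ℕ} {e : Expr} (h : Safe M χ ℓ (.output e (.run c) C)) :
    ∃ L₁ L₂ Γ S R, χ c = some (L₁, L₂) ∧ L₂ ≤ ℓ ∧ Safe M χ L₂ C ∧ ExprTyped Γ e S R := by
  obtain ⟨Γ, pc, ℓ', hΓ, hC, hpc, hl⟩ := h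
  cases hC with
  | output he hc hR hle hC =>
    obtain ⟨_, L₁, L₂, ⟨⟩, hχ, h₁, h₂⟩ := hΓ.chan _ _ _ _ hc
    obtain rfl := hpc.unique (hR ▸ h₂)
    exact ⟨L₁, ℓ', Γ, _, _, hχ, hl, ⟨Γ, pc, ℓ', hΓ, hC, hpc, le_rfl⟩, he⟩

theorem SafeBoth.output {c : ℕ} {e : Expr} (h : SafeBoth M M' χ (.output e (.run c) C)) :
    ∃ L₁ L₂ Γ S R Lₑ, χ c = some (L₁, L₂) ∧ L₁ ≤ Lₑ ∧ Γ.Ok M χ ∧ Γ.Ok M' χ ∧ ExprTyped Γ e S R ∧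
      EvalRights M R Lₑ ∧ SafeBoth M M' χ C := by
  obtain ⟨Γ, pc, ℓ, hΓ, hΓ', hC, hpc⟩ := h
  cases hC with
  | output he hc hR hle hC =>
    obtain ⟨_, L₁, L₂, ⟨⟩, hχ, h₁, h₂⟩ := hΓ.chan _ _ _ _ hc
    obtain ⟨Lₑ, hLₑ⟩ := he.evalRights hΓ
    exact ⟨L₁, L₂, Γ, _, _, Lₑ, hχ, h₁.le hle hLₑ, hΓ, hΓ', he, hLₑ, Γ, pc, ℓ, hΓ, hΓ', hC, hpc⟩

theorem Safe.input {c x y : ℕ} (h : Safe M χ ℓ (.input (.run c) x C)) (hx : x ∉ C.declared)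
    (hy : M y = none) (v : Value) :
    ∃ L₁ L₂, χ c = some (L₁, L₂) ∧ L₂ ≤ ℓ ∧
      Safe (M.set y (.var v L₁)) χ L₂ (C.subst x y) := by
  obtain ⟨Γ, pc, ℓ', hΓ, hC, hpc, hl⟩ := h
  cases hC with
  | input hc hR hC =>
    obtain ⟨_, L₁, L₂, ⟨⟩, hχ, h₁, h₂⟩ := hΓ.chan _ _ _ _ hc
    obtain rfl := hpc.unique (hR ▸ h₂)
    exact ⟨L₁, ℓ', hχ, hl, _, pc, ℓ', hΓ.bindVar hy _ h₁ v, hC.bindVar hΓ hy hpc h₁ hx,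
      hpc.mono (.set_fresh _ hy), le_rfl⟩

theorem SafeBoth.input {c x y : ℕ} (h : SafeBoth M M' χ (.input (.run c) x C))
    (hx : x ∉ C.declared) (hy : M y = none) (hy' : M' y = none) (v w : Value) :
    ∃ L₁ L₂, χ c = some (L₁, L₂) ∧
      SafeBoth (M.set y (.var v L₁)) (M'.set y (.var w L₁)) χ (C.subst x y) := by
  obtain ⟨Γ, pc, ℓ', hΓ, hΓ', hC, hpc⟩ := h
  cases hC with
  | input hc hR hC =>
    obtain ⟨_, L₁, L₂, ⟨⟩, hχ, h₁, h₂⟩ := hΓ.chan _ _ _ _ hc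
    obtain ⟨_, _, _, ⟨⟩, hχ', h₁', -⟩ := hΓ'.chan _ _ _ _ hc
    cases hχ.symm.trans hχ'
    exact ⟨L₁, L₂, hχ, _, pc, ℓ', hΓ.bindVar hy _ h₁ v, hΓ'.bindVar hy' _ h₁' w,
      hC.bindVar hΓ hy hpc h₁ hx, hpc.mono (.set_fresh _ hy)⟩

variable {Γ : Ctx} {c x : ℕ} {S : Ty} {R₁ R₂ : Rights} {L₁ L₂ : Label}

theorem Safe.bindChan (hC : CmdTyped R₂ (Γ.addChan x S R₁ R₂) C) (hΓ : Γ.Ok M χ)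
    (hx : x ∉ C.declared) (hc : M c = none) (hχ : χ c = none) (h₁ : EvalRights M R₁ L₁)
    (h₂ : EvalRights M R₂ L₂) :
    Safe M (Function.update χ c (some (L₁, L₂))) L₂ (C.subst x c) :=
  ⟨_, R₂, L₂, hΓ.bindChan S h₁ h₂, hC.bindChan hΓ hc hχ h₂ h₁ h₂ hx, h₂, le_rfl⟩

theorem SafeBoth.bindChan (hC : CmdTyped R₂ (Γ.addChan x S R₁ R₂) C) (hΓ : Γ.Ok M χ)
    (hΓ' : Γ.Ok M' χ) (hx : x ∉ C.declared) (hc : M c = none) (hχ : χ c = none)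
    (h₁ : EvalRights M R₁ L₁) (h₂ : EvalRights M R₂ L₂) (h₁' : EvalRights M' R₁ L₁)
    (h₂' : EvalRights M' R₂ L₂) :
    SafeBoth M M' (Function.update χ c (some (L₁, L₂))) (C.subst x c) :=
  ⟨_, R₂, L₂, hΓ.bindChan S h₁ h₂, hΓ'.bindChan S h₁' h₂', hC.bindChan hΓ hc hχ h₂ h₁ h₂ hx, h₂⟩

theorem ChanLabels.update (hχ : χ c = none) (q : Option (Label × Label)) (k : ℕ)
    (p : Label × Label) (hk : χ k = some p) : Function.update χ c q k = some p := by
  rw [Function.update_of_ne, hk]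
  rintro rfl
  cases hχ.symm.trans hk

/-- A thread `C` of the first run opens a channel. If the right of the channel is not below `L`,
then the second run can execute the same thread. -/
theorem DevSim.openChan {C' : Cmd} {TP TQ : Multiset Cmd} (h : DevSim L χ M M' (C ::ₘ TP) TQ)
    (hC : ∀ pc Γ, CmdTyped pc Γ C →
      R₁ ≤ R₂ ∧ R₂ ≤ pc ∧ CmdTyped R₂ (Γ.addChan x S R₁ R₂) C')
    (hx : C.declared = x :: C'.declared) (hc : M c = none) (hχ : χ c = none)
    (h₁ : EvalRights M R₁ L₁) (h₂ : EvalRights M R₂ L₂) (h₁' : EvalRights M' R₁ L₁)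
    (h₂' : EvalRights M' R₂ L₂) :
    L₁ ≤ L₂ ∧
      (L₂ ≤ L → DevSim L (Function.update χ c (some (L₁, L₂))) M M'
        ((C'.subst x c).threads + TP) TQ) ∧
      (¬ L₂ ≤ L → ∃ TQ', TQ = C ::ₘ TQ' ∧
        DevSim L (Function.update χ c (some (L₁, L₂))) M M'
          ((C'.subst x c).threads + TP) ((C'.subst x c).threads + TQ')) := by
  obtain ⟨hn, hrest, hcase⟩ := h.pick
  rw [hx] at hn
  obtain ⟨hx, hn⟩ := List.nodup_cons.1 hn
  have hn' := Cmd.nodup_threads (C := C'.subst x c) (by rwa [Cmd.declared_subst])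
  have hup := ChanLabels.update hχ (some (L₁, L₂))
  rcases hcase with ⟨Γ, pc, ℓ, hΓ, ht, hpc, hl⟩ | ⟨⟨Γ, pc, ℓ, hΓ, hΓ', ht, hpc⟩, TQ', hTQ, hrest'⟩
  · obtain ⟨hR, hR', ht⟩ := hC _ _ ht
    refine ⟨h₁.le hR h₂, fun hl₂ => ?_, fun hl₂ => absurd ((h₂.le hR' hpc).trans hl) hl₂⟩
    exact (hrest.mono .rfl .rfl hup).addLeft ((Safe.bindChan ht hΓ hx hc hχ h₁ h₂).le hl₂) hn'
  · obtain ⟨hR, hR', ht⟩ := hC _ _ ht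
    refine ⟨h₁.le hR h₂, fun hl₂ => ?_, fun hl₂ => ⟨TQ', hTQ, ?_⟩⟩
    · exact (hrest.mono .rfl .rfl hup).addLeft ((Safe.bindChan ht hΓ hx hc hχ h₁ h₂).le hl₂) hn'
    · exact (hrest'.mono .rfl .rfl hup).addBoth
        (SafeBoth.bindChan ht hΓ hΓ' hx hc hχ h₁ h₂ h₁' h₂') hn'

end

/-! ### Simulation of systems -/

variable {n : ℕ} {L : Label} {U : Finset ℕ} {N₀ : Set (ℕ × Value)}
  {N : Set (ℕ × Value × Value)} {χ : ChanLabels} {P P' Q : System n}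

theorem System.Sim.chan_eq_none (h : P.Sim L U N₀ N χ Q) {c : ℕ} (hc : c ∉ P.used) :
    χ c = none := by
  by_contra hχ
  obtain ⟨⟨L₁, L₂⟩, hχ⟩ := Option.ne_none_iff_exists'.mp hχ
  exact hc (h.chan c L₁ L₂ hχ).1

theorem System.RunThread.sim (hL : L ≠ ⊤) {i : Fin n} {C : Cmd} {ρ} (hs : P.RunThread i C ρ P')
    (h : P.Sim L U N₀ N χ Q) (hU : P'.used ⊆ U) :
    ∃ N₀' N' χ' Q', Q.Steps Q' ∧ P'.Sim L U N₀' N' χ' Q' := by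
  obtain ⟨hT, hs⟩ := hs
  rename_i T σ C'
  have hi := h.dev i
  obtain ⟨hn, hrest, hcase⟩ := (hT ▸ hi.threads).pick
  have hsafe : Safe (P.dev i).mem χ ⊤ C := hcase.elim (fun h => h.le le_top) fun h => h.1.safe
  obtain ⟨hext, hdom, hu⟩ := hs.raw hi.domLeft
  obtain ⟨-, -, hn', hconf⟩ := hs.safe hi.domLeft hsafe hn
  obtain ⟨N₀', hN₀, hlog₀, hconf'⟩ := hconf N₀ hi.conf h.log₀
  rcases hcase with hlow | ⟨hboth, TQ, hTQ, hrest'⟩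
  · obtain ⟨hle, hlow', -, -⟩ := hs.safe hi.domLeft hlow hn
    refine ⟨N₀', N, χ, Q, .refl, fun j => ?_, hlog₀, h.log.mono hu,
      fun n hn hU => hu (h.fresh n hn hU), fun c L₁ L₂ hc => ?_⟩
    · by_cases hj : j = i
      · subst hj
        rw [System.setDev_self]
        exact ⟨hdom, hi.domRight, hi.rel.stepLe_left hle, hconf',
          (hrest.mono hext .rfl fun _ _ => id).addLeft hlow' hn'⟩
      · rw [System.setDev_ne _ _ hj]
        exact (h.dev j).mono hN₀ subset_rfl (fun _ _ => id) hu subset_rfl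
    · obtain ⟨h₁, h₂⟩ := h.chan c L₁ L₂ hc
      exact ⟨hu h₁, h₂⟩
  · obtain ⟨N', τ, ρ', C'', hs', hN, hst, hres⟩ := hs.sim hL (h.store i) hU hboth hn
    obtain ⟨hext', -, hu'⟩ := hs'.raw hi.domRight
    refine ⟨N₀', N', χ, _, .single (.thread (.intro hTQ hs')), fun j => ?_, hlog₀, hst.log,
      hst.fresh, fun c L₁ L₂ hc => ?_⟩
    · by_cases hj : j = i
      · subst hj
        rw [System.setDev_self, System.setDev_self]
        have hrest' := hrest'.mono hext hext' fun _ _ => id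
        refine ⟨hst.dom_left, hst.dom_right, hst.rel, hconf', ?_⟩
        rcases hres with ⟨rfl, hb⟩ | hlow
        · exact hrest'.addBoth hb hn'
        · exact (hrest'.addLeft hlow hn').addRight _
      · rw [System.setDev_ne _ _ hj, System.setDev_ne _ _ hj]
        exact (h.dev j).mono hN₀ hN (fun _ _ => id) hu hu'
    · obtain ⟨h₁, h₂⟩ := h.chan c L₁ L₂ hc
      exact ⟨hu h₁, h₂⟩

/-- A new channel is established between the devices `i` and `j` of the first run. -/
theorem System.Sim.openChan (h : P.Sim L U N₀ N χ Q) {Q' : System n} {i j : Fin n} (hij : i ≠ j)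
    {c : ℕ} (hc : c ∉ P.used) {L₁ L₂ : Label} (hle : L₁ ≤ L₂) {T₁ T₂ : Multiset Cmd}
    (hu : Q.used ⊆ Q'.used) (hfresh : ∀ n ∈ Q'.used, n ∈ U → n ∈ insert c P.used)
    (hmem : ∀ k, (Q'.dev k).mem = (Q.dev k).mem)
    (hrest : ∀ k, k ≠ i → k ≠ j → (Q'.dev k).threads = (Q.dev k).threads)
    (hch : ∀ k, k ≠ c → Q'.chans k = Q.chans k) (hchc : ¬ L₂ ≤ L → Q'.chans c = some L₁)
    (d₁ : DevSim L (Function.update χ c (some (L₁, L₂))) (P.dev i).mem (Q.dev i).mem T₁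
      (Q'.dev i).threads)
    (d₂ : DevSim L (Function.update χ c (some (L₁, L₂))) (P.dev j).mem (Q.dev j).mem T₂
      (Q'.dev j).threads) :
    ((({ P with
          chans := Function.update P.chans c (some L₁)
          used := insert c P.used }.setDev i ⟨(P.dev i).mem, T₁⟩).setDev j
            ⟨(P.dev j).mem, T₂⟩)).Sim L U N₀ N (Function.update χ c (some (L₁, L₂))) Q' where
  dev := by
    have huc := Finset.subset_insert c P.used
    refine System.setDev_setDev (p := fun k D => D.Sim L N₀ N _ _ _ (Q'.dev k)) _ hij ?_ ?_ ?_
    · refine ⟨(h.dev i).domLeft.mono huc, ?_, ?_, (h.dev i).conf, ?_⟩ <;> rw [hmem]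
      exacts [(h.dev i).domRight.mono hu, (h.dev i).rel, d₁]
    · refine ⟨(h.dev j).domLeft.mono huc, ?_, ?_, (h.dev j).conf, ?_⟩ <;> rw [hmem]
      exacts [(h.dev j).domRight.mono hu, (h.dev j).rel, d₂]
    · intro k hki hkj
      have hQk : Q'.dev k = Q.dev k := by
        have h₁ := hmem k
        have h₂ := hrest k hki hkj
        cases hD : Q'.dev k
        cases hE : Q.dev k
        simp_all
      rw [hQk]
      exact (h.dev k).mono subset_rfl subset_rfl (ChanLabels.update (h.chan_eq_none hc) _) huc hu
  log₀ := h.log₀.mono (Finset.subset_insert ..)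
  log := h.log.mono (Finset.subset_insert ..)
  fresh := hfresh
  chan k L₁' L₂' hk := by
    by_cases hkc : k = c
    · subst hkc
      rw [Function.update_self] at hk
      cases hk
      exact ⟨Finset.mem_insert_self .., Function.update_self .., hle, hchc⟩
    · rw [Function.update_of_ne hkc] at hk
      obtain ⟨h₁, h₂, h₃, h₄⟩ := h.chan k L₁' L₂' hk
      exact ⟨Finset.mem_insert_of_mem h₁, (Function.update_of_ne hkc ..).trans h₂, h₃, fun hl =>
        (hch k hkc).trans (h₄ hl)⟩

theorem System.Sim.openChan_both (h : P.Sim L U N₀ N χ Q) {i j : Fin n} (hij : i ≠ j)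
    {c : ℕ} (hc : c ∉ P.used) {L₁ L₂ : Label} (hle : L₁ ≤ L₂) {T₁ T₂ T₁' T₂' : Multiset Cmd}
    (d₁ : DevSim L (Function.update χ c (some (L₁, L₂))) (P.dev i).mem (Q.dev i).mem T₁ T₁')
    (d₂ : DevSim L (Function.update χ c (some (L₁, L₂))) (P.dev j).mem (Q.dev j).mem T₂ T₂') :
    ((({ P with
          chans := Function.update P.chans c (some L₁)
          used := insert c P.used }.setDev i ⟨(P.dev i).mem, T₁⟩).setDev j
            ⟨(P.dev j).mem, T₂⟩)).Sim L U N₀ N (Function.update χ c (some (L₁, L₂)))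
      ((({ Q with
          chans := Function.update Q.chans c (some L₁)
          used := insert c Q.used }.setDev i ⟨(Q.dev i).mem, T₁'⟩).setDev j
            ⟨(Q.dev j).mem, T₂'⟩)) := by
  refine h.openChan hij hc hle (Finset.subset_insert ..) ((h.store i).use c).fresh
    (System.setDev_setDev (p := fun k D => D.mem = (Q.dev k).mem) _ hij rfl rfl fun _ _ _ => rfl)
    (fun k hki hkj => ?_) (fun k hk => Function.update_of_ne hk ..)
    (fun _ => Function.update_self ..) ?_ ?_
  · rw [System.setDev_ne _ _ hkj, System.setDev_ne _ _ hki]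
  · rwa [System.setDev_ne _ _ hij, System.setDev_self]
  · rwa [System.setDev_self]

/-- One step of the first run is matched by at most one step of the second run. -/
theorem System.Step.sim (hL : L ≠ ⊤) (hs : P.Step P') (h : P.Sim L U N₀ N χ Q)
    (hU : P'.used ⊆ U) : ∃ N₀' N' χ' Q', Q.Steps Q' ∧ P'.Sim L U N₀' N' χ' Q' := by
  have htop : ¬ (⊤ : Label) ≤ L := by simpa using hL
  have addAll : ∀ {χ M M' TP TQ C}, DevSim L χ M M' TP TQ → Safe M χ L C → C.declared.Nodup →
      DevSim L χ M M' (C.threads + TP) TQ := fun h hC hn => h.addLeft hC (Cmd.nodup_threads hn)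
  cases hs with
  | thread hs => exact hs.sim hL h hU
  | @openPub i j c₁ c₂ c S C₁ C₂ T₁ T₂ hij hTi hTj hc =>
    have hχ := h.chan_eq_none hc
    have hcQ := (h.store i).notMem hc (hU (Finset.mem_insert_self ..))
    obtain ⟨-, -, hi⟩ := (hTi ▸ (h.dev i).threads).openChan (R₁ := ⊤) (R₂ := ⊤) (x := c₁)
      (fun _ _ ht => by
        cases ht with
        | connectPub htop ht => subst htop; exact ⟨le_rfl, le_rfl, ht⟩)
      rfl ((h.dev i).domLeft.eq_none hc) hχ .top .top .top .top
    obtain ⟨-, -, hj⟩ := (hTj ▸ (h.dev j).threads).openChan (R₁ := ⊤) (R₂ := ⊤) (x := c₂)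
      (fun _ _ ht => by
        cases ht with
        | acceptPub htop ht => subst htop; exact ⟨le_rfl, le_rfl, ht⟩)
      rfl ((h.dev j).domLeft.eq_none hc) hχ .top .top .top .top
    obtain ⟨TQi, hQi, hdi⟩ := hi htop
    obtain ⟨TQj, hQj, hdj⟩ := hj htop
    exact ⟨N₀, N, _, _, .single (.openPub hij hQi hQj hcQ),
      h.openChan_both hij hc le_rfl hdi hdj⟩
  | @openSecure i j c₁ c₂ c S R₁ R₂ R₁' R₂' kc ks ps pc C₁ C₂ T₁ T₂ Ps Pc L₁ L₂ hij hTi hTj hps hpc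
      h₁ h₁' h₂ h₂' hkc hks hc =>
    have hχ := h.chan_eq_none hc
    have hcQ := (h.store i).notMem hc (hU (Finset.mem_insert_self ..))
    have toQ : ∀ {k R l}, EvalRights (P.dev k).mem R l → EvalRights (Q.dev k).mem R l :=
      fun {k _ _} hR => hR.map ((h.dev k).rel.evalKey hL)
    obtain ⟨hle, hi, hi'⟩ := (hTi ▸ (h.dev i).threads).openChan (x := c₁) (C' := C₁)
      (by rintro _ _ ⟨⟩; exact ⟨‹R₁ ≤ R₂›, ‹R₂ ≤ _›, ‹_›⟩)
      rfl ((h.dev i).domLeft.eq_none hc) hχ h₁ h₂ (toQ h₁) (toQ h₂)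
    obtain ⟨-, hj, hj'⟩ := (hTj ▸ (h.dev j).threads).openChan (x := c₂) (C' := C₂)
      (by rintro _ _ ⟨⟩; exact ⟨‹R₁' ≤ R₂'›, ‹R₂' ≤ _›, ‹_›⟩)
      rfl ((h.dev j).domLeft.eq_none hc) hχ h₁' h₂' (toQ h₁') (toQ h₂')
    by_cases hl : L₂ ≤ L
    · exact ⟨N₀, N, _, Q, .refl, h.openChan hij hc hle subset_rfl
        (fun n hn hU => Finset.mem_insert_of_mem (h.fresh n hn hU)) (fun _ => rfl)
        (fun _ _ _ => rfl) (fun _ _ => rfl) (fun hl' => absurd hl hl') (hi hl) (hj hl)⟩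
    · obtain ⟨TQi, hQi, hdi⟩ := hi' hl
      obtain ⟨TQj, hQj, hdj⟩ := hj' hl
      exact ⟨N₀, N, _, _, .single (.openSecure hij hQi hQj ((h.dev i).rel.get_prin hL hps)
        ((h.dev j).rel.get_prin hL hpc) (toQ h₁) (toQ h₁') (toQ h₂) (toQ h₂')
        ((h.dev i).rel.get_key hL hkc) ((h.dev j).rel.get_key hL hks) hcQ),
        h.openChan_both hij hc hle hdi hdj⟩
  | @comm i j c Lc e x v u y C₁ C₂ T₁ T₂ hij hch hTi hTj hE hy =>
    obtain ⟨hni, hdi, hi⟩ := (hTi ▸ (h.dev i).threads).pick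
    obtain ⟨hnj, hdj, hj⟩ := (hTj ▸ (h.dev j).threads).pick
    have hni : C₁.declared.Nodup := hni
    obtain ⟨hx, hnj⟩ : x ∉ C₂.declared ∧ C₂.declared.Nodup := List.nodup_cons.1 hnj
    have hnj' : (C₂.subst x y).declared.Nodup := by rwa [Cmd.declared_subst]
    have hsi : Safe (P.dev i).mem χ ⊤ _ := hi.elim (fun h => h.le le_top) fun h => h.1.safe
    have hsj : Safe (P.dev j).mem χ ⊤ _ := hj.elim (fun h => h.le le_top) fun h => h.1.safe
    have hu := hE.used_subset
    have huy := hu.trans (Finset.subset_insert y u)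
    have hyj := ((h.dev j).domLeft.mono hu).eq_none hy
    obtain ⟨L₁, L₂, Γ, S, R, hχ, -, hC₁, he⟩ := hsi.output
    obtain ⟨_, _, hχ', -, hC₂⟩ := hsj.input hx hyj v
    cases hχ.symm.trans hχ'
    obtain ⟨-, hch', hle, hchQ⟩ := h.chan c L₁ L₂ hχ
    cases hch.symm.trans hch'
    obtain ⟨N₀', hN₀, hlog₀, hv⟩ := hE.conf he (h.dev i).conf h.log₀
    have hlog₀ := hlog₀.mono (Finset.subset_insert y u)
    have hconf : MemConf N₀' ((P.dev j).mem.set y (.var v Lc)) :=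
      ((h.dev j).conf.mono hN₀).set _ (by rintro _ _ ⟨⟩; exact hv)
    have hdomj : ((P.dev j).mem.set y (.var v Lc)).Dom (insert y u) :=
      ((h.dev j).domLeft.mono huy).set _ (Finset.mem_insert_self ..)
    have hext := Mem.Ext.set_fresh (.var v Lc) hyj
    by_cases hl : L₂ ≤ L
    · have hst : (P.dev j).mem.StepLe L _ := .set_fresh (c := .var v Lc) (hle.trans hl) hyj
      refine ⟨N₀', N, χ, Q, .refl, System.setDev_setDev
        (p := fun k D => D.Sim L N₀' N χ _ _ (Q.dev k)) _ hij ?_ ?_ ?_, hlog₀, h.log.mono huy,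
        fun n hn hU => huy (h.fresh n hn hU), fun k K₁ K₂ hk => ?_⟩
      · exact ⟨(h.dev i).domLeft.mono huy, (h.dev i).domRight, (h.dev i).rel,
          (h.dev i).conf.mono hN₀, addAll hdi (hC₁.le hl) hni⟩
      · exact ⟨hdomj, (h.dev j).domRight, (h.dev j).rel.stepLe_left hst, hconf,
          addAll (hdj.mono hext .rfl fun _ _ => id) (hC₂.le hl) hnj'⟩
      · exact fun k _ _ => (h.dev k).mono hN₀ subset_rfl (fun _ _ => id) huy subset_rfl
      · obtain ⟨h₁, h₂⟩ := h.chan k K₁ K₂ hk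
        exact ⟨huy h₁, h₂⟩
    · rcases hi with hi | ⟨hbi, TQi, hQi, hdi⟩
      · obtain ⟨_, _, _, _, _, hχ', hl', -⟩ := hi.output
        cases hχ.symm.trans hχ'
        exact absurd hl' hl
      rcases hj with hj | ⟨hbj, TQj, hQj, hdj⟩
      · obtain ⟨_, _, hχ', hl', -⟩ := hj.input hx hyj v
        cases hχ.symm.trans hχ'
        exact absurd hl' hl
      obtain ⟨_, _, Γ, S, R, Lₑ, hχ', hle', hΓ, hΓ', he, hR, hbi⟩ := hbi.output
      cases hχ.symm.trans hχ'
      obtain ⟨w, D, N', hE', hN, hst, hv⟩ := (h.store i).eval hL hE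
        ((Finset.subset_insert ..).trans hU) he hΓ hΓ'
      have hyD := hst.notMem hy (hU (Finset.mem_insert_self ..))
      have hw := hE'.used_subset
      have hwy := hw.trans (Finset.subset_insert y D)
      have hyj' := ((h.dev j).domRight.mono hw).eq_none hyD
      obtain ⟨_, _, hχ', hbj⟩ := hbj.input hx hyj hyj' v w
      cases hχ.symm.trans hχ'
      have hext' := Mem.Ext.set_fresh (.var w Lc) hyj'
      refine ⟨N₀', N', χ, _, .single (.comm hij (hchQ hl) hQi hQj hE' hyD), System.setDev_setDev
        (p := fun k D => D.Sim L N₀' N' χ _ _ (System.dev _ k)) _ hij ?_ ?_ ?_, hlog₀,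
        (hst.use y).log, (hst.use y).fresh, fun k K₁ K₂ hk => ?_⟩
      · rw [System.setDev_ne _ _ hij, System.setDev_self]
        exact ⟨(h.dev i).domLeft.mono huy, (h.dev i).domRight.mono hwy, (h.dev i).rel.mono hN,
          (h.dev i).conf.mono hN₀, hdi.addBoth hbi (Cmd.nodup_threads hni)⟩
      · rw [System.setDev_self]
        exact ⟨hdomj, ((h.dev j).domRight.mono hwy).set _ (Finset.mem_insert_self ..),
          ((h.dev j).rel.mono hN).set y rfl fun hl' =>
            .var Lc (hv Lₑ hR fun h' => hl' (hle'.trans h')),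
          hconf, (hdj.mono hext hext' fun _ _ => id).addBoth hbj (Cmd.nodup_threads hnj')⟩
      · intro k hki hkj
        rw [System.setDev_ne _ _ hkj, System.setDev_ne _ _ hki]
        exact (h.dev k).mono hN₀ hN (fun _ _ => id) huy hwy
      · obtain ⟨h₁, h₂⟩ := h.chan k K₁ K₂ hk
        exact ⟨huy h₁, h₂⟩

variable {n : ℕ} {L : Label} {U : Finset ℕ} {N₀ : Set (ℕ × Value)}
  {N : Set (ℕ × Value × Value)} {χ : ChanLabels} {P P' Q : System n}

theorem System.Steps.sim (hL : L ≠ ⊤) (hs : P.Steps P') (h : P.Sim L U N₀ N χ Q)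
    (hU : P'.used ⊆ U) : ∃ N₀' N' χ' Q', Q.Steps Q' ∧ P'.Sim L U N₀' N' χ' Q' := by
  induction hs using Relation.ReflTransGen.head_induction_on generalizing N₀ N χ Q with
  | refl => exact ⟨N₀, N, χ, Q, .refl, h⟩
  | head hs hs' ih =>
    obtain ⟨hd, -, -⟩ := hs.raw fun j => (h.dev j).domLeft
    obtain ⟨_, _, _, Q₁, hQ, h₁⟩ := hs.sim hL h ((System.Steps.raw hs' hd).2.2.trans hU)
    obtain ⟨N₀', N', χ', Q', hQ', h'⟩ := ih h₁
    exact ⟨N₀', N', χ', Q', hQ.trans hQ', h'⟩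

/-- Related systems agree below `L`. -/
theorem System.Sim.lowIn (h : P.Sim L U N₀ N χ Q) : P.LowIn L Q ∧ Q.LowIn L P := by
  constructor
  · intro j y Ly v hv hl
    obtain ⟨c, hc, hr⟩ := (h.dev j).rel.left y _ hv hl
    cases hr with
    | var _ hr => exact ⟨_, hc, hr.erase_eq⟩
  · intro j y Ly v hv hl
    obtain ⟨c, hc, hr⟩ := (h.dev j).rel.right y _ hv hl
    cases hr with
    | var _ hr => exact ⟨_, hc, hr.erase_eq.symm⟩

/-! ### Initial systems and the change of a variable -/

/-- An initial system has no variables and no channels, so it is related to itself. -/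
theorem System.ValidInitial.sim (h : P.ValidInitial) (L : Label) (U : Finset ℕ) :
    P.Sim L U ∅ ∅ (fun _ => none) P where
  dev j := by
    have hM := h.memory j
    refine ⟨fun a c hc => (hM a c hc).1, fun a c hc => (hM a c hc).1, ?_, ?_, ?_⟩
    · have : ∀ a c, (P.dev j).mem a = some c → c.Rel L ∅ c := fun a c hc => by
        obtain ⟨-, κ, -, rfl | rfl⟩ := hM a c hc <;> constructor
      exact ⟨fun a c hc _ => ⟨c, hc, this a c hc⟩, fun a c hc _ => ⟨c, hc, this a c hc⟩⟩
    · intro a v Lx hv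
      obtain ⟨-, κ, -, h | h⟩ := hM a _ hv <;> cases h
    · obtain ⟨C, hC, hn, ht⟩ := h.typed j
      have hΓ : (Ctx.ofMem (P.dev j).mem).Ok (P.dev j).mem fun _ => none :=
        ⟨fun _ h => h, fun _ h => h, by rintro _ _ _ ⟨⟩, by rintro _ _ _ _ ⟨⟩⟩
      have hb : SafeBoth (P.dev j).mem (P.dev j).mem (fun _ => none) C :=
        ⟨_, ⊤, ⊤, hΓ, hΓ, ht, .top⟩
      rw [hC]
      refine ⟨C.threads, 0, 0, (add_zero _).symm, (add_zero _).symm, hb.threads,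
        fun _ h => absurd h (Multiset.notMem_zero _), ?_⟩
      rw [add_zero]
      exact Cmd.nodup_threads hn
  log₀ := ⟨fun _ _ _ h => absurd h (Set.notMem_empty _), fun _ h => absurd h (Set.notMem_empty _)⟩
  log := ⟨fun _ _ _ h => absurd h (Set.notMem_empty _), fun _ h => absurd h (Set.notMem_empty _)⟩
  fresh _ hn _ := hn
  chan _ _ _ h := by cases h

/-- The first run of a simulation can be compared with a copy whose memories differ from it below
`L`. All ciphertexts that exist at this point have the same contents in both runs. -/
theorem System.Sim.restart {Q₀ : System n} {U₀ : Finset ℕ} (h : P.Sim L U₀ N₀ N χ Q₀)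
    (U : Finset ℕ) (hu : Q.used = P.used) (hc : Q.chans = P.chans)
    (ht : ∀ j, (Q.dev j).threads = (P.dev j).threads)
    (hd : ∀ j, (Q.dev j).mem.Dom P.used) (hM : ∀ j, (P.dev j).mem.StepLe L (Q.dev j).mem) :
    P.Sim L U N₀ {p | p.2.1 = p.2.2 ∧ (p.1, p.2.1) ∈ N₀} χ Q where
  dev j := by
    have hj := h.dev j
    refine ⟨hj.domLeft, hu ▸ hd j, MRel.stepLe_right ?_ (hM j), hj.conf, ?_⟩
    · have : ∀ a c, (P.dev j).mem a = some c →
          c.Rel L {p | p.2.1 = p.2.2 ∧ (p.1, p.2.1) ∈ N₀} c := by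
        intro a c hc
        cases c with
        | var v Lx => exact .var Lx ((hj.conf a v Lx hc).vRel fun _ _ h => ⟨rfl, h⟩)
        | prin P => exact .prin P
        | key κ => exact .key κ
      exact ⟨fun a c hc _ => ⟨c, hc, this a c hc⟩, fun a c hc _ => ⟨c, hc, this a c hc⟩⟩
    · obtain ⟨T, H, J, hP, -, hT, hH, hn⟩ := hj.threads
      rw [ht, hP]
      refine ⟨T + H, 0, 0, (add_zero _).symm, (add_zero _).symm, fun C hC => ?_,
        fun _ h => absurd h (Multiset.notMem_zero _), by rwa [add_zero]⟩
      obtain ⟨Γ, pc, ℓ, hΓ, hC, hpc, -⟩ : Safe (P.dev j).mem χ ⊤ C :=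
        (Multiset.mem_add.1 hC).elim (fun h => (hT C h).safe) fun h => (hH C h).le le_top
      exact ⟨Γ, pc, ℓ, hΓ, hΓ.ext (hM j).ext, hC, hpc⟩
  log₀ := h.log₀
  log :=
    ⟨fun n ⟨p, p'⟩ ⟨q, q'⟩ ⟨hp, hp'⟩ ⟨hq, hq'⟩ => by
      cases hp; cases hq; cases h.log₀.functional n _ _ hp' hq'; rfl,
      fun p hp => h.log₀.used _ hp.2⟩
  fresh n hn _ := hu ▸ hn
  chan c L₁ L₂ hχ := by
    obtain ⟨h₁, h₂, h₃, -⟩ := h.chan c L₁ L₂ hχ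
    exact ⟨h₁, h₂, h₃, fun _ => by rw [hc, h₂]⟩

/-- The assignment `a := v` can be executed; it changes nothing but the value of `a`. -/
theorem System.exists_runThread_assignValue (P : System n) (i : Fin n) {a : ℕ} {w : Value}
    (ha : (P.dev i).mem a = some (.var w L)) (v : Value) :
    ∃ Q, RunThread i (assignValue a v) none (P.withAssign i a v) Q ∧ Q.used = P.used ∧
      Q.chans = P.chans ∧ (∀ j, (Q.dev j).threads = (P.dev j).threads) ∧
      ∀ j, (Q.dev j).mem = (P.dev j).mem ∨
        j = i ∧ (Q.dev j).mem = (P.dev j).mem.set a (.var v L) := by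
  have hi : (P.withAssign i a v).dev i = ⟨(P.dev i).mem, assignValue a v ::ₘ (P.dev i).threads⟩ :=
    System.setDev_self ..
  have hthr : ((P.withAssign i a v).dev i).threads = assignValue a v ::ₘ (P.dev i).threads := by
    rw [hi]
  refine ⟨_, .intro hthr (.basic (.assign (by rw [hi]; exact ha) .lit)), rfl, rfl, fun j => ?_,
    fun j => ?_⟩ <;> by_cases hj : j = i
  · subst hj
    rw [System.setDev_self]
    exact zero_add _
  · rw [System.setDev_ne _ _ hj]
    exact congrArg Device.threads (System.setDev_ne P _ hj)
  · subst hj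
    rw [System.setDev_self, hi]
    exact Or.inr ⟨rfl, rfl⟩
  · rw [System.setDev_ne _ _ hj]
    exact Or.inl (congrArg Device.mem (System.setDev_ne P _ hj))

end CloudTypes

theorem mainTheorem2 {n : ℕ} (P P₀ P₁ P' P'' : CloudTypes.System n)
    (hP : P.ValidInitial) (h₀ : P.Steps P₀)
    (i : Fin n) (x : ℕ) (S : CloudTypes.Ty) (R : CloudTypes.Rights) (e : CloudTypes.Expr)
    (C : CloudTypes.Cmd) (a : ℕ) (L : CloudTypes.Label)
    (hR : CloudTypes.EvalRights (P₀.dev i).mem R L)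
    (hnew : CloudTypes.System.RunThread i (CloudTypes.Cmd.new x S R e C) (some (x, a)) P₀ P₁)
    (h' : P₁.Steps P') (v : CloudTypes.Value) (hv : v.HasType S) (h'' : P'.Steps P'') :
    ∃ Q' Q'' : CloudTypes.System n,
      CloudTypes.System.RunThread i (CloudTypes.assignValue a v) none (P'.withAssign i a v) Q' ∧
      Q'.Steps Q'' ∧ P''.LowIn L Q'' ∧ Q''.LowIn L P'' := by
  have hsteps : P.Steps P' := h₀.trans (.head (.thread hnew) h')
  have hd : ∀ j, (P.dev j).mem.Dom P.used := fun j b c hc => (hP.memory j b c hc).1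
  have hd₀ := (h₀.raw hd).1
  have hd₁ := (CloudTypes.System.Step.thread hnew).raw hd₀
  obtain ⟨hd', hext, -⟩ := h'.raw hd₁.1
  have ha₁ : ∃ w, (P₁.dev i).mem a = some (.var w L) := by
    obtain ⟨hT, hs⟩ := hnew
    rw [CloudTypes.System.setDev_self]
    cases hs with
    | basic hs =>
      cases hs with
      | new _ hR' _ =>
        obtain rfl := hR.unique hR'
        exact ⟨_, CloudTypes.Mem.set_self ..⟩
  obtain ⟨w, ha⟩ : ∃ w, (P'.dev i).mem a = some (.var w L) := by
    obtain ⟨w, hw⟩ := ha₁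
    exact (hext i).get_var (x := .run a) hw
  obtain ⟨Q', hrun, hu, hc, ht, hm⟩ := P'.exists_runThread_assignValue i ha v
  by_cases hL : L = ⊤
  · -- no location has rights that are not below the public right
    subst hL
    exact ⟨Q', Q', hrun, .refl, fun _ _ _ _ _ hl => absurd le_top hl,
      fun _ _ _ _ _ hl => absurd le_top hl⟩
  · obtain ⟨_, _, _, _, -, hsim⟩ := hsteps.sim hL (hP.sim L P'.used) subset_rfl
    have hsim := hsim.restart P''.used hu hc ht
      (fun j => by
        rcases hm j with h | ⟨rfl, h⟩ <;> rw [h]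
        · exact hd' j
        · exact (hd' j).set _ (hd' j a _ ha))
      (fun j => by
        rcases hm j with h | ⟨rfl, h⟩ <;> rw [h]
        · exact .rfl
        · exact .set_var ha le_rfl)
    obtain ⟨_, _, _, Q'', hQ, hsim⟩ := h''.sim hL hsim subset_rfl
    exact ⟨Q', Q'', hrun, hQ, hsim.lowIn⟩
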